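/- Let $(X,\mathcal X)$ be a measurable space, let $\mu$ be a complex measure on it, and let $|\mu|$ be its total variation. Let $u$ be a symmetric measurable function on $X\times X$ whose values are complex numbers, except that the real part of $u$ may also take the value $+\infty$. Put $$\zeta(x,y)=e^{-u(x,y)}-1,$$ with $\zeta(x,y)=-1$ where $\operatorname{Re}u(x,y)=+\infty$, and let $\overline u(x,y)=u(x,y)$ where $\operatorname{Re}u(x,y)\neq+\infty$ and $\overline u(x,y)=1$ where $\operatorname{Re}u(x,y)=+\infty$. Let $a,b:X\to[0,\infty)$ be measurable functions such that: (i) for every $n$ and for $|\mu|^{\otimes n}$-almost all $(x_1,\dots,x_n)$, $\ \prod_{1\le i<j\le n}|1+\zeta(x_i,x_j)|\le\prod_{i=1}^n e^{b(x_i)}$; (ii) either $\int d|\mu|(y)\,|\zeta(x,y)|\,e^{a(y)+2b(y)}\le a(x)$ for $|\mu|$-almost all $x$, or $\int d|\mu|(y)\,|\overline u(x,y)|\,e^{a(y)+b(y)}\le a(x)$ for $|\mu|$-almost all $x$; (iii) $\int d|\mu|(y)\,e^{a(y)+2b(y)}<\infty$. For $n\ge1$ let $$\varphi(x_1,\dots,x_n)=\frac1{n!}\sum_{G\in\mathcal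 C_n}\ \prod_{\{i,j\}\in G}\zeta(x_i,x_j),$$ where $\mathcal C_n$ is the set of connected graphs (unoriented, without loops) on the vertex set $\{1,\dots,n\}$; thus $\varphi(x_1)=1$. Define $$Z=\sum_{n\ge0}\frac1{n!}\int d\mu(x_1)\cdots\int d\mu(x_n)\prod_{1\le i<j\le n}(1+\zeta(x_i,x_j)),$$ $$Z(x_1)=\sum_{n\ge1}\frac1{(n-1)!}\int d\mu(x_2)\cdots\int d\mu(x_n)\prod_{1\le i<j\le n}(1+\zeta(x_i,x_j)),$$ $$Z(x_1,x_2)=\sum_{n\ge2}\frac1{(n-2)!}\int d\mu(x_3)\cdots\int d\mu(x_n)\prod_{1\le i<j\le n}(1+\zeta(x_i,x_j)),$$ $$\hat Z(x_1)=\sum_{n\ge1}n\int d\mu(x_2)\cdots\int d\mu(x_n)\,\varphi(x_1,\dots,x_n),$$ $$\hat Z(x_1,x_2)=\sum_{n\ge2}n(n-1)\int d\mu(x_3)\cdots\int d\mu(x_n)\,\varphi(x_1,\dots,x_n),$$ where a term without integrals is the value of its integrand (in particular, the term $n=0$ of $Z$ and the term $n=1$ of $Z(x_1)$ are $1$). Then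 every integrand in $Z$ is $|\mu|^{\otimes n}$-integrable, the series $Z$ converges absolutely, and $Z\neq0$. For $|\mu|$-almost all $x_1$, all integrands in $Z(x_1)$ and $\hat Z(x_1)$ are integrable with respect to the corresponding power of $|\mu|$, both series converge absolutely (as series of complex numbers), and $$\frac{Z(x_1)}{Z}=\hat Z(x_1).$$ For $|\mu|\otimes|\mu|$-almost all $(x_1,x_2)$, all integrands in $Z(x_1,x_2)$ and $\hat Z(x_1,x_2)$ are integrable with respect to the corresponding power of $|\mu|$, both series converge absolutely (as series of complex numbers), and $$\frac{Z(x_1,x_2)}{Z}=\hat Z(x_1)\,\hat Z(x_2)+\hat Z(x_1,x_2).$$ In particular, for $|\mu|\otimes|\mu|$-almost all $(x_1,x_2)$, the truncated two-point correlation function is $$\frac{Z(x_1,x_2)}{Z}-\frac{Z(x_1)\,Z(x_2)}{Z^2}=\hat Z(x_1,x_2).$$ -/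

import Mathlib

open MeasureTheory
open scoped ENNReal

noncomputable section

namespace ClusterExpansion

/-- A measurable symmetric pair interaction `u` on `X × X`, given by its real part, which may take
the value `+∞` (but not `-∞`), and its imaginary part. -/
structure PairInteraction (X : Type*) [MeasurableSpace X] where
  re : X → X → EReal
  im : X → X → ℝ
  re_ne_bot : ∀ x y, re x y ≠ ⊥
  re_symm : ∀ x y, re x y = re y x
  im_symm : ∀ x y, im x y = im y x
  measurable_re : Measurable fun p : X × X => re p.1 p.2
  measurable_im : Measurable fun p : X × X => im p.1 p.2

variable {X : Type*} [MeasurableSpace X]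

namespace PairInteraction

/-- The complex number `u(x,y)` when `Re u(x,y)` is finite. -/
def val (u : PairInteraction X) (x y : X) : ℂ :=
  ((u.re x y).toReal : ℂ) + (u.im x y : ℂ) * Complex.I

open Classical in
/-- `ζ(x,y) = exp(-u(x,y)) - 1`, equal to `-1` where `Re u(x,y) = +∞`. -/
def zeta (u : PairInteraction X) (x y : X) : ℂ :=
  if u.re x y = ⊤ then -1 else Complex.exp (-u.val x y) - 1

open Classical in
/-- `ū(x,y)`: equal to `u(x,y)` where `Re u(x,y)` is finite, and to `1` where it is `+∞`. -/
def ubar (u : PairInteraction X) (x y : X) : ℂ :=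
  if u.re x y = ⊤ then 1 else u.val x y

/-- `∏_{i<j} (1 + ζ(x_i, x_j))`. -/
def weight (u : PairInteraction X) {n : ℕ} (x : Fin n → X) : ℂ :=
  ∏ p : Fin n × Fin n with p.1 < p.2, (1 + u.zeta (x p.1) (x p.2))

open Classical in
/-- `φ(x_1, …, x_n) = (1/n!) ∑_{G} ∏_{{i,j} ∈ G} ζ(x_i, x_j)`, the sum being over the connected
graphs `G` on `n` labelled vertices. The edges of `G` are enumerated as the pairs `i < j` that are
adjacent in `G`. For `n = 1` the value is `1`. -/
def phi (u : PairInteraction X) {n : ℕ} (x : Fin n → X) : ℂ :=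
  (1 / (n.factorial : ℂ)) *
    ∑ G : SimpleGraph (Fin n) with G.Connected,
      ∏ p : Fin n × Fin n with p.1 < p.2 ∧ G.Adj p.1 p.2, u.zeta (x p.1) (x p.2)

end PairInteraction

/-- The iterated integral `∫ dμ(x_1) ⋯ ∫ dμ(x_n) F(x_1, …, x_n)` of a complex function against a
complex measure; for `n = 0` it is the value of `F` at the empty tuple. -/
def iterInt (μ : ComplexMeasure X) : (n : ℕ) → ((Fin n → X) → ℂ) → ℂ
  | 0, F => F ![]
  | n + 1, F =>
      VectorMeasure.integral μ (fun x => iterInt μ n fun y => F (Matrix.vecCons x y))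
        (ContinuousLinearMap.mul ℝ ℂ)

/-- The product measure `|μ| ⊗ ⋯ ⊗ |μ|` on `n`-tuples, `|μ|` being the total variation of `μ`. -/
def absPi (μ : ComplexMeasure X) (n : ℕ) : Measure (Fin n → X) :=
  Measure.pi fun _ => μ.variation

/-- Stability: for every `n` and almost all `x_1, …, x_n`,
`∏_{i<j} |1 + ζ(x_i, x_j)| ≤ ∏_i exp(b(x_i))`. -/
def Stable (μ : ComplexMeasure X) (u : PairInteraction X) (b : X → ℝ) : Prop :=
  ∀ n : ℕ, ∀ᵐ x ∂(absPi μ n),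
    ∏ p : Fin n × Fin n with p.1 < p.2, ‖1 + u.zeta (x p.1) (x p.2)‖ ≤ ∏ i, Real.exp (b (x i))

/-- For almost all `x`, `∫ d|μ|(y) |ζ(x,y)| exp(a(y) + 2 b(y)) ≤ a(x)`. -/
def ZetaCriterion (μ : ComplexMeasure X) (u : PairInteraction X) (a b : X → ℝ) : Prop :=
  ∀ᵐ x ∂μ.variation,
    ∫⁻ y, ENNReal.ofReal (‖u.zeta x y‖ * Real.exp (a y + 2 * b y)) ∂μ.variation
      ≤ ENNReal.ofReal (a x)

/-- For almost all `x`, `∫ d|μ|(y) |ū(x,y)| exp(a(y) + b(y)) ≤ a(x)`. -/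
def UbarCriterion (μ : ComplexMeasure X) (u : PairInteraction X) (a b : X → ℝ) : Prop :=
  ∀ᵐ x ∂μ.variation,
    ∫⁻ y, ENNReal.ofReal (‖u.ubar x y‖ * Real.exp (a y + b y)) ∂μ.variation
      ≤ ENNReal.ofReal (a x)

/-! In the series below `n` is the number of points that are integrated, so that the total number
of points is `n`, `n + 1` or `n + 2`. -/

/-- Terms of the partition function `Z`. -/
def ZTerm (μ : ComplexMeasure X) (u : PairInteraction X) (n : ℕ) : ℂ :=
  (1 / (n.factorial : ℂ)) * iterInt μ n fun y => u.weight y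

/-- Terms of the unnormalized one-point correlation function `Z(x₁)`. -/
def ZTerm₁ (μ : ComplexMeasure X) (u : PairInteraction X) (x₁ : X) (n : ℕ) : ℂ :=
  (1 / (n.factorial : ℂ)) * iterInt μ n fun y => u.weight (Matrix.vecCons x₁ y)

/-- Terms of the unnormalized two-point correlation function `Z(x₁, x₂)`. -/
def ZTerm₂ (μ : ComplexMeasure X) (u : PairInteraction X) (x₁ x₂ : X) (n : ℕ) : ℂ :=
  (1 / (n.factorial : ℂ)) *
    iterInt μ n fun y => u.weight (Matrix.vecCons x₁ (Matrix.vecCons x₂ y))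

/-- Terms of the cluster function `Ẑ(x₁)`. -/
def clusterTerm₁ (μ : ComplexMeasure X) (u : PairInteraction X) (x₁ : X) (n : ℕ) : ℂ :=
  ((n : ℂ) + 1) * iterInt μ n fun y => u.phi (Matrix.vecCons x₁ y)

/-- Terms of the cluster function `Ẑ(x₁, x₂)`. -/
def clusterTerm₂ (μ : ComplexMeasure X) (u : PairInteraction X) (x₁ x₂ : X) (n : ℕ) : ℂ :=
  ((n : ℂ) + 2) * ((n : ℂ) + 1) *
    iterInt μ n fun y => u.phi (Matrix.vecCons x₁ (Matrix.vecCons x₂ y))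

/-- The partition function `Z`. -/
def Z (μ : ComplexMeasure X) (u : PairInteraction X) : ℂ := ∑' n, ZTerm μ u n

/-- The unnormalized one-point correlation function `Z(x₁)`. -/
def Z₁ (μ : ComplexMeasure X) (u : PairInteraction X) (x₁ : X) : ℂ := ∑' n, ZTerm₁ μ u x₁ n

/-- The unnormalized two-point correlation function `Z(x₁, x₂)`. -/
def Z₂ (μ : ComplexMeasure X) (u : PairInteraction X) (x₁ x₂ : X) : ℂ :=
  ∑' n, ZTerm₂ μ u x₁ x₂ n

/-- The cluster function `Ẑ(x₁)`. -/
def Zhat₁ (μ : ComplexMeasure X) (u : PairInteraction X) (x₁ : X) : ℂ :=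
  ∑' n, clusterTerm₁ μ u x₁ n

/-- The cluster function `Ẑ(x₁, x₂)`. -/
def Zhat₂ (μ : ComplexMeasure X) (u : PairInteraction X) (x₁ x₂ : X) : ℂ :=
  ∑' n, clusterTerm₂ μ u x₁ x₂ n

/-- The integrals and the series that define `Z` converge absolutely. -/
def ConvZ (μ : ComplexMeasure X) (u : PairInteraction X) : Prop :=
  (∀ n, Integrable (fun y : Fin n → X => u.weight y) (absPi μ n)) ∧ Summable (ZTerm μ u)

/-- The integrals and the series that define `Z(x₁)` and `Ẑ(x₁)` converge absolutely. -/
def Conv₁ (μ : ComplexMeasure X) (u : PairInteraction X) (x₁ : X) : Prop :=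
  (∀ n, Integrable (fun y : Fin n → X => u.weight (Matrix.vecCons x₁ y)) (absPi μ n)) ∧
  Summable (ZTerm₁ μ u x₁) ∧
  (∀ n, Integrable (fun y : Fin n → X => u.phi (Matrix.vecCons x₁ y)) (absPi μ n)) ∧
  Summable (clusterTerm₁ μ u x₁)

/-- The integrals and the series that define `Z(x₁, x₂)` and `Ẑ(x₁, x₂)` converge absolutely. -/
def Conv₂ (μ : ComplexMeasure X) (u : PairInteraction X) (x₁ x₂ : X) : Prop :=
  (∀ n, Integrable
    (fun y : Fin n → X => u.weight (Matrix.vecCons x₁ (Matrix.vecCons x₂ y))) (absPi μ n)) ∧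
  Summable (ZTerm₂ μ u x₁ x₂) ∧
  (∀ n, Integrable
    (fun y : Fin n → X => u.phi (Matrix.vecCons x₁ (Matrix.vecCons x₂ y))) (absPi μ n)) ∧
  Summable (clusterTerm₂ μ u x₁ x₂)

end ClusterExpansion

end

/-!
Up to the factor `1/n!`, `φ` is the Ursell function, the sum over connected graphs. It is dominated
by a sum over trees in two ways. Splitting off the cluster of one point at a time is the
Kirkwood–Salsburg recursion; by stability the point can be chosen so that its interaction with the
others costs at most `e^{2b}`, and the result is a sum over trees with edge weights `|ζ|`.
Alternatively, for the interaction `t u` both the Ursell functions and the sums over trees with edge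
weights `t |u|` solve evolution equations in `t`, which can be compared (Brydges–Kennedy); a hard
core is a limit of strong repulsions. The Kotecký–Preiss criterion sums the trees.

Give every integrated point a formal activity `z`. The component of `x₁` in the graph expansion of
the Boltzmann factor yields identities between power series in `z`,
`Z(x₁) = Ẑ(x₁) Z`, `Z(x₁, x₂) = Ẑ(x₁) Z(x₂) + Ẑ(x₁, x₂) Z` and `Z' = E Z`,
where `E` is the integral of `Ẑ(x₁)` over `x₁`. Since `E` converges absolutely at `z = 1`, so do `Z`
and `1/Z`, by Grönwall's inequality. Hence `Z ≠ 0`, and dividing by `Z` preserves absolute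
convergence.
-/

noncomputable section

namespace ClusterExpansion

open Finset

section SubsetSums

variable {V M : Type*} [AddCommMonoid M]

lemma sum_powerset_map {V' : Type*} (e : V' ↪ V) (B : Finset V') (F : Finset V → M) :
    ∑ A ∈ (B.map e).powerset, F A = ∑ A ∈ B.powerset, F (A.map e) := by
  have hmap : (B.map e).powerset = B.powerset.map (mapEmbedding e).toEmbedding := by
    ext A
    simp [subset_map_iff, eq_comm]
  rw [hmap, sum_map]
  rfl

variable [DecidableEq V]

lemma sum_powerset_sdiff_comm (Y : Finset V) (F : Finset V → Finset V → M) :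
    ∑ A ∈ Y.powerset, ∑ B ∈ (Y \ A).powerset, F A B =
      ∑ B ∈ Y.powerset, ∑ A ∈ (Y \ B).powerset, F A B := by
  refine sum_comm' fun A B => ?_
  simp only [mem_powerset, subset_sdiff, disjoint_comm (a := A)]
  tauto

lemma sum_powerset_powerset (Y : Finset V) (F : Finset V → Finset V → M) :
    ∑ A ∈ Y.powerset, ∑ B ∈ A.powerset, F A B =
      ∑ B ∈ Y.powerset, ∑ C ∈ (Y \ B).powerset, F (B ∪ C) B := by
  rw [sum_sigma', sum_sigma']
  refine sum_nbij' (fun p => ⟨p.2, p.1 \ p.2⟩) (fun p => ⟨p.1 ∪ p.2, p.1⟩) ?_ ?_ ?_ ?_ ?_ <;>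
    rintro ⟨A, B⟩ h <;> simp only [mem_sigma, mem_powerset, subset_sdiff] at h ⊢
  · exact ⟨h.2.trans h.1, sdiff_subset.trans h.1, sdiff_disjoint⟩
  · exact ⟨union_subset h.1 h.2.1, subset_union_left⟩
  · simp only [union_sdiff_of_subset h.2]
  · simp only [union_sdiff_cancel_left h.2.2.symm]
  · simp only [union_sdiff_of_subset h.2]

lemma sum_powerset_mem (Y : Finset V) (F : Finset V → V → M) :
    ∑ A ∈ Y.powerset, ∑ j ∈ A, F A j = ∑ j ∈ Y, ∑ A ∈ (Y.erase j).powerset, F (insert j A) j := by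
  rw [sum_sigma', sum_sigma']
  refine sum_nbij' (fun p => ⟨p.2, p.1.erase p.2⟩) (fun p => ⟨insert p.1 p.2, p.1⟩)
    ?_ ?_ ?_ ?_ ?_ <;>
    rintro ⟨_, _⟩ h <;> simp only [mem_sigma, mem_powerset, subset_erase] at h ⊢
  · exact ⟨h.1 h.2, (erase_subset _ _).trans h.1, notMem_erase _ _⟩
  · exact ⟨insert_subset h.1 h.2.1, mem_insert_self _ _⟩
  · simp only [insert_erase h.2]
  · simp only [erase_insert h.2.2]
  · simp only [insert_erase h.2]

lemma sum_powerset_filter_mem {X : Finset V} {r : V} (hr : r ∈ X) (F : Finset V → M) :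
    ∑ A ∈ X.powerset with r ∈ A, F A = ∑ A ∈ (X.erase r).powerset, F (insert r A) := by
  refine sum_nbij' (fun A => A.erase r) (fun A => insert r A) ?_ ?_ ?_ ?_ ?_ <;> intro A h <;>
    simp only [mem_filter, mem_powerset, subset_erase] at h ⊢
  · exact ⟨(erase_subset _ _).trans h.1, notMem_erase _ _⟩
  · exact ⟨insert_subset hr h.1, mem_insert_self _ _⟩
  · exact insert_erase h.2
  · exact erase_insert h.2
  · rw [insert_erase h.2]

lemma sum_powerset_filter_mem_eq_add_ssubsets {X : Finset V} {r : V} (hr : r ∈ X)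
    (F : Finset V → M) :
    ∑ A ∈ X.powerset with r ∈ A, F A = F X + ∑ A ∈ X.ssubsets with r ∈ A, F A := by
  have hX : {A ∈ X.powerset | r ∈ A} = insert X {A ∈ X.ssubsets | r ∈ A} := by
    rw [← insert_erase (mem_powerset_self X), filter_insert, if_pos hr]
    rfl
  rw [hX, sum_insert (by simp)]

end SubsetSums

section Pairs

variable {V : Type*} [LinearOrder V]

/-- The pairs `i < j` of elements of `A`, each standing for the unordered pair `{i, j}`. -/
def pairs (A : Finset V) : Finset (V × V) := {p ∈ A ×ˢ A | p.1 < p.2}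

lemma mem_pairs {A : Finset V} {p : V × V} : p ∈ pairs A ↔ p.1 ∈ A ∧ p.2 ∈ A ∧ p.1 < p.2 := by
  simp [pairs, and_assoc]

@[simp] lemma pairs_empty : pairs (∅ : Finset V) = ∅ := by simp [pairs]

lemma pairs_mono {A B : Finset V} (h : A ⊆ B) : pairs A ⊆ pairs B :=
  filter_subset_filter _ (product_subset_product h h)

lemma disjoint_pairs {A B : Finset V} (h : Disjoint A B) : Disjoint (pairs A) (pairs B) :=
  disjoint_filter_filter (disjoint_product.2 (Or.inl h))

lemma pairs_insert {A : Finset V} {i : V} (hi : i ∉ A) :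
    pairs (insert i A) = A.image (fun j => (min i j, max i j)) ∪ pairs A := by
  ext ⟨p, q⟩
  simp only [mem_pairs, mem_insert, mem_union, mem_image, Prod.mk.injEq]
  constructor
  · rintro ⟨rfl | hp, rfl | hq, hpq⟩
    · exact absurd hpq (lt_irrefl _)
    · exact Or.inl ⟨q, hq, min_eq_left hpq.le, max_eq_right hpq.le⟩
    · exact Or.inl ⟨p, hp, min_eq_right hpq.le, max_eq_left hpq.le⟩
    · exact Or.inr ⟨hp, hq, hpq⟩
  · rintro (⟨j, hj, rfl, rfl⟩ | ⟨hp, hq, hpq⟩)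
    · rcases lt_or_gt_of_ne (ne_of_mem_of_not_mem hj hi).symm with h | h
      · simp [min_eq_left h.le, max_eq_right h.le, hj, h]
      · simp [min_eq_right h.le, max_eq_left h.le, hj, h]
    · exact ⟨Or.inr hp, Or.inr hq, hpq⟩

lemma disjoint_image_min_max_pairs {A : Finset V} {i : V} (hi : i ∉ A) :
    Disjoint (A.image fun j => (min i j, max i j)) (pairs A) := by
  rw [Finset.disjoint_left]
  rintro _ h h'
  obtain ⟨j, -, rfl⟩ := mem_image.1 h
  obtain ⟨hmin, hmax, -⟩ := mem_pairs.1 h'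
  rcases le_total i j with hij | hij
  · exact hi (min_eq_left hij ▸ hmin)
  · exact hi (max_eq_left hij ▸ hmax)

lemma injective_min_max (i : V) : Function.Injective fun j => (min i j, max i j) := by
  intro j k hjk
  simp only [Prod.mk.injEq] at hjk
  grind

variable {M : Type*} [CommMonoid M] {f : V → V → M}

@[to_additive]
lemma prod_pairs_insert (hf : ∀ i j, f i j = f j i) {A : Finset V} {i : V} (hi : i ∉ A) :
    ∏ p ∈ pairs (insert i A), f p.1 p.2 = (∏ j ∈ A, f i j) * ∏ p ∈ pairs A, f p.1 p.2 := by
  rw [pairs_insert hi, prod_union (disjoint_image_min_max_pairs hi),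
    prod_image (injective_min_max i).injOn]
  congr 1
  refine prod_congr rfl fun j _ => ?_
  rcases le_total i j with hij | hij
  · simp [hij]
  · simp [hij, hf i j]

@[to_additive]
lemma prod_pairs_union (hf : ∀ i j, f i j = f j i) {A B : Finset V} (h : Disjoint A B) :
    ∏ p ∈ pairs (A ∪ B), f p.1 p.2 =
      (∏ p ∈ pairs A, f p.1 p.2) * (∏ p ∈ pairs B, f p.1 p.2) * ∏ i ∈ A, ∏ j ∈ B, f i j := by
  induction A using Finset.induction_on with
  | empty => simp
  | insert i A hi ih =>
    rw [disjoint_insert_left] at h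
    have hi' : i ∉ A ∪ B := by simp [hi, h.1]
    rw [insert_union, prod_pairs_insert hf hi', prod_pairs_insert hf hi, ih h.2,
      prod_union h.2, prod_insert hi]
    ac_rfl

lemma prod_prod_erase (hf : ∀ i j, f i j = f j i) (A : Finset V) :
    ∏ i ∈ A, ∏ j ∈ A.erase i, f i j = (∏ p ∈ pairs A, f p.1 p.2) ^ 2 := by
  induction A using Finset.induction_on with
  | empty => simp
  | insert i A hi ih =>
    have h : ∀ k ∈ A, ∏ j ∈ (insert i A).erase k, f k j = f i k * ∏ j ∈ A.erase k, f k j := by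
      intro k hk
      rw [erase_insert_of_ne (ne_of_mem_of_not_mem hk hi).symm, prod_insert (by simp [hi]), hf]
    rw [prod_insert hi, erase_insert hi, prod_congr rfl h, prod_mul_distrib, ih,
      prod_pairs_insert hf hi, mul_pow, sq (∏ j ∈ A, f i j), mul_assoc]

lemma prod_pairs_map {V' : Type*} [LinearOrder V'] (e : V' ↪o V) (f : V → V → M)
    (A : Finset V') :
    ∏ p ∈ pairs (A.map e.toEmbedding), f p.1 p.2 = ∏ p ∈ pairs A, f (e p.1) (e p.2) := by
  have hmap : pairs (A.map e.toEmbedding) =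
      (pairs A).map (e.toEmbedding.prodMap e.toEmbedding) := by
    ext ⟨p, q⟩
    simp only [mem_pairs, mem_map, Prod.exists, RelEmbedding.coe_toEmbedding,
      Function.Embedding.coe_prodMap, Prod.map_apply, Prod.mk.injEq]
    grind [OrderEmbedding.lt_iff_lt]
  rw [hmap, prod_map]
  rfl

end Pairs

section EdgeGraph

variable {V : Type*}

/-- The graph with edges `{i, j}` for `(i, j) ∈ E`. -/
def edgeGraph (E : Finset (V × V)) : SimpleGraph V := SimpleGraph.fromRel fun i j => (i, j) ∈ E

/-- Any two vertices of `A` are joined by a path with edges in `E`; the path may leave `A`. -/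
def Connects (E : Finset (V × V)) (A : Finset V) : Prop :=
  ∀ i ∈ A, ∀ j ∈ A, (edgeGraph E).Reachable i j

open Classical in
/-- The vertices of `X` that a path with edges in `E` joins to `r`. -/
def component (E : Finset (V × V)) (X : Finset V) (r : V) : Finset V :=
  {v ∈ X | (edgeGraph E).Reachable r v}

lemma mem_component {E : Finset (V × V)} {X : Finset V} {r v : V} :
    v ∈ component E X r ↔ v ∈ X ∧ (edgeGraph E).Reachable r v := by
  simp [component]

lemma edgeGraph_mono {E F : Finset (V × V)} (h : E ⊆ F) : edgeGraph E ≤ edgeGraph F := by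
  intro i j hij
  simp only [edgeGraph, SimpleGraph.fromRel_adj] at hij ⊢
  exact ⟨hij.1, hij.2.imp (@h _) (@h _)⟩

variable [LinearOrder V] {E : Finset (V × V)} {A B X : Finset V} {r v : V}

lemma edgeGraph_adj_of_mem (hE : E ⊆ pairs X) {p : V × V} (hp : p ∈ E) :
    (edgeGraph E).Adj p.1 p.2 := by
  rw [edgeGraph, SimpleGraph.fromRel_adj]
  exact ⟨(mem_pairs.1 (hE hp)).2.2.ne, Or.inl hp⟩

lemma mem_and_adj_inter_pairs (hE : E ⊆ pairs A ∪ pairs B) (hAB : Disjoint A B) {i j : V}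
    (hi : i ∈ A) (hij : (edgeGraph E).Adj i j) :
    j ∈ A ∧ (edgeGraph (E ∩ pairs A)).Adj i j := by
  have hiB : i ∉ B := Finset.disjoint_left.1 hAB hi
  simp only [edgeGraph, SimpleGraph.fromRel_adj, mem_inter] at hij ⊢
  rcases hij with ⟨hne, h | h⟩
  all_goals
    rcases mem_union.1 (hE h) with hA | hB
    · simp [hne, h, hA, (mem_pairs.1 hA).1, (mem_pairs.1 hA).2.1]
    · simp [hiB, mem_pairs] at hB

lemma mem_and_reachable_inter_pairs (hE : E ⊆ pairs A ∪ pairs B) (hAB : Disjoint A B)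
    (hr : r ∈ A) (h : (edgeGraph E).Reachable r v) :
    v ∈ A ∧ (edgeGraph (E ∩ pairs A)).Reachable r v := by
  rw [SimpleGraph.reachable_iff_reflTransGen] at h
  induction h with
  | refl => exact ⟨hr, SimpleGraph.Reachable.refl _⟩
  | tail _ hbc ih =>
    obtain ⟨hmem, hadj⟩ := mem_and_adj_inter_pairs hE hAB ih.1 hbc
    exact ⟨hmem, ih.2.trans hadj.reachable⟩

lemma subset_pairs_component_union (hE : E ⊆ pairs X) :
    E ⊆ pairs (component E X r) ∪ pairs (X \ component E X r) := by
  intro p hp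
  obtain ⟨hp₁, hp₂, hlt⟩ := mem_pairs.1 (hE hp)
  have hadj := edgeGraph_adj_of_mem hE hp
  have hiff : p.1 ∈ component E X r ↔ p.2 ∈ component E X r := by
    simp only [mem_component, hp₁, hp₂, true_and]
    exact ⟨fun h => h.trans hadj.reachable, fun h => h.trans hadj.symm.reachable⟩
  simp only [mem_union, mem_pairs, mem_sdiff]
  tauto

lemma component_eq_iff (hE : E ⊆ pairs X) (hAX : A ⊆ X) (hr : r ∈ A) :
    component E X r = A ↔ E ⊆ pairs A ∪ pairs (X \ A) ∧ Connects (E ∩ pairs A) A := by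
  constructor
  · rintro rfl
    have hsub := subset_pairs_component_union (r := r) hE
    have hreach : ∀ v ∈ component E X r,
        (edgeGraph (E ∩ pairs (component E X r))).Reachable r v := fun v hv =>
      (mem_and_reachable_inter_pairs hsub disjoint_sdiff hr (mem_component.1 hv).2).2
    exact ⟨hsub, fun i hi j hj => (hreach i hi).symm.trans (hreach j hj)⟩
  · rintro ⟨hsub, hconn⟩
    ext v
    rw [mem_component]
    exact ⟨fun h => (mem_and_reachable_inter_pairs hsub disjoint_sdiff hr h.2).1,
      fun hv => ⟨hAX hv, (hconn r hr v hv).mono (edgeGraph_mono inter_subset_left)⟩⟩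

end EdgeGraph

section Mayer

variable {V S : Type*} [LinearOrder V]

section CommSemiring

variable [CommSemiring S]

/-- The Boltzmann factor `∏_{i<j} (1 + ζ i j)` of the points in `A`. -/
def boltzmannProd (ζ : V → V → S) (A : Finset V) : S := ∏ p ∈ pairs A, (1 + ζ p.1 p.2)

open Classical in
/-- Mayer's sum over the connected graphs on `A` of the products of `ζ` over edges. -/
def mayerSum (ζ : V → V → S) (A : Finset V) : S :=
  ∑ E ∈ (pairs A).powerset with Connects E A, ∏ p ∈ E, ζ p.1 p.2

@[simp] lemma boltzmannProd_empty (ζ : V → V → S) : boltzmannProd ζ ∅ = 1 := by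
  simp [boltzmannProd]

lemma boltzmannProd_insert {ζ : V → V → S} (hζ : ∀ i j, ζ i j = ζ j i) {A : Finset V} {i : V}
    (hi : i ∉ A) : boltzmannProd ζ (insert i A) = (∏ j ∈ A, (1 + ζ i j)) * boltzmannProd ζ A :=
  prod_pairs_insert (f := fun i j => 1 + ζ i j) (fun i j => by rw [hζ]) hi

lemma boltzmannProd_map {V' : Type*} [LinearOrder V'] (e : V' ↪o V) (ζ : V → V → S)
    (A : Finset V') :
    boltzmannProd ζ (A.map e.toEmbedding) = boltzmannProd (fun i j => ζ (e i) (e j)) A :=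
  prod_pairs_map e (fun i j => 1 + ζ i j) A

open Classical in
lemma sum_component_eq (ζ : V → V → S) {X A : Finset V} {r : V} (hAX : A ⊆ X) (hr : r ∈ A) :
    ∑ E ∈ (pairs X).powerset with component E X r = A, ∏ p ∈ E, ζ p.1 p.2 =
      mayerSum ζ A * boltzmannProd ζ (X \ A) := by
  have hdisj : Disjoint (pairs A) (pairs (X \ A)) := disjoint_pairs disjoint_sdiff
  have hinter {E F : Finset (V × V)} (hE : E ⊆ pairs A) (hF : F ⊆ pairs (X \ A)) :
      (E ∪ F) ∩ pairs A = E ∧ (E ∪ F) ∩ pairs (X \ A) = F := by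
    rw [union_inter_distrib_right, union_inter_distrib_right, inter_eq_left.2 hE,
      inter_eq_left.2 hF, disjoint_iff_inter_eq_empty.1 (hdisj.symm.mono_left hF),
      disjoint_iff_inter_eq_empty.1 (hdisj.mono_left hE)]
    exact ⟨union_empty E, empty_union F⟩
  rw [mayerSum, boltzmannProd, prod_one_add, sum_mul_sum, ← sum_product']
  refine sum_nbij' (fun E => (E ∩ pairs A, E ∩ pairs (X \ A))) (fun p => p.1 ∪ p.2)
    (fun E hE => ?_) ?_ (fun E hE => ?_) ?_ (fun E hE => ?_)
  · obtain ⟨hEX, hEA⟩ := by simpa using hE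
    simpa using ((component_eq_iff hEX hAX hr).1 hEA).2
  · rintro ⟨E, F⟩ h
    obtain ⟨⟨hE, hc⟩, hF⟩ := by simpa using h
    have hEFX : E ∪ F ⊆ pairs X :=
      union_subset (hE.trans (pairs_mono hAX)) (hF.trans (pairs_mono sdiff_subset))
    rw [mem_filter, mem_powerset, component_eq_iff hEFX hAX hr, (hinter hE hF).1]
    exact ⟨hEFX, union_subset_union hE hF, hc⟩
  · obtain ⟨hEX, hEA⟩ := by simpa using hE
    rw [← inter_union_distrib_left, inter_eq_left.2 ((component_eq_iff hEX hAX hr).1 hEA).1]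
  · rintro ⟨E, F⟩ h
    obtain ⟨⟨hE, -⟩, hF⟩ := by simpa using h
    rw [(hinter hE hF).1, (hinter hE hF).2]
  · obtain ⟨hEX, hEA⟩ := by simpa using hE
    rw [← prod_union (hdisj.mono inter_subset_right inter_subset_right),
      ← inter_union_distrib_left, inter_eq_left.2 ((component_eq_iff hEX hAX hr).1 hEA).1]

lemma boltzmannProd_eq_sum_mayerSum (ζ : V → V → S) {X : Finset V} {r : V} (hr : r ∈ X) :
    boltzmannProd ζ X = ∑ A ∈ X.powerset with r ∈ A, mayerSum ζ A * boltzmannProd ζ (X \ A) := by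
  have hmaps : ∀ E ∈ (pairs X).powerset, component E X r ∈ {A ∈ X.powerset | r ∈ A} :=
    fun E _ => by simp [component, hr]
  rw [boltzmannProd, prod_one_add, ← sum_fiberwise_of_maps_to hmaps]
  refine sum_congr rfl fun A hA => ?_
  obtain ⟨hAX, hrA⟩ := by simpa using hA
  exact sum_component_eq ζ hAX hrA

end CommSemiring

section CommRing

variable [CommRing S]

-- Splitting off the component of `r` determines the Mayer sums.
lemma eq_mayerSum_of_recursion {ζ : V → V → S} {r : V} {f : Finset V → S}
    (hf : ∀ X : Finset V, r ∈ X →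
      boltzmannProd ζ X = ∑ A ∈ X.powerset with r ∈ A, f A * boltzmannProd ζ (X \ A))
    {X : Finset V} (hr : r ∈ X) : f X = mayerSum ζ X := by
  induction X using Finset.strongInduction with
  | H X ih =>
    have hcomp := (hf X hr).symm.trans (boltzmannProd_eq_sum_mayerSum ζ hr)
    have hrest : ∑ A ∈ X.ssubsets with r ∈ A, f A * boltzmannProd ζ (X \ A) =
        ∑ A ∈ X.ssubsets with r ∈ A, mayerSum ζ A * boltzmannProd ζ (X \ A) := by
      refine sum_congr rfl fun A hA => ?_
      obtain ⟨hAX, hrA⟩ := by simpa using hA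
      rw [ih A hAX hrA]
    rw [sum_powerset_filter_mem_eq_add_ssubsets hr, sum_powerset_filter_mem_eq_add_ssubsets hr,
      hrest] at hcomp
    simpa using hcomp

lemma mayerSum_eq_sub (ζ : V → V → S) {X : Finset V} {r : V} (hr : r ∈ X) :
    mayerSum ζ X =
      boltzmannProd ζ X - ∑ A ∈ X.ssubsets with r ∈ A, mayerSum ζ A * boltzmannProd ζ (X \ A) := by
  rw [boltzmannProd_eq_sum_mayerSum ζ hr, sum_powerset_filter_mem_eq_add_ssubsets hr]
  simp

lemma mayerSum_map {V' : Type*} [LinearOrder V'] (e : V' ↪o V) (ζ : V → V → S) {A : Finset V'}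
    (hA : A.Nonempty) :
    mayerSum ζ (A.map e.toEmbedding) = mayerSum (fun i j => ζ (e i) (e j)) A := by
  obtain ⟨r, hr⟩ := hA
  refine eq_mayerSum_of_recursion (f := fun A => mayerSum ζ (A.map e.toEmbedding))
    (fun X hX => ?_) hr
  rw [← boltzmannProd_map, boltzmannProd_eq_sum_mayerSum ζ (mem_map_of_mem _ hX), sum_filter,
    sum_powerset_map, sum_filter]
  refine sum_congr rfl fun A _ => ?_
  rw [← boltzmannProd_map, Finset.map_sdiff]
  simp

lemma mayerSum_zero {X : Finset V} {r : V} (hr : r ∈ X) :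
    mayerSum (fun _ _ => (0 : S)) X = if X = {r} then 1 else 0 := by
  symm
  refine eq_mayerSum_of_recursion (f := fun X => if X = {r} then 1 else 0) (fun Y hY => ?_) hr
  simp only [boltzmannProd, add_zero, prod_const_one, mul_one]
  rw [sum_ite_eq' _ ({r} : Finset V)]
  simp [hY]

end CommRing

end Mayer

section Peel

variable {V S : Type*} [DecidableEq V] [CommSemiring S]

lemma card_erase_union_add_card_sdiff_lt {R Y K : Finset V} {i : V} (hi : i ∈ R) (hK : K ⊆ Y) :
    #(R.erase i ∪ K) + #(Y \ K) < #R + #Y := by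
  have hunion : #(R.erase i ∪ K) ≤ #R - 1 + #K :=
    (card_union_le _ _).trans_eq (by rw [card_erase_of_mem hi])
  have hsdiff := card_sdiff_of_subset hK
  have hle := card_le_card hK
  have hpos := card_pos.2 ⟨i, hi⟩
  omega

lemma disjoint_erase_union_sdiff {R Y : Finset V} (h : Disjoint R Y) (i : V) (K : Finset V) :
    Disjoint (R.erase i ∪ K) (Y \ K) :=
  disjoint_union_left.2 ⟨h.mono (erase_subset _ _) sdiff_subset, disjoint_sdiff⟩

lemma erase_union_union_sdiff (R : Finset V) {Y K : Finset V} (i : V) (hK : K ⊆ Y) :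
    R.erase i ∪ K ∪ (Y \ K) = R.erase i ∪ Y := by
  rw [union_assoc, union_sdiff_of_subset hK]

lemma union_eq_insert_erase_union {R : Finset V} {i : V} (hi : i ∈ R) (Y : Finset V) :
    R ∪ Y = insert i (R.erase i ∪ Y) := by
  rw [← insert_union, insert_erase hi]

lemma sdiff_insert_eq_erase_sdiff (Y K : Finset V) (j : V) :
    Y \ insert j K = Y.erase j \ K := by
  rw [sdiff_insert, erase_sdiff_comm]

@[elab_as_elim]
lemma peel_induction {motive : ∀ R Y : Finset V, Disjoint R Y → Prop}
    (empty : ∀ Y, motive ∅ Y (disjoint_empty_left Y))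
    (peel : ∀ (R Y : Finset V) (hRY : Disjoint R Y), R.Nonempty →
      (∀ i ∈ R, ∀ K ⊆ Y, motive (R.erase i ∪ K) (Y \ K) (disjoint_erase_union_sdiff hRY i K)) →
      motive R Y hRY)
    {R Y : Finset V} (hRY : Disjoint R Y) : motive R Y hRY := by
  induction hn : #R + #Y using Nat.strong_induction_on generalizing R Y with
  | _ n ih =>
    rcases R.eq_empty_or_nonempty with rfl | hR
    · exact empty Y
    · exact peel R Y hRY hR fun i hi K hK =>
        ih _ (hn ▸ card_erase_union_add_card_sdiff_lt hi hK) _ rfl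

/-- The solution of the recursion that removes the root `ι R` from a nonempty set of roots `R`,
at the cost `c R (ι R)`, and turns a subset `K` of the other vertices `Y` into roots, at the cost
`w (ι R) k` for each `k ∈ K`. -/
def peelSum (ι : ∀ R : Finset V, R.Nonempty → R) (c : Finset V → V → S) (w : V → V → S)
    (R Y : Finset V) : S :=
  if h : R.Nonempty then
    c R (ι R h) * ∑ K ∈ Y.powerset.attach,
      (∏ k ∈ K.1, w (ι R h) k) * peelSum ι c w (R.erase (ι R h) ∪ K.1) (Y \ K.1)
  else if Y = ∅ then 1 else 0
termination_by #R + #Y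
decreasing_by exact card_erase_union_add_card_sdiff_lt (ι R h).2 (mem_powerset.1 K.2)

variable (ι : ∀ R : Finset V, R.Nonempty → R) (c : Finset V → V → S) (w : V → V → S)

lemma peelSum_empty (Y : Finset V) : peelSum ι c w ∅ Y = if Y = ∅ then 1 else 0 := by
  rw [peelSum]; simp

lemma peelSum_of_nonempty {R : Finset V} (h : R.Nonempty) (Y : Finset V) :
    peelSum ι c w R Y = c R (ι R h) * ∑ K ∈ Y.powerset,
      (∏ k ∈ K, w (ι R h) k) * peelSum ι c w (R.erase (ι R h) ∪ K) (Y \ K) := by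
  rw [peelSum, dif_pos h, ← sum_attach Y.powerset]

end Peel

section ForestSum

variable {V S : Type*} [LinearOrder V] [CommSemiring S]

/-- The weighted sum over the forests on `R ∪ Y` such that each tree contains exactly one element
of `R`, its root; an edge from a parent `i` to a child `k` has weight `w i k`. It is encoded by the
recursion that lists the children of one root at a time, taking the smallest root first. -/
def forestSum (w : V → V → S) (R Y : Finset V) : S :=
  peelSum (fun R h => ⟨R.min' h, R.min'_mem h⟩) (fun _ _ => 1) w R Y

lemma forestSum_empty_left (w : V → V → S) (Y : Finset V) :
    forestSum w ∅ Y = if Y = ∅ then 1 else 0 := peelSum_empty _ _ _ _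

lemma forestSum_eq_sum_min (w : V → V → S) {R : Finset V} (h : R.Nonempty) (Y : Finset V) :
    forestSum w R Y = ∑ K ∈ Y.powerset,
      (∏ k ∈ K, w (R.min' h) k) * forestSum w (R.erase (R.min' h) ∪ K) (Y \ K) :=
  (peelSum_of_nonempty _ _ _ h Y).trans (one_mul _)

lemma forestSum_eq_sum (w : V → V → S) {R Y : Finset V} (hRY : Disjoint R Y) {i : V}
    (hi : i ∈ R) :
    forestSum w R Y =
      ∑ K ∈ Y.powerset, (∏ k ∈ K, w i k) * forestSum w (R.erase i ∪ K) (Y \ K) := by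
  induction hRY using peel_induction generalizing i with
  | empty Y => simp at hi
  | peel R Y hRY hR ih =>
    -- Peeling two roots gives the same sum in either order.
    have expand : ∀ a ∈ R, ∀ b ∈ R, a ≠ b → ∑ K ∈ Y.powerset, (∏ k ∈ K, w a k) *
        forestSum w (R.erase a ∪ K) (Y \ K) = ∑ K ∈ Y.powerset, ∑ L ∈ (Y \ K).powerset,
          (∏ k ∈ K, w a k) * (∏ k ∈ L, w b k) *
            forestSum w ((R.erase a).erase b ∪ (K ∪ L)) (Y \ (K ∪ L)) := by
      intro a ha b hb hab
      refine sum_congr rfl fun K hK => ?_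
      rw [mem_powerset] at hK
      have hbK : b ∉ K := fun h => Finset.disjoint_left.1 hRY hb (hK h)
      rw [ih a ha K hK (mem_union_left _ (mem_erase.2 ⟨hab.symm, hb⟩)), mul_sum]
      refine sum_congr rfl fun L _ => ?_
      rw [erase_union_distrib, erase_eq_of_notMem hbK, union_assoc, sdiff_sdiff_left, mul_assoc]
      rfl
    rw [forestSum_eq_sum_min w hR]
    generalize hm : R.min' hR = m
    have hmR : m ∈ R := hm ▸ R.min'_mem hR
    rcases eq_or_ne m i with rfl | hmi
    · rfl
    rw [expand m hmR i hi hmi, expand i hi m hmR hmi.symm, sum_powerset_sdiff_comm]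
    refine sum_congr rfl fun K _ => sum_congr rfl fun L _ => ?_
    rw [erase_right_comm, union_comm K L, mul_comm (∏ k ∈ K, w i k)]

lemma forestSum_empty_right (w : V → V → S) (R : Finset V) : forestSum w R ∅ = 1 := by
  induction R using Finset.induction_on with
  | empty => simp [forestSum_empty_left]
  | insert i R hi ih =>
    rw [forestSum_eq_sum w (disjoint_empty_right _) (mem_insert_self i R)]
    simpa [hi] using ih

lemma forestSum_map {V' : Type*} [LinearOrder V'] (e : V' ↪ V) (w : V → V → S)
    {R Y : Finset V'} (hRY : Disjoint R Y) :
    forestSum w (R.map e) (Y.map e) = forestSum (fun i j => w (e i) (e j)) R Y := by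
  induction hRY using peel_induction with
  | empty Y => simp [forestSum_empty_left]
  | peel R Y hRY hR ih =>
    obtain ⟨i, hi⟩ := hR
    rw [forestSum_eq_sum w ((disjoint_map e).2 hRY) (mem_map_of_mem e hi),
      forestSum_eq_sum _ hRY hi, sum_powerset_map]
    refine sum_congr rfl fun K hK => ?_
    rw [← ih i hi K (mem_powerset.1 hK), prod_map, map_union, map_erase, Finset.map_sdiff]

lemma map_forestSum {S' : Type*} [CommSemiring S'] (φ : S →+* S') (w : V → V → S)
    {R Y : Finset V} (hRY : Disjoint R Y) :
    φ (forestSum w R Y) = forestSum (fun i j => φ (w i j)) R Y := by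
  induction hRY using peel_induction with
  | empty Y =>
    simp only [forestSum_empty_left]
    split_ifs <;> simp
  | peel R Y hRY hR ih =>
    obtain ⟨i, hi⟩ := hR
    rw [forestSum_eq_sum w hRY hi, forestSum_eq_sum _ hRY hi, map_sum]
    refine sum_congr rfl fun K hK => ?_
    rw [map_mul, map_prod, ih i hi K (mem_powerset.1 hK)]

lemma forestSum_nonneg [PartialOrder S] [IsOrderedRing S] {w : V → V → S}
    (hw : ∀ i j, 0 ≤ w i j) {R Y : Finset V} (hRY : Disjoint R Y) : 0 ≤ forestSum w R Y := by
  induction hRY using peel_induction with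
  | empty Y =>
    rw [forestSum_empty_left]
    split_ifs
    exacts [zero_le_one, le_rfl]
  | peel R Y hRY hR ih =>
    obtain ⟨i, hi⟩ := hR
    rw [forestSum_eq_sum w hRY hi]
    exact sum_nonneg fun K hK => mul_nonneg (prod_nonneg fun k _ => hw i k)
      (ih i hi K (mem_powerset.1 hK))

lemma forestSum_union (w : V → V → S) {R R' Y : Finset V} (hRY : Disjoint R Y)
    (hR' : Disjoint R' R) (hY : Disjoint R' Y) :
    forestSum w (R ∪ R') Y = ∑ B ∈ Y.powerset, forestSum w R (Y \ B) * forestSum w R' B := by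
  induction hRY using peel_induction with
  | empty Y =>
    have hB : ∀ B ∈ Y.powerset, forestSum w ∅ (Y \ B) * forestSum w R' B =
        if B = Y then forestSum w R' Y else 0 := by
      intro B hB
      have hiff : Y \ B = ∅ ↔ B = Y := by
        rw [sdiff_eq_empty_iff_subset]
        exact ⟨(mem_powerset.1 hB).antisymm, fun h => h.ge⟩
      rw [forestSum_empty_left]
      split_ifs with h h' h' <;> simp_all
    rw [empty_union, sum_congr rfl hB, sum_ite_eq', if_pos (mem_powerset_self Y)]
  | peel R Y hRY hR ih =>
    obtain ⟨i, hi⟩ := hR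
    have hpeel : ∀ K ∈ Y.powerset,
        (∏ k ∈ K, w i k) * forestSum w ((R ∪ R').erase i ∪ K) (Y \ K) =
          ∑ B ∈ (Y \ K).powerset, (∏ k ∈ K, w i k) *
            (forestSum w (R.erase i ∪ K) ((Y \ B) \ K) * forestSum w R' B) := by
      intro K hK
      rw [mem_powerset] at hK
      have hu : (R ∪ R').erase i ∪ K = (R.erase i ∪ K) ∪ R' := by
        rw [erase_union_distrib, erase_eq_of_notMem (Finset.disjoint_right.1 hR' hi),
          union_right_comm]
      rw [hu, ih i hi K hK (disjoint_union_right.2 ⟨hR'.mono_right (erase_subset _ _),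
        hY.mono_right hK⟩) (hY.mono_right sdiff_subset), mul_sum]
      exact sum_congr rfl fun B _ => by rw [sdiff_right_comm]
    rw [forestSum_eq_sum w (disjoint_union_left.2 ⟨hRY, hY⟩) (mem_union_left _ hi),
      sum_congr rfl hpeel, sum_powerset_sdiff_comm]
    refine sum_congr rfl fun B _ => ?_
    rw [forestSum_eq_sum w (hRY.mono_right sdiff_subset) hi, sum_mul]
    exact sum_congr rfl fun K _ => (mul_assoc _ _ _).symm

end ForestSum

section MarkedForestSum

variable {V S : Type*} [LinearOrder V] [CommSemiring S]

/-- The forest sum with one marked edge, whose weight is `f` instead of `w`: the marked edge joins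
`v` to its child `j`, and `B` consists of `j` and its descendants. -/
def markedForestSum (f w : V → V → S) (R Y : Finset V) : S :=
  ∑ B ∈ Y.powerset, ∑ j ∈ B, (∑ v ∈ R ∪ (Y \ B), f v j) *
    (forestSum w R (Y \ B) * forestSum w {j} (B.erase j))

lemma markedForestSum_empty_left (f w : V → V → S) (Y : Finset V) :
    markedForestSum f w ∅ Y = 0 := by
  refine sum_eq_zero fun B _ => sum_eq_zero fun j _ => ?_
  rw [forestSum_empty_left, empty_union]
  split_ifs with h <;> simp [h]

lemma markedForestSum_add (f g w : V → V → S) (R Y : Finset V) :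
    markedForestSum (fun i j => f i j + g i j) w R Y =
      markedForestSum f w R Y + markedForestSum g w R Y := by
  simp only [markedForestSum, sum_add_distrib, add_mul]

lemma markedForestSum_mono [PartialOrder S] [IsOrderedRing S] {f g w : V → V → S}
    (hw : ∀ i j, 0 ≤ w i j) (hfg : ∀ i j, f i j ≤ g i j) {R Y : Finset V} (hRY : Disjoint R Y) :
    markedForestSum f w R Y ≤ markedForestSum g w R Y :=
  sum_le_sum fun B _ => sum_le_sum fun j _ => mul_le_mul_of_nonneg_right
    (sum_le_sum fun v _ => hfg v j) (mul_nonneg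
      (forestSum_nonneg hw (hRY.mono_right sdiff_subset))
      (forestSum_nonneg hw (disjoint_singleton_left.2 (notMem_erase j B))))

variable (f w : V → V → S) {R Y : Finset V} {i : V}

lemma sum_marked_edge_at_root (hRY : Disjoint R Y) (hi : i ∈ R) :
    ∑ B ∈ Y.powerset, ∑ j ∈ B, f i j * (forestSum w R (Y \ B) * forestSum w {j} (B.erase j)) =
      ∑ K ∈ Y.powerset,
        (∑ k ∈ K, f i k * ∏ l ∈ K.erase k, w i l) * forestSum w (R.erase i ∪ K) (Y \ K) := by
  simp_rw [sum_mul]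
  rw [sum_powerset_mem Y fun B j => f i j * (forestSum w R (Y \ B) * forestSum w {j} (B.erase j)),
    sum_powerset_mem Y fun K k =>
      f i k * (∏ l ∈ K.erase k, w i l) * forestSum w (R.erase i ∪ K) (Y \ K)]
  refine sum_congr rfl fun j hj => ?_
  have hpeel : ∀ B ∈ (Y.erase j).powerset, f i j * (forestSum w R (Y \ insert j B) *
      forestSum w {j} ((insert j B).erase j)) = ∑ K ∈ (Y.erase j \ B).powerset,
        f i j * (∏ k ∈ K, w i k) *
          (forestSum w (R.erase i ∪ K) ((Y.erase j \ K) \ B) * forestSum w {j} B) := by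
    intro B hB
    rw [mem_powerset, subset_erase] at hB
    rw [erase_insert hB.2, sdiff_insert_eq_erase_sdiff, forestSum_eq_sum w
      (hRY.mono_right (sdiff_subset.trans (erase_subset _ _))) hi, sum_mul, mul_sum]
    refine sum_congr rfl fun K _ => ?_
    rw [sdiff_right_comm]
    ac_rfl
  rw [sum_congr rfl hpeel, sum_powerset_sdiff_comm]
  refine sum_congr rfl fun K hK => ?_
  rw [mem_powerset, subset_erase] at hK
  have hjR : j ∉ R := Finset.disjoint_right.1 hRY hj
  have hu : R.erase i ∪ insert j K = (R.erase i ∪ K) ∪ {j} := by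
    rw [union_insert, insert_eq, union_comm]
  rw [erase_insert hK.2, sdiff_insert_eq_erase_sdiff, hu, forestSum_union w
    (disjoint_erase_union_sdiff (hRY.mono_right (erase_subset _ _)) i K)
    (by simp [hjR, hK.2]) (by simp), mul_sum]

lemma sum_marked_edge_off_root (hRY : Disjoint R Y) (hi : i ∈ R) :
    ∑ B ∈ Y.powerset, ∑ j ∈ B, (∑ v ∈ R.erase i ∪ (Y \ B), f v j) *
        (forestSum w R (Y \ B) * forestSum w {j} (B.erase j)) =
      ∑ K ∈ Y.powerset, (∏ k ∈ K, w i k) * markedForestSum f w (R.erase i ∪ K) (Y \ K) := by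
  have hpeel : ∀ B ∈ Y.powerset, ∑ j ∈ B, (∑ v ∈ R.erase i ∪ (Y \ B), f v j) *
        (forestSum w R (Y \ B) * forestSum w {j} (B.erase j)) =
      ∑ K ∈ (Y \ B).powerset, (∏ k ∈ K, w i k) * ∑ j ∈ B,
        (∑ v ∈ R.erase i ∪ K ∪ ((Y \ K) \ B), f v j) *
          (forestSum w (R.erase i ∪ K) ((Y \ K) \ B) * forestSum w {j} (B.erase j)) := by
    intro B _
    rw [sum_congr rfl fun K _ => mul_sum _ _ _, sum_comm,
      forestSum_eq_sum w (hRY.mono_right sdiff_subset) hi]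
    refine sum_congr rfl fun j _ => ?_
    rw [sum_mul (Y \ B).powerset, mul_sum]
    refine sum_congr rfl fun K hK => ?_
    rw [sdiff_right_comm Y K, erase_union_union_sdiff R i (mem_powerset.1 hK)]
    ac_rfl
  rw [sum_congr rfl hpeel, sum_powerset_sdiff_comm]
  refine sum_congr rfl fun K _ => ?_
  rw [markedForestSum, mul_sum]

lemma markedForestSum_eq_sum (hRY : Disjoint R Y) (hi : i ∈ R) :
    markedForestSum f w R Y = ∑ K ∈ Y.powerset,
      ((∑ k ∈ K, f i k * ∏ l ∈ K.erase k, w i l) * forestSum w (R.erase i ∪ K) (Y \ K) +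
        (∏ k ∈ K, w i k) * markedForestSum f w (R.erase i ∪ K) (Y \ K)) := by
  have hsplit : ∀ B j, ∑ v ∈ R ∪ (Y \ B), f v j =
      f i j + ∑ v ∈ R.erase i ∪ (Y \ B), f v j := by
    intro B j
    rw [union_eq_insert_erase_union hi, sum_insert]
    simp [Finset.disjoint_left.1 hRY hi]
  simp_rw [markedForestSum, hsplit, add_mul, sum_add_distrib]
  rw [sum_marked_edge_at_root f w hRY hi, sum_marked_edge_off_root f w hRY hi]
  rfl

end MarkedForestSum

section ForestCalculus

variable {V : Type*} [LinearOrder V] {R Y : Finset V}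

lemma hasDerivAt_forestSum {𝕜 : Type*} [NontriviallyNormedField 𝕜] {w : 𝕜 → V → V → 𝕜}
    {f : V → V → 𝕜} {t : 𝕜} (hw : ∀ i j, HasDerivAt (fun t => w t i j) (f i j) t)
    (hRY : Disjoint R Y) :
    HasDerivAt (fun t => forestSum (w t) R Y) (markedForestSum f (w t) R Y) t := by
  induction hRY using peel_induction with
  | empty Y =>
    simp_rw [forestSum_empty_left, markedForestSum_empty_left]
    exact hasDerivAt_const _ _
  | peel R Y hRY hR ih =>
    obtain ⟨i, hi⟩ := hR
    simp_rw [fun t => forestSum_eq_sum (w t) hRY hi]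
    rw [markedForestSum_eq_sum f (w t) hRY hi]
    refine HasDerivAt.fun_sum fun K hK => ?_
    have hprod := HasDerivAt.fun_finsetProd (u := K) (f := fun k t => w t i k)
      (f' := fun k => f i k) (x := t) (fun k _ => hw i k)
    refine (hprod.mul (ih i hi K (mem_powerset.1 hK))).congr_deriv ?_
    simp only [smul_eq_mul, mul_comm (f i _)]

open Filter Topology in
lemma tendsto_forestSum {α S : Type*} [CommSemiring S] [TopologicalSpace S]
    [IsTopologicalSemiring S] {l : Filter α} {w : α → V → V → S} {w' : V → V → S}
    (hw : ∀ i j, Tendsto (fun a => w a i j) l (𝓝 (w' i j))) (hRY : Disjoint R Y) :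
    Tendsto (fun a => forestSum (w a) R Y) l (𝓝 (forestSum w' R Y)) := by
  induction hRY using peel_induction with
  | empty Y =>
    simp only [forestSum_empty_left]
    exact tendsto_const_nhds
  | peel R Y hRY hR ih =>
    obtain ⟨i, hi⟩ := hR
    simp only [forestSum_eq_sum _ hRY hi]
    exact tendsto_finsetSum _ fun K hK =>
      (tendsto_finsetProd _ fun k _ => hw i k).mul (ih i hi K (mem_powerset.1 hK))

lemma sum_mul_prod_erase_le {S : Type*} [CommSemiring S] [PartialOrder S] [IsOrderedRing S]
    {f w κ : V → S} (hw : ∀ i, 0 ≤ w i) (hf : ∀ i, f i ≤ κ i * w i) (K : Finset V) :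
    ∑ k ∈ K, f k * ∏ l ∈ K.erase k, w l ≤ (∑ k ∈ K, κ k) * ∏ l ∈ K, w l := by
  rw [sum_mul]
  refine sum_le_sum fun k hk => ?_
  rw [← mul_prod_erase K w hk, ← mul_assoc]
  exact mul_le_mul_of_nonneg_right (hf k) (prod_nonneg fun l _ => hw l)

lemma markedForestSum_le {S : Type*} [CommSemiring S] [PartialOrder S] [IsOrderedRing S]
    {f w κ : V → V → S} (hw : ∀ i j, 0 ≤ w i j) (hκ0 : ∀ i j, 0 ≤ κ i j)
    (hκ : ∀ i j, κ i j = κ j i) (hf : ∀ i j, f i j ≤ κ i j * w i j) (hRY : Disjoint R Y) :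
    markedForestSum f w R Y ≤ (∑ p ∈ pairs (R ∪ Y), κ p.1 p.2) * forestSum w R Y := by
  induction hRY using peel_induction with
  | empty Y =>
    rw [markedForestSum_empty_left]
    exact mul_nonneg (sum_nonneg fun p _ => hκ0 p.1 p.2)
      (forestSum_nonneg hw (disjoint_empty_left Y))
  | peel R Y hRY hR ih =>
    obtain ⟨i, hi⟩ := hR
    have hiY : i ∉ Y := Finset.disjoint_left.1 hRY hi
    rw [markedForestSum_eq_sum f w hRY hi, forestSum_eq_sum w hRY hi,
      union_eq_insert_erase_union hi, sum_pairs_insert hκ (by simp [hiY]), mul_sum]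
    refine sum_le_sum fun K hK => ?_
    rw [mem_powerset] at hK
    have hP : 0 ≤ ∏ k ∈ K, w i k := prod_nonneg fun k _ => hw i k
    have hF := forestSum_nonneg hw (disjoint_erase_union_sdiff hRY i K)
    have hκK : ∑ k ∈ K, κ i k ≤ ∑ j ∈ R.erase i ∪ Y, κ i j :=
      sum_le_sum_of_subset_of_nonneg (hK.trans subset_union_right) fun j _ _ => hκ0 i j
    rw [add_mul]
    refine add_le_add ?_ ?_
    · rw [← mul_assoc]
      exact mul_le_mul_of_nonneg_right ((sum_mul_prod_erase_le (hw i) (hf i) K).trans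
        (mul_le_mul_of_nonneg_right hκK hP)) hF
    · rw [mul_left_comm, ← erase_union_union_sdiff R i hK]
      exact mul_le_mul_of_nonneg_left (ih i hi K hK) hP

end ForestCalculus

section KirkwoodSalsburg

variable {V S : Type*} [LinearOrder V]

/-- The sum over the graphs on `R ∪ Y` such that each vertex is connected to an element of `R`,
computed with the Kirkwood–Salsburg recursion; `ι` chooses the root to be removed. -/
def kirkwoodSalsburgSum [CommSemiring S] (ι : ∀ R : Finset V, R.Nonempty → R) (ζ : V → V → S)
    (R Y : Finset V) : S :=
  peelSum ι (fun R i => ∏ j ∈ R.erase i, (1 + ζ i j)) ζ R Y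

lemma boltzmannProd_union_eq_sum [CommSemiring S] (ι : ∀ R : Finset V, R.Nonempty → R)
    {ζ : V → V → S} (hζ : ∀ i j, ζ i j = ζ j i) {R Y : Finset V} (hRY : Disjoint R Y) :
    boltzmannProd ζ (R ∪ Y) =
      ∑ K ∈ Y.powerset, kirkwoodSalsburgSum ι ζ R K * boltzmannProd ζ (Y \ K) := by
  induction hRY using peel_induction with
  | empty Y =>
    rw [sum_eq_single ∅ (fun B _ hB => by simp [kirkwoodSalsburgSum, peelSum_empty, hB]) (by simp)]
    simp [kirkwoodSalsburgSum, peelSum_empty]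
  | peel R Y hRY hR ih =>
    obtain ⟨i, hi, hι⟩ : ∃ i ∈ R, (ι R hR : V) = i := ⟨ι R hR, (ι R hR).2, rfl⟩
    have hpeel : ∀ K ∈ Y.powerset, kirkwoodSalsburgSum ι ζ R K * boltzmannProd ζ (Y \ K) =
        ∑ L ∈ K.powerset, (∏ j ∈ R.erase i, (1 + ζ i j)) * ((∏ k ∈ L, ζ i k) *
          (kirkwoodSalsburgSum ι ζ (R.erase i ∪ L) (K \ L) * boltzmannProd ζ (Y \ K))) := by
      intro K _
      rw [kirkwoodSalsburgSum, peelSum_of_nonempty _ _ _ hR, hι, mul_assoc, sum_mul, mul_sum]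
      exact sum_congr rfl fun L _ => by rw [kirkwoodSalsburgSum, mul_assoc]
    rw [sum_congr rfl hpeel, sum_powerset_powerset, union_eq_insert_erase_union hi,
      boltzmannProd_insert hζ (by simp [Finset.disjoint_left.1 hRY hi]),
      prod_union (hRY.mono_left (erase_subset _ _)), prod_one_add (s := Y), mul_assoc, sum_mul,
      mul_sum]
    refine sum_congr rfl fun K hK => ?_
    rw [mem_powerset] at hK
    rw [← erase_union_union_sdiff R i hK, ih i hi K hK, mul_sum, mul_sum]
    refine sum_congr rfl fun L hL => ?_
    rw [mem_powerset, subset_sdiff] at hL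
    rw [union_sdiff_cancel_left hL.2.symm, sdiff_sdiff_left]
    rfl

lemma mayerSum_eq_kirkwoodSalsburgSum [CommRing S] (ι : ∀ R : Finset V, R.Nonempty → R)
    {ζ : V → V → S} (hζ : ∀ i j, ζ i j = ζ j i) {X : Finset V} {r : V} (hr : r ∈ X) :
    mayerSum ζ X = kirkwoodSalsburgSum ι ζ {r} (X.erase r) := by
  symm
  refine eq_mayerSum_of_recursion (f := fun X => kirkwoodSalsburgSum ι ζ {r} (X.erase r))
    (fun X hr => ?_) hr
  have hsum := boltzmannProd_union_eq_sum ι hζ (R := {r}) (Y := X.erase r) (by simp)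
  rw [← insert_eq, insert_erase hr] at hsum
  rw [hsum, sum_powerset_filter_mem hr]
  refine sum_congr rfl fun K hK => ?_
  rw [mem_powerset, subset_erase] at hK
  rw [erase_insert hK.2, sdiff_insert_eq_erase_sdiff]

-- The geometric mean over `i ∈ R` of the products `∏ j ∈ R.erase i, f i j` is at most that of the
-- numbers `c i ^ 2`.
lemma exists_prod_erase_le_sq {f : V → V → ℝ} (hf0 : ∀ i j, 0 ≤ f i j)
    (hf : ∀ i j, f i j = f j i) {c : V → ℝ} (hc : ∀ i, 0 < c i) {R : Finset V} (hR : R.Nonempty)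
    (hle : ∏ p ∈ pairs R, f p.1 p.2 ≤ ∏ i ∈ R, c i) :
    ∃ i ∈ R, ∏ j ∈ R.erase i, f i j ≤ c i ^ 2 := by
  by_contra! hcon
  have hlt : ∏ i ∈ R, c i ^ 2 < ∏ i ∈ R, ∏ j ∈ R.erase i, f i j :=
    prod_lt_prod_of_nonempty (fun i _ => pow_pos (hc i) 2) hcon hR
  rw [prod_prod_erase hf, prod_pow] at hlt
  exact hlt.not_ge (pow_le_pow_left₀ (prod_nonneg fun _ _ => hf0 _ _) hle 2)

variable {𝕜 : Type*} [NormedField 𝕜]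

lemma norm_kirkwoodSalsburgSum_le {ι : ∀ R : Finset V, R.Nonempty → R} {ζ : V → V → 𝕜}
    {c : V → ℝ} (hc : ∀ i, 0 ≤ c i)
    (hι : ∀ R h, ∏ j ∈ R.erase (ι R h), ‖1 + ζ (ι R h) j‖ ≤ c (ι R h))
    {R Y : Finset V} (hRY : Disjoint R Y) :
    ‖kirkwoodSalsburgSum ι ζ R Y‖ ≤
      (∏ i ∈ R ∪ Y, c i) * forestSum (fun i j => ‖ζ i j‖) R Y := by
  induction hRY using peel_induction with
  | empty Y =>
    rw [kirkwoodSalsburgSum, peelSum_empty, forestSum_empty_left]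
    split_ifs with h <;> simp [h]
  | peel R Y hRY hR ih =>
    have hιR := hι R hR
    obtain ⟨i, hi, hi'⟩ : ∃ i ∈ R, (ι R hR : V) = i := ⟨ι R hR, (ι R hR).2, rfl⟩
    rw [hi'] at hιR
    rw [kirkwoodSalsburgSum, peelSum_of_nonempty _ _ _ hR, hi', forestSum_eq_sum _ hRY hi,
      norm_mul, norm_prod, union_eq_insert_erase_union hi,
      prod_insert (by simp [Finset.disjoint_left.1 hRY hi]), mul_assoc]
    refine mul_le_mul hιR ?_ (norm_nonneg _) (hc i)
    rw [mul_sum]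
    refine (norm_sum_le _ _).trans (sum_le_sum fun K hK => ?_)
    rw [mem_powerset] at hK
    rw [norm_mul, norm_prod, ← erase_union_union_sdiff R i hK, mul_left_comm]
    exact mul_le_mul_of_nonneg_left (ih i hi K hK) (prod_nonneg fun _ _ => norm_nonneg _)

theorem norm_mayerSum_le_forestSum_norm {ζ : V → V → 𝕜} (hζ : ∀ i j, ζ i j = ζ j i) {b : V → ℝ}
    (hst : ∀ R : Finset V, ∏ p ∈ pairs R, ‖1 + ζ p.1 p.2‖ ≤ ∏ i ∈ R, Real.exp (b i))
    {X : Finset V} {r : V} (hr : r ∈ X) :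
    ‖mayerSum ζ X‖ ≤
      (∏ i ∈ X, Real.exp (b i) ^ 2) * forestSum (fun i j => ‖ζ i j‖) {r} (X.erase r) := by
  choose ι hιR hι using fun (R : Finset V) (h : R.Nonempty) =>
    exists_prod_erase_le_sq (fun i j => norm_nonneg (1 + ζ i j)) (fun i j => by rw [hζ])
      (fun i => Real.exp_pos (b i)) h (hst R)
  have hle := norm_kirkwoodSalsburgSum_le (ι := fun R h => ⟨ι R h, hιR R h⟩)
    (fun i => sq_nonneg (Real.exp (b i))) hι (R := {r}) (Y := X.erase r) (by simp)
  rwa [← mayerSum_eq_kirkwoodSalsburgSum _ hζ hr, ← insert_eq, insert_erase hr] at hle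

end KirkwoodSalsburg

section CrossSum

variable {V S : Type*} [LinearOrder V]

/-- The pair interaction `u` across all the splittings of `X` into a part that contains `r` and a
part `B`, weighted with the values of `m` at the parts. -/
def crossSum [CommSemiring S] (u : V → V → S) (m : Finset V → S) (r : V) (X : Finset V) : S :=
  ∑ B ∈ (X.erase r).powerset, (∑ j ∈ B, ∑ v ∈ X \ B, u v j) * (m (X \ B) * m B)

lemma sum_powerset_filter_mem_powerset_erase [AddCommMonoid S] (X : Finset V) (r : V)
    (F : Finset V → Finset V → S) :
    ∑ A ∈ X.powerset with r ∈ A, ∑ B ∈ (A.erase r).powerset, F (A \ B) B =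
      ∑ C ∈ X.powerset with r ∈ C, ∑ B ∈ (X \ C).powerset, F C B := by
  rw [sum_sigma', sum_sigma']
  refine sum_nbij' (fun p => ⟨p.1 \ p.2, p.2⟩) (fun p => ⟨p.1 ∪ p.2, p.2⟩) ?_ ?_ ?_ ?_ ?_ <;>
    rintro ⟨A, B⟩ h <;>
    simp only [mem_sigma, mem_filter, mem_powerset, subset_sdiff, subset_erase] at h ⊢
  · exact ⟨⟨sdiff_subset.trans h.1.1, mem_sdiff.2 ⟨h.1.2, h.2.2⟩⟩, h.2.1.trans h.1.1,
      disjoint_sdiff⟩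
  · exact ⟨⟨union_subset h.1.1 h.2.1, mem_union_left _ h.1.2⟩, subset_union_right,
      Finset.disjoint_right.1 h.2.2 h.1.2⟩
  · simp only [sdiff_union_of_subset h.2.1]
  · simp only [union_sdiff_cancel_right h.2.2.symm]

lemma sum_sum_mul_mayerSum_mul_boltzmannProd [CommSemiring S] (ζ : V → V → S) (g : V → S)
    (Y : Finset V) :
    ∑ B ∈ Y.powerset, (∑ j ∈ B, g j) * (mayerSum ζ B * boltzmannProd ζ (Y \ B)) =
      (∑ j ∈ Y, g j) * boltzmannProd ζ Y := by
  simp_rw [sum_mul]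
  rw [sum_powerset_mem Y fun B j => g j * (mayerSum ζ B * boltzmannProd ζ (Y \ B))]
  refine sum_congr rfl fun j hj => ?_
  rw [← mul_sum, ← sum_powerset_filter_mem hj fun B => mayerSum ζ B * boltzmannProd ζ (Y \ B),
    ← boltzmannProd_eq_sum_mayerSum ζ hj]

lemma sum_crossSum_mul_boltzmannProd [CommSemiring S] (u ζ : V → V → S) (X : Finset V) (r : V) :
    ∑ A ∈ X.powerset with r ∈ A, crossSum u (mayerSum ζ) r A * boltzmannProd ζ (X \ A) =
      ∑ A ∈ X.powerset with r ∈ A,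
        (∑ j ∈ X \ A, ∑ v ∈ A, u v j) * (mayerSum ζ A * boltzmannProd ζ (X \ A)) := by
  have hsplit : ∀ A ∈ {A ∈ X.powerset | r ∈ A},
      crossSum u (mayerSum ζ) r A * boltzmannProd ζ (X \ A) =
        ∑ B ∈ (A.erase r).powerset, mayerSum ζ (A \ B) * ((∑ j ∈ B, ∑ v ∈ A \ B, u v j) *
          (mayerSum ζ B * boltzmannProd ζ ((X \ (A \ B)) \ B))) := by
    intro A _
    rw [crossSum, sum_mul]
    refine sum_congr rfl fun B hB => ?_
    rw [mem_powerset, subset_erase] at hB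
    have hX : (X \ (A \ B)) \ B = X \ A := by
      rw [sdiff_sdiff_left]
      exact congrArg _ (sdiff_union_of_subset hB.1)
    rw [hX]
    ac_rfl
  rw [sum_congr rfl hsplit, sum_powerset_filter_mem_powerset_erase X r fun C B =>
    mayerSum ζ C * ((∑ j ∈ B, ∑ v ∈ C, u v j) * (mayerSum ζ B * boltzmannProd ζ ((X \ C) \ B)))]
  refine sum_congr rfl fun C _ => ?_
  rw [← mul_sum, sum_sum_mul_mayerSum_mul_boltzmannProd ζ (fun j => ∑ v ∈ C, u v j)]
  ac_rfl

lemma norm_crossSum_le {𝕜 : Type*} [NormedField 𝕜] (u : V → V → 𝕜) {m : Finset V → 𝕜} {r : V}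
    {X : Finset V} (hr : r ∈ X) {w : V → V → ℝ} (hw : ∀ i j, 0 ≤ w i j) {b : V → ℝ}
    (hm : ∀ A ⊂ X, ∀ r ∈ A, ‖m A‖ ≤ Real.exp (∑ i ∈ A, b i) * forestSum w {r} (A.erase r)) :
    ‖crossSum u m r X‖ ≤
      Real.exp (∑ i ∈ X, b i) * markedForestSum (fun i j => ‖u i j‖) w {r} (X.erase r) := by
  rw [markedForestSum, mul_sum, crossSum]
  refine (norm_sum_le _ _).trans (sum_le_sum fun B hB => ?_)
  rw [mem_powerset, subset_erase] at hB
  have herase : (X \ B).erase r = X.erase r \ B := (erase_sdiff_comm X B r).symm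
  have hX : {r} ∪ (X.erase r \ B) = X \ B := by
    rw [← herase, ← insert_eq, insert_erase (mem_sdiff.2 ⟨hr, hB.2⟩)]
  rw [hX, sum_mul, mul_sum]
  refine (norm_sum_le _ _).trans (sum_le_sum fun j hj => ?_)
  have hroot := hm (X \ B) (sdiff_ssubset hB.1 ⟨j, hj⟩) r (mem_sdiff.2 ⟨hr, hB.2⟩)
  have hbranch := hm B ((ssubset_iff_of_subset hB.1).2 ⟨r, hr, hB.2⟩) j hj
  rw [herase] at hroot
  have hprod := mul_le_mul hroot hbranch (norm_nonneg _)
    (mul_nonneg (Real.exp_pos _).le (forestSum_nonneg hw (by simp)))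
  rw [norm_mul, norm_mul, ← sum_sdiff hB.1, Real.exp_add]
  exact (mul_le_mul (norm_sum_le _ _) hprod (by positivity)
    (sum_nonneg fun _ _ => norm_nonneg _)).trans_eq (by ring)

end CrossSum

section BrydgesKennedy

variable {V : Type*}

/-- The Mayer function of the interaction `t u`. -/
def scaledZeta (u : V → V → ℂ) (t : ℝ) (i j : V) : ℂ := Complex.exp (-(t * u i j)) - 1

open Filter Topology in
lemma tendsto_scaledZeta_hard {hard : V → V → Prop} [∀ i j, Decidable (hard i j)]
    (z : V → V → ℂ) (i j : V) :
    Tendsto (fun ρ : ℝ => scaledZeta (fun i j => if hard i j then (ρ : ℂ) else z i j) 1 i j) atTop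
      (𝓝 (if hard i j then -1 else Complex.exp (-z i j) - 1)) := by
  simp only [scaledZeta]
  split_ifs
  · have hlim : Tendsto (fun ρ : ℝ => ((Real.exp (-ρ) : ℝ) : ℂ) - 1) atTop (𝓝 ((0 : ℝ) - 1)) :=
      ((Complex.continuous_ofReal.tendsto _).comp
        Real.tendsto_exp_neg_atTop_nhds_zero).sub_const 1
    simpa using hlim
  · simp

variable [LinearOrder V]

lemma boltzmannProd_scaledZeta (u : V → V → ℂ) (t : ℝ) (X : Finset V) :
    boltzmannProd (scaledZeta u t) X = Complex.exp (-(t * ∑ p ∈ pairs X, u p.1 p.2)) := by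
  simp only [boltzmannProd, scaledZeta, add_sub_cancel, mul_sum, ← sum_neg_distrib,
    Complex.exp_sum]

lemma hasDerivAt_boltzmannProd_scaledZeta (u : V → V → ℂ) (t : ℝ) (X : Finset V) :
    HasDerivAt (fun t => boltzmannProd (scaledZeta u t) X)
      (-(∑ p ∈ pairs X, u p.1 p.2) * boltzmannProd (scaledZeta u t) X) t := by
  simp_rw [boltzmannProd_scaledZeta]
  have hlin : HasDerivAt (fun t : ℝ => -((t : ℂ) * ∑ p ∈ pairs X, u p.1 p.2))
      (-(1 * ∑ p ∈ pairs X, u p.1 p.2)) t :=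
    ((hasDerivAt_id t).ofReal_comp.mul_const _).neg
  refine hlin.cexp.congr_deriv ?_
  ring

/-- The right side of the evolution equation of `mayerSum (scaledZeta u t)`. -/
def mayerDeriv (u : V → V → ℂ) (m : Finset V → ℂ) (r : V) (X : Finset V) : ℂ :=
  -(∑ p ∈ pairs X, u p.1 p.2) * m X - crossSum u m r X

lemma sum_mayerDeriv_mul_boltzmannProd {u : V → V → ℂ} (hu : ∀ i j, u i j = u j i)
    (ζ : V → V → ℂ) {X : Finset V} {r : V} (hr : r ∈ X) :
    ∑ A ∈ X.powerset with r ∈ A, mayerDeriv u (mayerSum ζ) r A * boltzmannProd ζ (X \ A) =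
      -(∑ p ∈ pairs X, u p.1 p.2) * boltzmannProd ζ X + ∑ A ∈ X.powerset with r ∈ A,
        mayerSum ζ A * ((∑ p ∈ pairs (X \ A), u p.1 p.2) * boltzmannProd ζ (X \ A)) := by
  simp only [mayerDeriv, sub_mul, sum_sub_distrib]
  rw [sum_crossSum_mul_boltzmannProd, boltzmannProd_eq_sum_mayerSum ζ hr, mul_sum,
    ← sum_sub_distrib, ← sum_add_distrib]
  refine sum_congr rfl fun A hA => ?_
  simp only [mem_filter, mem_powerset] at hA
  have hunion := sum_pairs_union hu (disjoint_sdiff (s := A) (t := X))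
  rw [union_sdiff_of_subset hA.1] at hunion
  rw [hunion, sum_comm (s := X \ A)]
  ring

lemma hasDerivAt_mayerSum_scaledZeta {u : V → V → ℂ} (hu : ∀ i j, u i j = u j i) (t : ℝ) {r : V}
    (X : Finset V) (hr : r ∈ X) :
    HasDerivAt (fun t => mayerSum (scaledZeta u t) X)
      (mayerDeriv u (mayerSum (scaledZeta u t)) r X) t := by
  induction X using Finset.strongInduction with
  | H X ih =>
    simp_rw [fun t => mayerSum_eq_sub (scaledZeta u t) hr]
    have hsum : HasDerivAt (fun t => ∑ A ∈ X.ssubsets with r ∈ A,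
        mayerSum (scaledZeta u t) A * boltzmannProd (scaledZeta u t) (X \ A))
        (∑ A ∈ X.ssubsets with r ∈ A,
          (mayerDeriv u (mayerSum (scaledZeta u t)) r A * boltzmannProd (scaledZeta u t) (X \ A) +
          mayerSum (scaledZeta u t) A *
            (-(∑ p ∈ pairs (X \ A), u p.1 p.2) * boltzmannProd (scaledZeta u t) (X \ A)))) t := by
      refine HasDerivAt.fun_sum fun A hA => ?_
      simp only [mem_filter, mem_ssubsets] at hA
      exact (ih A hA.1 hA.2).mul (hasDerivAt_boltzmannProd_scaledZeta u t (X \ A))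
    refine ((hasDerivAt_boltzmannProd_scaledZeta u t X).sub hsum).congr_deriv ?_
    have hrec := sum_mayerDeriv_mul_boltzmannProd hu (scaledZeta u t) hr
    rw [sum_powerset_filter_mem_eq_add_ssubsets hr, sum_powerset_filter_mem_eq_add_ssubsets hr]
      at hrec
    simp only [sdiff_self, pairs_empty, sum_empty, mul_zero, zero_add, bot_eq_empty,
      boltzmannProd_empty, mul_one] at hrec
    simp only [sum_add_distrib, neg_mul, mul_neg, sum_neg_distrib] at hrec ⊢
    linear_combination -hrec

lemma hasDerivAt_mayerSum_mul_cexp {u : V → V → ℂ} (hu : ∀ i j, u i j = u j i) (t : ℝ) {r : V}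
    {X : Finset V} (hr : r ∈ X) :
    HasDerivAt (fun t : ℝ => mayerSum (scaledZeta u t) X *
        Complex.exp (t * ∑ p ∈ pairs X, u p.1 p.2))
      (-crossSum u (mayerSum (scaledZeta u t)) r X *
        Complex.exp (t * ∑ p ∈ pairs X, u p.1 p.2)) t := by
  have hlin : HasDerivAt (fun t : ℝ => (t : ℂ) * ∑ p ∈ pairs X, u p.1 p.2)
      (1 * ∑ p ∈ pairs X, u p.1 p.2) t := (hasDerivAt_id t).ofReal_comp.mul_const _
  refine ((hasDerivAt_mayerSum_scaledZeta hu t X hr).mul hlin.cexp).congr_deriv ?_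
  rw [mayerDeriv]
  ring

lemma mayerSum_scaledZeta_zero (u : V → V → ℂ) {X : Finset V} {r : V} (hr : r ∈ X) :
    mayerSum (scaledZeta u 0) X = if X = {r} then 1 else 0 := by
  rw [← mayerSum_zero hr]
  congr 1
  funext i j
  simp [scaledZeta]

section SoftInteraction

variable {u : V → V → ℂ} {f g κ : V → V → ℝ} {b : V → ℝ} {X : Finset V} {r : V}

lemma markedForestSum_norm_le (hf : ∀ i j, 0 ≤ f i j) (hg : ∀ i j, 0 ≤ g i j)
    (hκ0 : ∀ i j, 0 ≤ κ i j) (hκ : ∀ i j, κ i j = κ j i)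
    (hnorm : ∀ i j, ‖u i j‖ ≤ f i j + κ i j * g i j) {c : ℝ}
    (hst : ∑ p ∈ pairs X, κ p.1 p.2 ≤ c) (hr : r ∈ X) {t : ℝ} (ht : 0 ≤ t) :
    markedForestSum (fun i j => ‖u i j‖) (fun i j => t * f i j + g i j) {r} (X.erase r) ≤
      c * forestSum (fun i j => t * f i j + g i j) {r} (X.erase r) +
        markedForestSum f (fun i j => t * f i j + g i j) {r} (X.erase r) := by
  have hdisj : Disjoint {r} (X.erase r) := by simp
  have hw : ∀ i j, 0 ≤ t * f i j + g i j := fun i j => add_nonneg (mul_nonneg ht (hf i j)) (hg i j)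
  have hκg := markedForestSum_le hw hκ0 hκ (fun i j => mul_le_mul_of_nonneg_left
    (le_add_of_nonneg_left (mul_nonneg ht (hf i j))) (hκ0 i j)) hdisj
  rw [← insert_eq, insert_erase hr] at hκg
  refine (markedForestSum_mono hw hnorm hdisj).trans ?_
  rw [markedForestSum_add, add_comm]
  gcongr
  exact hκg.trans (mul_le_mul_of_nonneg_right hst (forestSum_nonneg hw hdisj))

lemma hasDerivAt_exp_mul_forestSum (f g : V → V → ℝ) (c t : ℝ) (r : V) (X : Finset V) :
    HasDerivAt (fun t : ℝ => Real.exp (t * c) *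
        forestSum (fun i j => t * f i j + g i j) {r} (X.erase r))
      (Real.exp (t * c) * (c * forestSum (fun i j => t * f i j + g i j) {r} (X.erase r) +
        markedForestSum f (fun i j => t * f i j + g i j) {r} (X.erase r))) t := by
  have hlin : HasDerivAt (fun t : ℝ => t * c) (1 * c) t := (hasDerivAt_id t).mul_const _
  have hforest : HasDerivAt (fun t : ℝ => forestSum (fun i j => t * f i j + g i j) {r} (X.erase r))
      (markedForestSum f (fun i j => t * f i j + g i j) {r} (X.erase r)) t :=
    hasDerivAt_forestSum (w := fun t i j => t * f i j + g i j) (fun i j =>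
      (((hasDerivAt_id t).mul_const (f i j)).add_const _).congr_deriv (one_mul _)) (by simp)
  refine (hlin.exp.mul hforest).congr_deriv ?_
  ring

-- With `U = ∑ p ∈ pairs X, u p.1 p.2` the two sides are compared along `t ∈ [0, 1]`, after
-- multiplication by `exp (t U)`; the derivative of a forest sum marks an edge, and so does the
-- evolution equation of the Mayer sums.
theorem norm_mayerSum_scaledZeta_le (hu : ∀ i j, u i j = u j i) (hf : ∀ i j, 0 ≤ f i j)
    (hg : ∀ i j, 0 ≤ g i j) (hκ0 : ∀ i j, 0 ≤ κ i j) (hκ : ∀ i j, κ i j = κ j i)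
    (hnorm : ∀ i j, ‖u i j‖ ≤ f i j + κ i j * g i j)
    (hst : ∀ A ⊆ X, ∑ p ∈ pairs A, κ p.1 p.2 ≤ (∑ p ∈ pairs A, u p.1 p.2).re + ∑ i ∈ A, b i)
    (hr : r ∈ X) {t : ℝ} (ht : t ∈ Set.Icc (0 : ℝ) 1) :
    ‖mayerSum (scaledZeta u t) X‖ ≤ Real.exp (t * ∑ i ∈ X, b i) *
      forestSum (fun i j => t * f i j + g i j) {r} (X.erase r) := by
  induction X using Finset.strongInduction generalizing r t with
  | H X ih =>
    set U : ℂ := ∑ p ∈ pairs X, u p.1 p.2 with hU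
    set β : ℝ := ∑ i ∈ X, b i
    have hw {t : ℝ} (ht : 0 ≤ t) : ∀ i j, 0 ≤ t * f i j + g i j := fun i j =>
      add_nonneg (mul_nonneg ht (hf i j)) (hg i j)
    have hexp : ∀ t : ℝ, ‖Complex.exp (t * U)‖ = Real.exp (t * U.re) := fun t => by
      rw [Complex.norm_exp, Complex.re_ofReal_mul]
    have hcompare := image_norm_le_of_norm_deriv_right_le_deriv_boundary (a := 0) (b := 1)
      (fun t _ => (hasDerivAt_mayerSum_mul_cexp hu t hr).continuousAt.continuousWithinAt)
      (fun t _ => (hasDerivAt_mayerSum_mul_cexp hu t hr).hasDerivWithinAt) ?_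
      (fun t => hasDerivAt_exp_mul_forestSum f g (U.re + β) t r X) ?_ ht
    · simp only [norm_mul, ← hU, hexp, mul_add, Real.exp_add, mul_assoc] at hcompare
      rw [mul_comm] at hcompare
      exact le_of_mul_le_mul_left hcompare (Real.exp_pos _)
    · rw [mayerSum_scaledZeta_zero u hr]
      split_ifs with hX
      · simp [hX, forestSum_empty_right]
      · simpa using forestSum_nonneg (hw le_rfl) (by simp : Disjoint {r} (X.erase r))
    · intro t ht
      have hcross := norm_crossSum_le u (m := mayerSum (scaledZeta u t)) hr (hw ht.1)
        (b := fun i => t * b i) fun A hA r hr => by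
          rw [← mul_sum]
          exact ih A hA (fun B hB => hst B (hB.trans hA.1)) hr ⟨ht.1, ht.2.le⟩
      rw [← mul_sum] at hcross
      rw [norm_mul, norm_neg, ← hU, hexp, mul_add t, Real.exp_add, mul_comm, mul_assoc]
      exact mul_le_mul_of_nonneg_left (hcross.trans (mul_le_mul_of_nonneg_left
        (markedForestSum_norm_le hf hg hκ0 hκ hnorm (hst X subset_rfl) hr ht.1)
        (Real.exp_pos _).le)) (Real.exp_pos _).le

end SoftInteraction

section HardCore

open Filter Topology

lemma tendsto_mayerSum {α S : Type*} [CommSemiring S] [TopologicalSpace S]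
    [IsTopologicalSemiring S] {l : Filter α} {ζ : α → V → V → S} {ζ' : V → V → S}
    (hζ : ∀ i j, Tendsto (fun a => ζ a i j) l (𝓝 (ζ' i j))) (X : Finset V) :
    Tendsto (fun a => mayerSum (ζ a) X) l (𝓝 (mayerSum ζ' X)) :=
  tendsto_finsetSum _ fun _ _ => tendsto_finsetProd _ fun p _ => hζ p.1 p.2

variable {z : V → V → ℂ} {hard : V → V → Prop} [∀ i j, Decidable (hard i j)] {b : V → ℝ}
  {X : Finset V} {r : V}

lemma sum_hard_le_re_sum_add (hb : ∀ i, 0 ≤ b i)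
    (hst : (∀ p ∈ pairs X, ¬ hard p.1 p.2) → 0 ≤ (∑ p ∈ pairs X, z p.1 p.2).re + ∑ i ∈ X, b i)
    {C : ℝ} (hC : ∑ p ∈ pairs X, ‖z p.1 p.2‖ ≤ C) (ρ : ℝ) :
    ∑ p ∈ pairs X, (if hard p.1 p.2 then ρ - C else 0) ≤
      (∑ p ∈ pairs X, if hard p.1 p.2 then (ρ : ℂ) else z p.1 p.2).re + ∑ i ∈ X, b i := by
  by_cases hX : ∀ p ∈ pairs X, ¬ hard p.1 p.2
  · rw [sum_congr rfl fun p hp => if_neg (hX p hp),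
      sum_congr rfl fun p hp => if_neg (hX p hp), sum_const_zero]
    exact hst hX
  · push Not at hX
    obtain ⟨q, hq, hqh⟩ := hX
    have hC0 : 0 ≤ C := (sum_nonneg fun _ _ => norm_nonneg _).trans hC
    have hone : C ≤ ∑ p ∈ pairs X, if hard p.1 p.2 then C else 0 := by
      have := single_le_sum (f := fun p : V × V => if hard p.1 p.2 then C else 0)
        (fun p _ => by positivity) hq
      simpa [hqh] using this
    have hre : ∑ p ∈ pairs X, (if hard p.1 p.2 then ρ - C else 0) +
        ∑ p ∈ pairs X, (if hard p.1 p.2 then C else 0) - ∑ p ∈ pairs X, ‖z p.1 p.2‖ ≤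
          (∑ p ∈ pairs X, if hard p.1 p.2 then (ρ : ℂ) else z p.1 p.2).re := by
      rw [Complex.re_sum, ← sum_add_distrib, ← sum_sub_distrib]
      refine sum_le_sum fun p _ => ?_
      split_ifs
      · simp
      · have := neg_le_of_abs_le (Complex.abs_re_le_norm (z p.1 p.2))
        linarith
    have hβ : 0 ≤ ∑ i ∈ X, b i := sum_nonneg fun i _ => hb i
    linarith

lemma tendsto_div_sub_atTop (C : ℝ) : Tendsto (fun ρ : ℝ => ρ / (ρ - C)) atTop (𝓝 1) := by
  have hlim : Tendsto (fun ρ : ℝ => 1 + C / (ρ - C)) atTop (𝓝 (1 + 0)) :=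
    ((tendsto_atTop_add_const_right _ (-C) tendsto_id).const_div_atTop C).const_add 1
  rw [add_zero] at hlim
  refine hlim.congr' ?_
  filter_upwards [eventually_gt_atTop C] with ρ hρ
  rw [one_add_div (sub_pos.2 hρ).ne', sub_add_cancel]

-- The hard core is the limit `ρ → ∞` of a repulsion of strength `ρ`, for which all but the
-- constant `C` is available as a stabilizing energy.
theorem norm_mayerSum_le_forestSum_hard (hz : ∀ i j, z i j = z j i)
    (hh : ∀ i j, hard i j ↔ hard j i) (hb : ∀ i, 0 ≤ b i)
    (hst : ∀ A ⊆ X, (∀ p ∈ pairs A, ¬ hard p.1 p.2) →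
      0 ≤ (∑ p ∈ pairs A, z p.1 p.2).re + ∑ i ∈ A, b i) (hr : r ∈ X) :
    ‖mayerSum (fun i j => if hard i j then -1 else Complex.exp (-z i j) - 1) X‖ ≤
      (∏ i ∈ X, Real.exp (b i)) *
        forestSum (fun i j => if hard i j then 1 else ‖z i j‖) {r} (X.erase r) := by
  set C : ℝ := ∑ p ∈ pairs X, ‖z p.1 p.2‖
  have hC0 : 0 ≤ C := sum_nonneg fun _ _ => norm_nonneg _
  have hbound : ∀ᶠ ρ : ℝ in atTop,
      ‖mayerSum (scaledZeta (fun i j => if hard i j then (ρ : ℂ) else z i j) 1) X‖ ≤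
        Real.exp (1 * ∑ i ∈ X, b i) * forestSum (fun i j =>
          1 * (if hard i j then 0 else ‖z i j‖) + if hard i j then ρ / (ρ - C) else 0)
            {r} (X.erase r) := by
    filter_upwards [eventually_gt_atTop C] with ρ hρ
    have hρC : 0 < ρ - C := sub_pos.2 hρ
    have hρ0 : 0 < ρ := hC0.trans_lt hρ
    refine norm_mayerSum_scaledZeta_le (κ := fun i j => if hard i j then ρ - C else 0)
      (fun i j => by simp only [hh i j, hz i j]) (fun i j => by positivity)
      (fun i j => by positivity) (fun i j => by positivity) (fun i j => by simp only [hh i j])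
      (fun i j => ?_) (fun A hA => sum_hard_le_re_sum_add hb (hst A hA)
        (sum_le_sum_of_subset_of_nonneg (pairs_mono hA) fun _ _ _ => norm_nonneg _) ρ) hr (by simp)
    split_ifs
    · simp [abs_of_pos hρ0, mul_div_cancel₀ ρ hρC.ne']
    · simp
  have hforest : Tendsto (fun ρ : ℝ => forestSum (fun i j =>
      1 * (if hard i j then 0 else ‖z i j‖) + if hard i j then ρ / (ρ - C) else 0)
        {r} (X.erase r)) atTop
      (𝓝 (forestSum (fun i j => if hard i j then 1 else ‖z i j‖) {r} (X.erase r))) := by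
    refine tendsto_forestSum (fun i j => ?_) (by simp)
    split_ifs
    · simpa using tendsto_div_sub_atTop C
    · simp
  have hle := le_of_tendsto_of_tendsto (tendsto_mayerSum (tendsto_scaledZeta_hard z) X).norm
    (hforest.const_mul _) hbound
  rwa [one_mul, Real.exp_sum] at hle

end HardCore

end BrydgesKennedy

section Marginals

lemma measurable_pair {V X E : Type*} [MeasurableSpace X] [MeasurableSpace E] {w : X → X → E}
    (hw : Measurable fun p : X × X => w p.1 p.2) (i j : V) :
    Measurable fun x : V → X => w (x i) (x j) :=
  hw.comp (f := fun x : V → X => (x i, x j))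
    ((measurable_pi_apply i).prodMk (measurable_pi_apply j))

variable {V X : Type*} [DecidableEq V] [MeasurableSpace X] (ν : Measure X)

lemma lmarginal_congr_of_eq_off {s : Finset V} {f g : (V → X) → ℝ≥0∞} {x : V → X}
    (h : ∀ z : V → X, (∀ i ∉ s, z i = x i) → f z = g z) :
    (∫⋯∫⁻_s, f ∂fun _ => ν) x = (∫⋯∫⁻_s, g ∂fun _ => ν) x :=
  lintegral_congr fun y => h _ fun i hi => by simp [Function.updateFinset, hi]

lemma lmarginal_const_mul {s : Finset V} {f : (V → X) → ℝ≥0∞}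
    (hf : Measurable f) (c : ℝ≥0∞) (x : V → X) :
    (∫⋯∫⁻_s, (fun z => c * f z) ∂fun _ => ν) x = c * (∫⋯∫⁻_s, f ∂fun _ => ν) x :=
  lintegral_const_mul c (hf.comp measurable_updateFinset)

lemma lmarginal_sum {ι : Type*} (S : Finset ι) {s : Finset V}
    {f : ι → (V → X) → ℝ≥0∞} (hf : ∀ k ∈ S, Measurable (f k)) (x : V → X) :
    (∫⋯∫⁻_s, (fun z => ∑ k ∈ S, f k z) ∂fun _ => ν) x =
      ∑ k ∈ S, (∫⋯∫⁻_s, f k ∂fun _ => ν) x :=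
  lintegral_finsetSum S fun k hk => (hf k hk).comp measurable_updateFinset

lemma lmarginal_prod [SigmaFinite ν] {g : X → ℝ≥0∞} (hg : Measurable g)
    (s : Finset V) (x : V → X) :
    (∫⋯∫⁻_s, (fun z => ∏ k ∈ s, g (z k)) ∂fun _ => ν) x = (∫⁻ y, g y ∂ν) ^ #s := by
  induction s using Finset.induction_on with
  | empty => simp
  | insert i s hi ih =>
    have hm : ∀ s : Finset V, Measurable fun z : V → X => ∏ k ∈ s, g (z k) := fun s =>
      Finset.measurable_fun_prod _ fun k _ => hg.comp (measurable_pi_apply k)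
    rw [lmarginal_insert' _ (hm _) hi, card_insert_of_notMem hi, pow_succ', ← ih,
      ← lmarginal_const_mul ν (hm s)]
    congr 1
    funext z
    rw [← lintegral_mul_const _ hg]
    refine lintegral_congr fun y => ?_
    rw [prod_insert hi, Function.update_self]
    congr 1
    exact prod_congr rfl fun k hk => by
      rw [Function.update_of_ne (ne_of_mem_of_not_mem hk hi)]

end Marginals

section ForestIntegral

variable {V X : Type*} [LinearOrder V] [MeasurableSpace X]

lemma forestSum_mul_right {S : Type*} [CommSemiring S] (w : V → V → S) (g : V → S)
    {R Y : Finset V} (hRY : Disjoint R Y) :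
    forestSum (fun i j => w i j * g j) R Y = (∏ j ∈ Y, g j) * forestSum w R Y := by
  induction hRY using peel_induction with
  | empty Y =>
    simp only [forestSum_empty_left]
    split_ifs with h <;> simp [h]
  | peel R Y hRY hR ih =>
    obtain ⟨i, hi⟩ := hR
    rw [forestSum_eq_sum _ hRY hi, forestSum_eq_sum _ hRY hi, mul_sum]
    refine sum_congr rfl fun K hK => ?_
    rw [mem_powerset] at hK
    rw [ih i hi K hK, prod_mul_distrib, ← prod_sdiff hK]
    ring

variable {w : X → X → ℝ≥0∞}

lemma measurable_forestSum (hw : Measurable fun p : X × X => w p.1 p.2)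
    {R Y : Finset V} (hRY : Disjoint R Y) :
    Measurable fun x : V → X => forestSum (fun i j => w (x i) (x j)) R Y := by
  induction hRY using peel_induction with
  | empty Y =>
    simp_rw [forestSum_empty_left]
    exact measurable_const
  | peel R Y hRY hR ih =>
    obtain ⟨i, hi⟩ := hR
    simp_rw [fun w => forestSum_eq_sum (V := V) (S := ℝ≥0∞) w hRY hi]
    refine Finset.measurable_fun_sum _ fun K hK => Measurable.mul ?_
      (ih i hi K (mem_powerset.1 hK))
    exact Finset.measurable_fun_prod _ fun k _ => measurable_pair hw i k

/-- The integral of the forest sum with roots `R` over the positions of the other vertices `Y`,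
as a function of the positions of the roots. -/
def forestIntegral (ν : Measure X) (w : X → X → ℝ≥0∞) (R Y : Finset V) : (V → X) → ℝ≥0∞ :=
  ∫⋯∫⁻_Y, (fun x => forestSum (fun i j => w (x i) (x j)) R Y) ∂fun _ => ν

variable {ν : Measure X}

lemma forestIntegral_empty_left (Y : Finset V) (x : V → X) :
    forestIntegral ν w ∅ Y x = if Y = ∅ then 1 else 0 := by
  rcases eq_or_ne Y ∅ with rfl | hY
  · simp [forestIntegral, forestSum_empty_left]
  · simp [forestIntegral, forestSum_empty_left, hY, lmarginal]

variable [SigmaFinite ν]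

lemma measurable_forestIntegral (hw : Measurable fun p : X × X => w p.1 p.2)
    {R Y : Finset V} (hRY : Disjoint R Y) : Measurable (forestIntegral ν w R Y) :=
  (measurable_forestSum hw hRY).lmarginal _

lemma forestIntegral_eq_sum (hw : Measurable fun p : X × X => w p.1 p.2)
    {R Y : Finset V} (hRY : Disjoint R Y) {i : V} (hi : i ∈ R) (x : V → X) :
    forestIntegral ν w R Y x = ∑ K ∈ Y.powerset, (∫⋯∫⁻_K, (fun z =>
      (∏ k ∈ K, w (z i) (z k)) * forestIntegral ν w (R.erase i ∪ K) (Y \ K) z) ∂fun _ => ν) x := by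
  have hiY : i ∉ Y := Finset.disjoint_left.1 hRY hi
  have hf : ∀ K : Finset V, Measurable fun x : V → X =>
      forestSum (fun i j => w (x i) (x j)) (R.erase i ∪ K) (Y \ K) := fun K =>
    measurable_forestSum hw (disjoint_erase_union_sdiff hRY i K)
  have hwf : ∀ K : Finset V, Measurable fun x : V → X => (∏ k ∈ K, w (x i) (x k)) *
      forestSum (fun i j => w (x i) (x j)) (R.erase i ∪ K) (Y \ K) := fun K =>
    (Finset.measurable_fun_prod _ fun k _ => measurable_pair hw i k).fun_mul (hf K)
  rw [forestIntegral]
  simp_rw [fun w => forestSum_eq_sum (V := V) (S := ℝ≥0∞) w hRY hi]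
  rw [lmarginal_sum ν _ fun K _ => hwf K]
  refine sum_congr rfl fun K hK => ?_
  have hKY := union_sdiff_of_subset (mem_powerset.1 hK)
  conv_lhs => rw [← hKY]
  rw [lmarginal_union _ _ (by rw [hKY]; exact hwf K) disjoint_sdiff]
  congr 1
  funext z
  rw [hKY, forestIntegral, ← lmarginal_const_mul ν (hf K)]
  refine lmarginal_congr_of_eq_off ν fun z' hz' => ?_
  rw [hz' i (by simp [hiY])]
  congr 1
  exact prod_congr rfl fun k hk => by rw [hz' k (by simp [hk])]

variable {e : X → ℝ≥0∞} {ε : ℝ≥0∞}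

lemma lmarginal_prod_mul_prod_union (hw : Measurable fun p : X × X => w p.1 p.2)
    (he : Measurable e) {R K : Finset V} (hRK : Disjoint R K) {i : V} (hi : i ∉ K) (x : V → X) :
    (∫⋯∫⁻_K, (fun z => (∏ k ∈ K, w (z i) (z k)) * ∏ j ∈ R ∪ K, e (z j)) ∂fun _ => ν) x =
      (∏ j ∈ R, e (x j)) * (∫⁻ y, w (x i) y * e y ∂ν) ^ #K := by
  have hwe : Measurable fun y => w (x i) y * e y := (hw.comp measurable_prodMk_left).mul he
  have hprod : Measurable fun z : V → X => ∏ k ∈ K, (w (x i) (z k) * e (z k)) :=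
    Finset.measurable_fun_prod _ fun k _ => hwe.comp (measurable_pi_apply k)
  rw [← lmarginal_prod ν hwe, ← lmarginal_const_mul ν hprod]
  refine lmarginal_congr_of_eq_off ν fun z hz => ?_
  have hR : ∏ j ∈ R, e (z j) = ∏ j ∈ R, e (x j) :=
    prod_congr rfl fun j hj => by rw [hz j (Finset.disjoint_left.1 hRK hj)]
  rw [hz i hi, prod_union hRK, prod_mul_distrib, hR]
  ring

lemma sum_lmarginal_prod_mul_forestIntegral_le (hw : Measurable fun p : X × X => w p.1 p.2)
    (he : Measurable e) {R K L : Finset V} (hRK : Disjoint R K) (hRKL : Disjoint (R ∪ K) L)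
    {i : V} (hi : i ∉ K)
    (hL : ∀ z : V → X, ∑ Z ∈ L.powerset, ε ^ #Z * forestIntegral ν w (R ∪ K) Z z ≤
      ∏ j ∈ R ∪ K, e (z j)) (x : V → X) :
    ∑ Z ∈ L.powerset, ε ^ #Z * (∫⋯∫⁻_K, (fun z => (∏ k ∈ K, w (z i) (z k)) *
        forestIntegral ν w (R ∪ K) Z z) ∂fun _ => ν) x ≤
      (∏ j ∈ R, e (x j)) * (∫⁻ y, w (x i) y * e y ∂ν) ^ #K := by
  have hwF : ∀ Z ∈ L.powerset, Measurable fun z : V → X =>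
      (∏ k ∈ K, w (z i) (z k)) * forestIntegral ν w (R ∪ K) Z z := fun Z hZ =>
    (Finset.measurable_fun_prod _ fun k _ => measurable_pair hw i k).fun_mul
      (measurable_forestIntegral hw (hRKL.mono_right (mem_powerset.1 hZ)))
  calc _ = (∫⋯∫⁻_K, (fun z => ∑ Z ∈ L.powerset, ε ^ #Z * ((∏ k ∈ K, w (z i) (z k)) *
          forestIntegral ν w (R ∪ K) Z z)) ∂fun _ => ν) x := by
        rw [lmarginal_sum ν _ fun Z hZ => (hwF Z hZ).const_mul _]
        exact sum_congr rfl fun Z hZ => (lmarginal_const_mul ν (hwF Z hZ) _ _).symm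
    _ ≤ (∫⋯∫⁻_K, (fun z => (∏ k ∈ K, w (z i) (z k)) * ∏ j ∈ R ∪ K, e (z j)) ∂fun _ => ν) x := by
        refine lmarginal_mono (fun z => ?_) x
        simp_rw [mul_left_comm (ε ^ _)]
        rw [← mul_sum]
        gcongr
        exact hL z
    _ = _ := lmarginal_prod_mul_prod_union hw he hRK hi x

-- A discrete version of the sum over all forests: picking the vertices from `n` labels, each with
-- weight `ε`, turns the sum over the sets of children of a root into a binomial sum.
lemma sum_pow_card_mul_forestIntegral_le (hw : Measurable fun p : X × X => w p.1 p.2)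
    (he : Measurable e) {n : ℕ} (hwe : ∀ x, (1 + ε * ∫⁻ y, w x y * e y ∂ν) ^ n ≤ e x)
    {R L : Finset V} (hRL : Disjoint R L) (hL : #L ≤ n) (x : V → X) :
    ∑ Y ∈ L.powerset, ε ^ #Y * forestIntegral ν w R Y x ≤ ∏ i ∈ R, e (x i) := by
  induction hRL using peel_induction generalizing x with
  | empty L => simp [forestIntegral_empty_left]
  | peel R L hRL hR ih =>
    obtain ⟨i, hi⟩ := hR
    have hK : ∀ K ∈ L.powerset, ∑ Z ∈ (L \ K).powerset, ε ^ #(K ∪ Z) *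
          (∫⋯∫⁻_K, (fun z => (∏ k ∈ K, w (z i) (z k)) *
            forestIntegral ν w (R.erase i ∪ K) ((K ∪ Z) \ K) z) ∂fun _ => ν) x ≤
        (∏ j ∈ R.erase i, e (x j)) * (ε * ∫⁻ y, w (x i) y * e y ∂ν) ^ #K := by
      intro K hK
      rw [mem_powerset] at hK
      have hsum := sum_lmarginal_prod_mul_forestIntegral_le (ε := ε) hw he
        (hRL.mono (erase_subset i R) hK) (disjoint_erase_union_sdiff hRL i K)
        (fun h => Finset.disjoint_left.1 hRL hi (hK h))
        (ih i hi K hK ((card_le_card sdiff_subset).trans hL)) x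
      rw [mul_pow, mul_left_comm]
      refine le_trans (le_of_eq ?_) (mul_le_mul_right hsum (ε ^ #K))
      rw [mul_sum]
      refine sum_congr rfl fun Z hZ => ?_
      rw [mem_powerset, subset_sdiff] at hZ
      rw [union_sdiff_cancel_left hZ.2.symm, card_union_of_disjoint hZ.2.symm, pow_add, mul_assoc]
    have hbinom : ∀ c : ℝ≥0∞, ∑ K ∈ L.powerset, c ^ #K = (1 + c) ^ #L := fun c => by
      simpa [add_comm] using sum_pow_mul_eq_add_pow c 1 L
    calc _ = ∑ Y ∈ L.powerset, ∑ K ∈ Y.powerset, ε ^ #Y * (∫⋯∫⁻_K, (fun z =>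
            (∏ k ∈ K, w (z i) (z k)) * forestIntegral ν w (R.erase i ∪ K) (Y \ K) z)
            ∂fun _ => ν) x := sum_congr rfl fun Y hY => by
          rw [forestIntegral_eq_sum hw (hRL.mono_right (mem_powerset.1 hY)) hi, mul_sum]
      _ ≤ (∏ j ∈ R.erase i, e (x j)) * (1 + ε * ∫⁻ y, w (x i) y * e y ∂ν) ^ #L := by
          rw [sum_powerset_powerset, ← hbinom, mul_sum]
          exact sum_le_sum hK
      _ ≤ (∏ j ∈ R.erase i, e (x j)) * e (x i) := by
          gcongr
          exact (pow_le_pow_right₀ le_self_add hL).trans (hwe (x i))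
      _ = _ := prod_erase_mul R (fun j => e (x j)) hi

end ForestIntegral

section TreeIntegral

open Filter Topology

variable {X : Type*} [MeasurableSpace X]

/-- The integral over the labelled trees on `m + 1` points, the first of which is fixed. -/
def treeIntegral (ν : Measure X) (w : X → X → ℝ≥0∞) (m : ℕ) (x₀ : X) : ℝ≥0∞ :=
  ∫⁻ y : Fin m → X, forestSum (fun i j : Fin (m + 1) =>
    w (Matrix.vecCons x₀ y i) (Matrix.vecCons x₀ y j)) {0} (univ.erase 0) ∂Measure.pi fun _ => ν

lemma measurable_vecCons (m : ℕ) :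
    Measurable fun p : X × (Fin m → X) => (Matrix.vecCons p.1 p.2 : Fin (m + 1) → X) := by
  refine measurable_pi_iff.2 fun i => Fin.cases measurable_fst (fun k => ?_) i
  exact (measurable_pi_apply k).comp measurable_snd

lemma exists_map_univ_erase_zero_eq {N : ℕ} {Y : Finset (Fin (N + 1))} (hY : 0 ∉ Y) :
    ∃ e : Fin (#Y + 1) ↪ Fin (N + 1), e 0 = 0 ∧ (∀ k, e k.succ = Y.orderEmbOfFin rfl k) ∧
      (univ.erase 0).map e = Y := by
  have hmem : ∀ k, Y.orderEmbOfFin rfl k ∈ Y := fun k => Y.orderEmbOfFin_mem rfl k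
  have hinj : Function.Injective (Fin.cons 0 (Y.orderEmbOfFin rfl) : Fin (#Y + 1) → Fin (N + 1)) :=
    Fin.cons_injective_iff.2
      ⟨fun ⟨k, hk⟩ => hY (hk ▸ hmem k), (Y.orderEmbOfFin rfl).injective⟩
  refine ⟨⟨_, hinj⟩, rfl, fun k => rfl, ?_⟩
  rw [map_eq_image, ← compl_singleton, ← Fin.image_succ_univ, image_image]
  exact Y.image_orderEmbOfFin_univ rfl

variable {ν : Measure X} [SigmaFinite ν] {w : X → X → ℝ≥0∞}

lemma forestIntegral_eq_treeIntegral (hw : Measurable fun p : X × X => w p.1 p.2) {N : ℕ}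
    {Y : Finset (Fin (N + 1))} (hY : 0 ∉ Y) (x₀ : X) :
    forestIntegral ν w {0} Y (fun _ => x₀) = treeIntegral ν w #Y x₀ := by
  obtain ⟨e, he₀, he, heY⟩ := exists_map_univ_erase_zero_eq hY
  have hR : ({0} : Finset (Fin (N + 1))) = ({0} : Finset (Fin (#Y + 1))).map e := by
    rw [map_singleton, he₀]
  have hm : Measurable fun y : Fin #Y → X => forestSum (fun i j : Fin (#Y + 1) =>
      w (Matrix.vecCons x₀ y i) (Matrix.vecCons x₀ y j)) {0} (univ.erase 0) :=
    (measurable_forestSum hw (by simp)).comp ((measurable_vecCons #Y).comp measurable_prodMk_left)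
  have himage := lmarginal_image (μ := fun _ : Fin (N + 1) => ν)
    (Y.orderEmbOfFin rfl).injective univ hm fun _ => x₀
  rw [image_orderEmbOfFin_univ, lmarginal_univ] at himage
  refine Eq.trans (lmarginal_congr_of_eq_off ν fun z hz => ?_) himage
  have hze : ∀ i, z (e i) = Matrix.vecCons x₀ (z ∘' ⇑(Y.orderEmbOfFin rfl)) i := by
    refine Fin.cases ?_ fun k => ?_
    · rw [he₀, hz 0 hY, Matrix.cons_val_zero]
    · rw [he, Matrix.cons_val_succ]
  have hmap := forestSum_map e (fun i j => w (z i) (z j)) (R := {0}) (Y := univ.erase 0) (by simp)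
  rw [← hR, heY] at hmap
  simp only [hmap, Function.comp_apply, hze]

lemma sum_range_choose_mul_treeIntegral_le (hw : Measurable fun p : X × X => w p.1 p.2)
    {e : X → ℝ≥0∞} (he : Measurable e) {ε : ℝ≥0∞} {N : ℕ}
    (hwe : ∀ x, (1 + ε * ∫⁻ y, w x y * e y ∂ν) ^ N ≤ e x) (x₀ : X) :
    ∑ m ∈ range (N + 1), (N.choose m * ε ^ m) * treeIntegral ν w m x₀ ≤ e x₀ := by
  have hsum := sum_pow_card_mul_forestIntegral_le (V := Fin (N + 1)) hw he hwe
    (R := {0}) (L := univ.erase 0) (by simp) (by simp) fun _ => x₀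
  rw [prod_singleton, sum_congr rfl fun Y hY => by
      rw [forestIntegral_eq_treeIntegral hw (subset_erase.1 (mem_powerset.1 hY)).2],
    sum_powerset_apply_card fun m => ε ^ m * treeIntegral ν w m x₀] at hsum
  simpa [mul_assoc] using hsum

lemma one_add_mul_pow_le_exp {ε α : ℝ} (hε : 0 ≤ ε) (hα : 0 ≤ α) {n : ℕ} (hn : ε * n ≤ 1)
    {I : ℝ≥0∞} (hI : I ≤ ENNReal.ofReal α) :
    (1 + ENNReal.ofReal ε * I) ^ n ≤ ENNReal.ofReal (Real.exp α) := by
  have hbase : 1 + ENNReal.ofReal ε * I ≤ ENNReal.ofReal (Real.exp (ε * α)) := by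
    calc 1 + ENNReal.ofReal ε * I ≤ 1 + ENNReal.ofReal ε * ENNReal.ofReal α := by gcongr
      _ = ENNReal.ofReal (1 + ε * α) := by
        rw [← ENNReal.ofReal_mul hε, ENNReal.ofReal_add zero_le_one (mul_nonneg hε hα),
          ENNReal.ofReal_one]
      _ ≤ _ := ENNReal.ofReal_le_ofReal (by linarith [Real.add_one_le_exp (ε * α)])
  calc (1 + ENNReal.ofReal ε * I) ^ n ≤ ENNReal.ofReal (Real.exp (ε * α)) ^ n := by gcongr
    _ = ENNReal.ofReal (Real.exp (n * (ε * α))) := by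
      rw [← ENNReal.ofReal_pow (Real.exp_pos _).le, Real.exp_nat_mul]
    _ ≤ _ := ENNReal.ofReal_le_ofReal (Real.exp_le_exp.2 (by nlinarith))

lemma tendsto_choose_mul_one_div_pow (m : ℕ) :
    Tendsto (fun N : ℕ => (N.choose m * ENNReal.ofReal (1 / N) ^ m : ℝ≥0∞)) atTop
      (𝓝 (ENNReal.ofReal (1 / m.factorial))) := by
  have hone : Tendsto (fun N : ℕ => (N : ℝ) * (1 / N)) atTop (𝓝 1) :=
    tendsto_const_nhds.congr' <| (eventually_ne_atTop 0).mono fun N hN => by field_simp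
  have hlim := ENNReal.tendsto_ofReal (ProbabilityTheory.tendsto_choose_mul_pow_atTop m hone)
  rw [one_pow] at hlim
  refine hlim.congr fun N => ?_
  rw [ENNReal.ofReal_mul (by positivity), ENNReal.ofReal_natCast,
    ENNReal.ofReal_pow (by positivity)]

-- The Kotecký–Preiss criterion sums over all trees; the factor `1 / m!` arises as the limit of
-- `N.choose m / N ^ m`.
theorem tsum_treeIntegral_le (hw : Measurable fun p : X × X => w p.1 p.2) {a : X → ℝ}
    (ha : Measurable a) (ha0 : ∀ x, 0 ≤ a x)
    (hcrit : ∀ x, ∫⁻ y, w x y * ENNReal.ofReal (Real.exp (a y)) ∂ν ≤ ENNReal.ofReal (a x))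
    (x₀ : X) :
    ∑' m : ℕ, ENNReal.ofReal (1 / m.factorial) * treeIntegral ν w m x₀ ≤
      ENNReal.ofReal (Real.exp (a x₀)) := by
  refine ENNReal.tsum_le_of_sum_range_le fun M => ?_
  have hlim : Tendsto (fun N : ℕ => ∑ m ∈ range M,
      (N.choose m * ENNReal.ofReal (1 / N) ^ m) * treeIntegral ν w m x₀) atTop
      (𝓝 (∑ m ∈ range M, ENNReal.ofReal (1 / m.factorial) * treeIntegral ν w m x₀)) := by
    refine tendsto_finsetSum _ fun m _ => ENNReal.Tendsto.mul_const
      (tendsto_choose_mul_one_div_pow m) (Or.inl ?_)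
    rw [Ne, ENNReal.ofReal_eq_zero, not_le]
    positivity
  refine le_of_tendsto hlim ?_
  filter_upwards [eventually_gt_atTop 0, eventually_ge_atTop M] with N hN hM
  have hN0 : (N : ℝ) ≠ 0 := by exact_mod_cast hN.ne'
  exact (sum_le_sum_of_subset (range_subset_range.2 (by lia))).trans <|
    sum_range_choose_mul_treeIntegral_le hw ha.exp.ennreal_ofReal
      (fun x => one_add_mul_pow_le_exp (by positivity) (ha0 x) (one_div_mul_cancel hN0).le
        (hcrit x)) x₀

end TreeIntegral

section Phase

open Filter

variable {X : Type*} [MeasurableSpace X]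

instance isFiniteMeasure_absPi (μ : ComplexMeasure X) [IsFiniteMeasure μ.variation] (n : ℕ) :
    IsFiniteMeasure (absPi μ n) := by
  unfold absPi; infer_instance

lemma withDensityᵥ_rnDeriv_eq_of_absolutelyContinuous (μ : ComplexMeasure X) (ν : Measure X)
    [SigmaFinite ν] (h : μ ≪ᵥ ν.toENNRealVectorMeasure) : ν.withDensityᵥ (μ.rnDeriv ν) = μ := by
  obtain ⟨hre, him⟩ := (ComplexMeasure.absolutelyContinuous_ennreal_iff μ _).1 h
  have hi := ComplexMeasure.integrable_rnDeriv μ ν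
  ext s hs
  rw [withDensityᵥ_apply hi hs]
  refine Complex.ext ?_ ?_
  · rw [← RCLike.re_eq_complex_re, ← integral_re hi.integrableOn]
    refine (withDensityᵥ_apply (SignedMeasure.integrable_rnDeriv _ ν) hs).symm.trans ?_
    exact congrArg (fun σ : SignedMeasure X => σ s)
      (SignedMeasure.withDensityᵥ_rnDeriv_eq (ComplexMeasure.re μ) ν hre)
  · rw [← RCLike.im_eq_complex_im, ← integral_im hi.integrableOn]
    refine (withDensityᵥ_apply (SignedMeasure.integrable_rnDeriv _ ν) hs).symm.trans ?_
    exact congrArg (fun σ : SignedMeasure X => σ s)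
      (SignedMeasure.withDensityᵥ_rnDeriv_eq (ComplexMeasure.im μ) ν him)

/-- `h` is the unimodular factor of the polar decomposition `dμ = h d|μ|` of the complex measure
`μ`. It turns integrals against `μ` into Bochner integrals against the total variation. -/
structure IsPhase (μ : ComplexMeasure X) (h : X → ℂ) : Prop where
  measurable : Measurable h
  norm_eq_one : ∀ x, ‖h x‖ = 1
  withDensityᵥ_eq : μ.variation.withDensityᵥ h = μ

lemma exists_isPhase (μ : ComplexMeasure X) [IsFiniteMeasure μ.variation] :
    ∃ h : X → ℂ, IsPhase μ h := by
  classical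
  set g := μ.rnDeriv μ.variation
  have hg := withDensityᵥ_rnDeriv_eq_of_absolutelyContinuous μ _ μ.absolutelyContinuous
  have hgi : Integrable g μ.variation := ComplexMeasure.integrable_rnDeriv μ _
  have hgm : Measurable g := by
    have hre := SignedMeasure.measurable_rnDeriv (ComplexMeasure.re μ) μ.variation
    have him := SignedMeasure.measurable_rnDeriv (ComplexMeasure.im μ) μ.variation
    exact Complex.measurableEquivRealProd.symm.measurable.comp (hre.prodMk him)
  have hg1 : ∀ᵐ x ∂μ.variation, ‖g x‖ₑ = 1 := by
    have hvar := Measure.variation_withDensityᵥ hgi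
    rw [hg] at hvar
    refine (withDensity_eq_iff hgm.enorm.aemeasurable aemeasurable_const hgi.2.ne).1 ?_
    rw [← hvar, withDensity_const, one_smul]
  have hae : (fun x => if ‖g x‖ = 1 then g x else 1) =ᵐ[μ.variation] g := by
    filter_upwards [hg1] with x hx
    rw [if_pos (by simpa using congrArg ENNReal.toReal hx)]
  refine ⟨fun x => if ‖g x‖ = 1 then g x else 1,
    .ite (measurableSet_eq_fun hgm.norm measurable_const) hgm measurable_const,
    fun x => by split_ifs with h <;> simp [h], ?_⟩
  rw [WithDensityᵥEq.congr_ae hae, hg]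

namespace IsPhase

variable {μ : ComplexMeasure X} {h : X → ℂ}

lemma integrable_mul_prod (hμ : IsPhase μ h) {ι Y : Type*} [Fintype ι] [MeasurableSpace Y]
    {m : Measure Y} {φ : Y → ι → X} (hφ : Measurable φ) {F : Y → ℂ} (hF : Integrable F m) :
    Integrable (fun y => F y * ∏ i, h (φ y i)) m :=
  hF.mul_bdd (c := 1)
    (Finset.measurable_fun_prod _ fun i _ => hμ.measurable.comp
      ((measurable_pi_apply i).comp hφ)).aestronglyMeasurable
    (Eventually.of_forall fun y => by simp [norm_prod, hμ.norm_eq_one])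

lemma integrable_mul (hμ : IsPhase μ h) {f : X → ℂ} (hf : Integrable f μ.variation) :
    Integrable (fun x => f x * h x) μ.variation :=
  hf.mul_bdd (c := 1) hμ.measurable.aestronglyMeasurable
    (Eventually.of_forall fun x => (hμ.norm_eq_one x).le)

lemma continuous_integral_mul (hμ : IsPhase μ h) :
    Continuous fun f : X →₁[μ.variation] ℂ => ∫ x, f x * h x ∂μ.variation := by
  refine LipschitzWith.continuous (K := 1) (LipschitzWith.of_dist_le_mul fun f₁ f₂ => ?_)
  rw [dist_eq_norm, ← integral_sub (hμ.integrable_mul (L1.integrable_coeFn f₁))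
    (hμ.integrable_mul (L1.integrable_coeFn f₂)), NNReal.coe_one, one_mul, dist_eq_norm,
    L1.norm_eq_integral_norm]
  refine (norm_integral_le_integral_norm _).trans (le_of_eq (integral_congr_ae ?_))
  filter_upwards [Lp.coeFn_sub f₁ f₂] with x hx
  rw [hx, Pi.sub_apply, ← sub_mul, norm_mul, hμ.norm_eq_one, mul_one]

lemma integral_indicator_mul [IsFiniteMeasure μ.variation] (hμ : IsPhase μ h) (c : ℂ) {s : Set X}
    (hs : MeasurableSet s) : ∫ x, s.indicator (fun _ => c) x * h x ∂μ.variation = c * μ s := by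
  have hh : Integrable h μ.variation := by
    simpa using hμ.integrable_mul (integrable_const (1 : ℂ))
  have hind : ∀ x, s.indicator (fun _ => c) x * h x = s.indicator (fun x => c * h x) x :=
    fun x => by by_cases hx : x ∈ s <;> simp [hx]
  simp_rw [hind]
  rw [integral_indicator hs, integral_const_mul, ← withDensityᵥ_apply hh hs, hμ.withDensityᵥ_eq]

lemma vectorMeasure_integral_eq [IsFiniteMeasure μ.variation] (hμ : IsPhase μ h) {f : X → ℂ}
    (hf : Integrable f μ.variation) :
    VectorMeasure.integral μ f (ContinuousLinearMap.mul ℝ ℂ) = ∫ x, f x * h x ∂μ.variation := by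
  refine Integrable.induction (P := fun f => VectorMeasure.integral μ f
    (ContinuousLinearMap.mul ℝ ℂ) = ∫ x, f x * h x ∂μ.variation) ?_ ?_ ?_ ?_ hf
  · intro c s hs _
    rw [hμ.integral_indicator_mul c hs, VectorMeasure.integral_indicator hs,
      VectorMeasure.setIntegral_const]
    simp
  · intro f₁ f₂ _ hf₁ hf₂ ih₁ ih₂
    rw [VectorMeasure.integral_add hf₁ hf₂, ih₁, ih₂,
      ← integral_add (hμ.integrable_mul hf₁) (hμ.integrable_mul hf₂)]
    simp [add_mul]
  · exact isClosed_eq VectorMeasure.continuous_integral hμ.continuous_integral_mul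
  · intro f₁ f₂ hf _ ih
    rw [← VectorMeasure.integral_congr_ae hf, ih]
    exact integral_congr_ae (hf.mono fun x hx => congrArg (· * h x) hx)

end IsPhase

lemma coe_piFinSuccAbove_symm (n : ℕ) :
    ⇑(MeasurableEquiv.piFinSuccAbove (fun _ : Fin (n + 1) => X) 0).symm =
      fun p : X × (Fin n → X) => (Matrix.vecCons p.1 p.2 : Fin (n + 1) → X) :=
  funext fun p => Fin.insertNth_zero' p.1 p.2

lemma measurePreserving_vecCons (ν : Measure X) [SigmaFinite ν] (n : ℕ) :
    MeasurePreserving (fun p : X × (Fin n → X) => (Matrix.vecCons p.1 p.2 : Fin (n + 1) → X))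
      (ν.prod (Measure.pi fun _ => ν)) (Measure.pi fun _ => ν) := by
  have h := (measurePreserving_piFinSuccAbove (fun _ : Fin (n + 1) => ν) 0).symm
  rwa [coe_piFinSuccAbove_symm] at h

lemma measurableEmbedding_vecCons (n : ℕ) :
    MeasurableEmbedding (fun p : X × (Fin n → X) =>
      (Matrix.vecCons p.1 p.2 : Fin (n + 1) → X)) := by
  have h := (MeasurableEquiv.piFinSuccAbove (fun _ : Fin (n + 1) => X) 0).symm.measurableEmbedding
  rwa [coe_piFinSuccAbove_symm] at h

lemma IsPhase.iterInt_eq {μ : ComplexMeasure X} [IsFiniteMeasure μ.variation] {h : X → ℂ}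
    (hμ : IsPhase μ h) (n : ℕ) {F : (Fin n → X) → ℂ} (hF : Integrable F (absPi μ n)) :
    iterInt μ n F = ∫ y, F y * ∏ i, h (y i) ∂absPi μ n := by
  induction n with
  | zero =>
    rw [iterInt, absPi, Measure.pi_of_empty _ ![], integral_dirac]
    simp
  | succ n ih =>
    have hmp := measurePreserving_vecCons μ.variation n
    have hme := measurableEmbedding_vecCons (X := X) n
    have hFcons := (hmp.integrable_comp_emb hme).2 hF
    have hFprod : Integrable (fun p : X × (Fin n → X) =>
        F (Matrix.vecCons p.1 p.2) * ∏ i, h (p.2 i)) (μ.variation.prod (absPi μ n)) :=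
      hμ.integrable_mul_prod measurable_snd hFcons
    have hslice : (fun x => iterInt μ n fun y => F (Matrix.vecCons x y)) =ᵐ[μ.variation]
        fun x => ∫ y, F (Matrix.vecCons x y) * ∏ i, h (y i) ∂absPi μ n :=
      hFcons.prod_right_ae.mono fun x hx => ih hx
    rw [iterInt, VectorMeasure.integral_congr_ae hslice,
      hμ.vectorMeasure_integral_eq hFprod.integral_prod_left,
      show absPi μ (n + 1) = Measure.pi fun _ => μ.variation from rfl, ← hmp.integral_comp hme]
    refine Eq.trans ?_ (integral_prod _
      ((hmp.integrable_comp_emb hme).2 (hμ.integrable_mul_prod measurable_id hF))).symm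
    refine integral_congr_ae (Eventually.of_forall fun x => ?_)
    simp only [Function.comp_apply, Fin.prod_univ_succ, Matrix.cons_val_zero, Matrix.cons_val_succ,
      id_eq]
    rw [← integral_mul_const]
    exact integral_congr_ae (Eventually.of_forall fun y => by ring)

end Phase

section Convolution

variable {X : Type*} [MeasurableSpace X]

lemma measurePreserving_restrict_compl (ν : Measure X) [SigmaFinite ν] {n j l : ℕ}
    {A : Finset (Fin n)} (hj : #A = j) (hl : #Aᶜ = l) :
    MeasurePreserving (fun y : Fin n → X => (y ∘ A.orderEmbOfFin hj, y ∘ Aᶜ.orderEmbOfFin hl))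
      (Measure.pi fun _ => ν) ((Measure.pi fun _ => ν).prod (Measure.pi fun _ => ν)) :=
  (measurePreserving_sumPiEquivProdPi fun _ : Fin j ⊕ Fin l => ν).comp
    (measurePreserving_piCongrLeft (fun _ : Fin n => ν) (finSumEquivOfFinset hj hl)).symm

lemma measurableEmbedding_restrict_compl {n j l : ℕ} {A : Finset (Fin n)} (hj : #A = j)
    (hl : #Aᶜ = l) : MeasurableEmbedding
      (fun y : Fin n → X => (y ∘ A.orderEmbOfFin hj, y ∘ Aᶜ.orderEmbOfFin hl)) :=
  ((MeasurableEquiv.piCongrLeft (fun _ : Fin n => X) (finSumEquivOfFinset hj hl)).symm.trans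
    (MeasurableEquiv.sumPiEquivProdPi fun _ : Fin j ⊕ Fin l => X)).measurableEmbedding

lemma prod_eq_prod_restrict_mul_prod_compl {M : Type*} [CommMonoid M] {n : ℕ}
    (A : Finset (Fin n)) (f : Fin n → M) :
    ∏ i, f i = (∏ i, f (A.orderEmbOfFin rfl i)) * ∏ i, f (Aᶜ.orderEmbOfFin rfl i) := by
  rw [← (finSumEquivOfFinset (s := A) rfl rfl).prod_comp, Fintype.prod_sum_type]
  simp

variable {μ : ComplexMeasure X} [IsFiniteMeasure μ.variation] {f g : ∀ n, (Fin n → X) → ℂ}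

lemma integrable_restrict_mul_compl (hf : ∀ n, Integrable (f n) (absPi μ n))
    (hg : ∀ n, Integrable (g n) (absPi μ n)) {n : ℕ} (A : Finset (Fin n)) :
    Integrable (fun y : Fin n → X => f #A (y ∘ A.orderEmbOfFin rfl) *
      g #Aᶜ (y ∘ Aᶜ.orderEmbOfFin rfl)) (absPi μ n) :=
  ((measurePreserving_restrict_compl μ.variation rfl rfl).integrable_comp_emb
    (measurableEmbedding_restrict_compl rfl rfl)).2 ((hf #A).mul_prod (hg #Aᶜ))

lemma IsPhase.integral_restrict_mul_compl {h : X → ℂ} (hμ : IsPhase μ h)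
    (hf : ∀ n, Integrable (f n) (absPi μ n)) (hg : ∀ n, Integrable (g n) (absPi μ n)) {n : ℕ}
    (A : Finset (Fin n)) :
    ∫ y, f #A (y ∘ A.orderEmbOfFin rfl) * g #Aᶜ (y ∘ Aᶜ.orderEmbOfFin rfl) *
        ∏ i, h (y i) ∂absPi μ n =
      iterInt μ #A (f #A) * iterInt μ #Aᶜ (g #Aᶜ) := by
  rw [hμ.iterInt_eq _ (hf _), hμ.iterInt_eq _ (hg _), ← integral_prod_mul]
  refine Eq.trans ?_ ((measurePreserving_restrict_compl μ.variation (A := A) rfl rfl).integral_comp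
    (measurableEmbedding_restrict_compl rfl rfl) _)
  refine integral_congr_ae (Filter.Eventually.of_forall fun y => ?_)
  simp only [prod_eq_prod_restrict_mul_prod_compl A fun i => h (y i), Function.comp_apply]
  ring

lemma one_div_factorial_mul_choose {K : Type*} [Field K] [CharZero K] {m n : ℕ} (hmn : m ≤ n) :
    1 / (n.factorial : K) * n.choose m = 1 / m.factorial * (1 / (n - m).factorial) := by
  have hchoose : (n.choose m : K) * m.factorial * (n - m).factorial = n.factorial := by
    exact_mod_cast Nat.choose_mul_factorial_mul_factorial hmn
  have hn : (n.factorial : K) ≠ 0 := by exact_mod_cast n.factorial_ne_zero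
  have hm : (m.factorial : K) ≠ 0 := by exact_mod_cast m.factorial_ne_zero
  have hnm : ((n - m).factorial : K) ≠ 0 := by exact_mod_cast (n - m).factorial_ne_zero
  field_simp
  linear_combination hchoose

lemma iterInt_sum_restrict_mul_compl (hf : ∀ n, Integrable (f n) (absPi μ n))
    (hg : ∀ n, Integrable (g n) (absPi μ n)) (n : ℕ) :
    (1 / (n.factorial : ℂ)) * iterInt μ n (fun y => ∑ A ∈ univ.powerset,
        f #A (y ∘ A.orderEmbOfFin rfl) * g #Aᶜ (y ∘ Aᶜ.orderEmbOfFin rfl)) =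
      ∑ p ∈ antidiagonal n, ((1 / (p.1.factorial : ℂ)) * iterInt μ p.1 (f p.1)) *
        ((1 / (p.2.factorial : ℂ)) * iterInt μ p.2 (g p.2)) := by
  obtain ⟨h, hμ⟩ := exists_isPhase μ
  have hcard : ∀ A : Finset (Fin n), iterInt μ #A (f #A) * iterInt μ #Aᶜ (g #Aᶜ) =
      iterInt μ #A (f #A) * iterInt μ (n - #A) (g (n - #A)) := fun A => by
    rw [show #Aᶜ = n - #A by rw [card_compl, Fintype.card_fin]]
  have hint : ∀ A : Finset (Fin n), Integrable (fun y => f #A (y ∘ A.orderEmbOfFin rfl) *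
      g #Aᶜ (y ∘ Aᶜ.orderEmbOfFin rfl) * ∏ i, h (y i)) (absPi μ n) := fun A =>
    hμ.integrable_mul_prod measurable_id (integrable_restrict_mul_compl hf hg A)
  rw [hμ.iterInt_eq _ (integrable_finsetSum _ fun A _ => integrable_restrict_mul_compl hf hg A)]
  simp_rw [sum_mul]
  rw [integral_finsetSum _ fun A _ => hint A,
    sum_congr rfl fun A _ => (hμ.integral_restrict_mul_compl hf hg A).trans (hcard A),
    sum_powerset_apply_card fun m => iterInt μ m (f m) * iterInt μ (n - m) (g (n - m)),
    Nat.sum_antidiagonal_eq_sum_range_succ_mk, mul_sum, card_univ, Fintype.card_fin]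
  refine sum_congr rfl fun m hm => ?_
  rw [nsmul_eq_mul, ← mul_assoc,
    one_div_factorial_mul_choose (Nat.lt_succ_iff.1 (mem_range.1 hm))]
  ring

end Convolution

section FinEmbeddings

variable {j n : ℕ}

/-- The order embedding that fixes `0` and is the shift of `e` on the successors. -/
def consEmb (e : Fin j ↪o Fin n) : Fin (j + 1) ↪o Fin (n + 1) :=
  OrderEmbedding.ofStrictMono (Fin.cons 0 fun k => (e k).succ) <| Fin.strictMono_iff_lt_succ.2 <| by
    intro k
    cases j with
    | zero => exact k.elim0
    | succ j =>
      induction k using Fin.cases with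
      | zero => simp
      | succ k => simp

@[simp] lemma consEmb_zero (e : Fin j ↪o Fin n) : consEmb e 0 = 0 := rfl

@[simp] lemma consEmb_succ (e : Fin j ↪o Fin n) (k : Fin j) : consEmb e k.succ = (e k).succ := rfl

lemma univ_map_consEmb (e : Fin j ↪o Fin n) :
    univ.map (consEmb e).toEmbedding =
      insert 0 ((univ.map e.toEmbedding).map (Fin.succOrderEmb n).toEmbedding) := by
  ext v
  refine Fin.cases ?_ (fun k => ?_) v
  · simpa using ⟨0, rfl⟩
  · simp [Fin.exists_fin_succ, Fin.succ_ne_zero, (Fin.succ_ne_zero _).symm]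

lemma univ_map_trans_succOrderEmb (e : Fin j ↪o Fin n) :
    univ.map (e.trans (Fin.succOrderEmb n)).toEmbedding =
      (univ.map e.toEmbedding).map (Fin.succOrderEmb n).toEmbedding :=
  (map_map _ _ _).symm

lemma vecCons_comp_consEmb {X : Type*} (e : Fin j ↪o Fin n) (x : X) (y : Fin n → X) :
    (Matrix.vecCons x y : Fin (n + 1) → X) ∘ consEmb e = Matrix.vecCons x (y ∘ e) := by
  funext i
  refine Fin.cases ?_ (fun k => ?_) i <;> simp

lemma vecCons_comp_trans_succOrderEmb {X : Type*} (e : Fin j ↪o Fin n) (x : X) (y : Fin n → X) :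
    (Matrix.vecCons x y : Fin (n + 1) → X) ∘ e.trans (Fin.succOrderEmb n) = y ∘ e := rfl

lemma compl_map_succOrderEmb (B : Finset (Fin n)) :
    (B.map (Fin.succOrderEmb n).toEmbedding)ᶜ =
      insert 0 (Bᶜ.map (Fin.succOrderEmb n).toEmbedding) := by
  ext v
  refine Fin.cases ?_ (fun k => ?_) v <;> simp

lemma compl_insert_zero_map_succOrderEmb (B : Finset (Fin n)) :
    (insert 0 (B.map (Fin.succOrderEmb n).toEmbedding))ᶜ =
      Bᶜ.map (Fin.succOrderEmb n).toEmbedding := by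
  ext v
  refine Fin.cases ?_ (fun k => ?_) v <;> simp

variable {M : Type*} [AddCommMonoid M]

lemma sum_powerset_univ_filter_zero_mem (F : Finset (Fin (n + 1)) → M) :
    ∑ A ∈ univ.powerset with 0 ∈ A, F A =
      ∑ B ∈ univ.powerset, F (insert 0 (B.map (Fin.succOrderEmb n).toEmbedding)) := by
  have herase : univ.erase (0 : Fin (n + 1)) = univ.map (Fin.succOrderEmb n).toEmbedding := by
    ext v
    refine Fin.cases ?_ (fun k => ?_) v <;> simp
  rw [sum_powerset_filter_mem (mem_univ _), herase, sum_powerset_map]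

lemma sum_powerset_univ_succ (F : Finset (Fin (n + 1)) → M) :
    ∑ A ∈ univ.powerset, F A = ∑ B ∈ univ.powerset, F (B.map (Fin.succOrderEmb n).toEmbedding) +
      ∑ B ∈ univ.powerset, F (insert 0 (B.map (Fin.succOrderEmb n).toEmbedding)) := by
  have hinsert : (univ : Finset (Fin (n + 1))) =
      insert 0 (univ.map (Fin.succOrderEmb n).toEmbedding) := by
    ext v
    refine Fin.cases ?_ (fun k => ?_) v <;> simp
  conv_lhs => rw [hinsert]
  rw [sum_powerset_insert (by simp), sum_powerset_map, sum_powerset_map]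

end FinEmbeddings

section ConnectedGraphs

variable {V : Type*} [Fintype V]

lemma connects_univ_iff [Nonempty V] {E : Finset (V × V)} :
    Connects E univ ↔ (edgeGraph E).Connected := by
  simp [Connects, SimpleGraph.connected_iff, SimpleGraph.Preconnected, ‹Nonempty V›]

variable [LinearOrder V]

open Classical in
/-- The edges of `G`, each listed as a pair `i < j`. -/
def orderedEdges (G : SimpleGraph V) : Finset (V × V) := {p | p.1 < p.2 ∧ G.Adj p.1 p.2}

lemma mem_orderedEdges {G : SimpleGraph V} {p : V × V} :
    p ∈ orderedEdges G ↔ p.1 < p.2 ∧ G.Adj p.1 p.2 := by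
  simp [orderedEdges]

lemma orderedEdges_subset_pairs (G : SimpleGraph V) : orderedEdges G ⊆ pairs univ :=
  fun _ hp => mem_pairs.2 ⟨mem_univ _, mem_univ _, (mem_orderedEdges.1 hp).1⟩

lemma edgeGraph_orderedEdges (G : SimpleGraph V) : edgeGraph (orderedEdges G) = G := by
  ext i j
  simp only [edgeGraph, SimpleGraph.fromRel_adj, mem_orderedEdges]
  constructor
  · rintro ⟨_, h | h⟩
    · exact h.2
    · exact h.2.symm
  · intro h
    exact ⟨h.ne, (lt_or_gt_of_ne h.ne).imp (⟨·, h⟩) (⟨·, h.symm⟩)⟩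

lemma orderedEdges_edgeGraph {E : Finset (V × V)} (hE : E ⊆ pairs univ) :
    orderedEdges (edgeGraph E) = E := by
  ext ⟨i, j⟩
  simp only [mem_orderedEdges, edgeGraph, SimpleGraph.fromRel_adj]
  constructor
  · rintro ⟨hij, _, h | h⟩
    · exact h
    · exact absurd (mem_pairs.1 (hE h)).2.2 hij.asymm
  · intro h
    have hij := (mem_pairs.1 (hE h)).2.2
    exact ⟨hij, hij.ne, Or.inl h⟩

open Classical in
lemma mayerSum_univ [Nonempty V] {S : Type*} [CommSemiring S] (ζ : V → V → S) :
    mayerSum ζ univ =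
      ∑ G : SimpleGraph V with G.Connected, ∏ p ∈ orderedEdges G, ζ p.1 p.2 := by
  symm
  refine sum_nbij' orderedEdges edgeGraph (fun G hG => ?_) (fun E hE => ?_)
    (fun G _ => edgeGraph_orderedEdges G) (fun E hE => ?_) fun _ _ => rfl
  · rw [mem_filter, mem_powerset, connects_univ_iff, edgeGraph_orderedEdges]
    exact ⟨orderedEdges_subset_pairs G, (mem_filter.1 hG).2⟩
  · exact mem_filter.2 ⟨mem_univ _, connects_univ_iff.1 (mem_filter.1 hE).2⟩
  · exact orderedEdges_edgeGraph (mem_powerset.1 (mem_filter.1 hE).1)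

end ConnectedGraphs

section Ursell

variable {X : Type*} [MeasurableSpace X]

namespace PairInteraction

lemma zeta_symm (u : PairInteraction X) (x y : X) : u.zeta x y = u.zeta y x := by
  simp only [zeta, val, u.re_symm x y, u.im_symm x y]

/-- The Ursell function `n! φ(x₁, …, xₙ)`: the sum over the connected graphs on the points. -/
def ursellSum (u : PairInteraction X) {n : ℕ} (x : Fin n → X) : ℂ :=
  mayerSum (fun i j => u.zeta (x i) (x j)) univ

lemma weight_eq_boltzmannProd (u : PairInteraction X) {n : ℕ} (x : Fin n → X) :
    u.weight x = boltzmannProd (fun i j => u.zeta (x i) (x j)) univ := by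
  simp only [weight, boltzmannProd, pairs, univ_product_univ]

lemma phi_eq (u : PairInteraction X) {n : ℕ} (x : Fin (n + 1) → X) :
    u.phi x = (1 / ((n + 1).factorial : ℂ)) * u.ursellSum x := by
  rw [ursellSum, mayerSum_univ]
  rfl

lemma mayerSum_eq_ursellSum (u : PairInteraction X) {j n : ℕ} (e : Fin (j + 1) ↪o Fin n)
    {x : Fin n → X} {A : Finset (Fin n)} {y : Fin (j + 1) → X}
    (hA : univ.map e.toEmbedding = A) (hy : x ∘ e = y) :
    mayerSum (fun i j => u.zeta (x i) (x j)) A = u.ursellSum y := by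
  subst hA hy
  exact mayerSum_map e _ univ_nonempty

lemma boltzmannProd_eq_weight (u : PairInteraction X) {j n : ℕ} (e : Fin j ↪o Fin n)
    {x : Fin n → X} {A : Finset (Fin n)} {y : Fin j → X}
    (hA : univ.map e.toEmbedding = A) (hy : x ∘ e = y) :
    boltzmannProd (fun i j => u.zeta (x i) (x j)) A = u.weight y := by
  subst hA hy
  rw [boltzmannProd_map, weight_eq_boltzmannProd]
  rfl

lemma weight_eq_sum_mayerSum (u : PairInteraction X) {n : ℕ} (x : Fin (n + 1) → X) :
    u.weight x = ∑ B ∈ univ.powerset,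
      mayerSum (fun i j => u.zeta (x i) (x j))
          (insert 0 (B.map (Fin.succOrderEmb n).toEmbedding)) *
        boltzmannProd (fun i j => u.zeta (x i) (x j))
          (Bᶜ.map (Fin.succOrderEmb n).toEmbedding) := by
  rw [weight_eq_boltzmannProd, boltzmannProd_eq_sum_mayerSum _ (mem_univ 0),
    sum_powerset_univ_filter_zero_mem]
  simp only [← compl_eq_univ_sdiff, compl_insert_zero_map_succOrderEmb]

-- The sum is over the points other than `x₀` in the cluster of `x₀`.
lemma weight_vecCons (u : PairInteraction X) {n : ℕ} (x₀ : X) (y : Fin n → X) :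
    u.weight (Matrix.vecCons x₀ y) = ∑ B ∈ univ.powerset,
      u.ursellSum (Matrix.vecCons x₀ (y ∘ B.orderEmbOfFin rfl)) *
        u.weight (y ∘ Bᶜ.orderEmbOfFin rfl) := by
  rw [weight_eq_sum_mayerSum]
  refine sum_congr rfl fun B _ => congrArg₂ _ ?_ ?_
  · exact u.mayerSum_eq_ursellSum (consEmb (B.orderEmbOfFin rfl))
      (by rw [univ_map_consEmb, map_orderEmbOfFin_univ]) (vecCons_comp_consEmb _ _ _)
  · exact u.boltzmannProd_eq_weight ((Bᶜ.orderEmbOfFin rfl).trans (Fin.succOrderEmb n))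
      (by rw [univ_map_trans_succOrderEmb, map_orderEmbOfFin_univ]) rfl

-- The cluster of `x₁` avoids `x₂` in the first sum and contains it in the second.
lemma weight_vecCons_vecCons (u : PairInteraction X) {n : ℕ} (x₁ x₂ : X) (y : Fin n → X) :
    u.weight (Matrix.vecCons x₁ (Matrix.vecCons x₂ y)) =
      ∑ B ∈ univ.powerset, u.ursellSum (Matrix.vecCons x₁ (y ∘ B.orderEmbOfFin rfl)) *
        u.weight (Matrix.vecCons x₂ (y ∘ Bᶜ.orderEmbOfFin rfl)) +
      ∑ B ∈ univ.powerset,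
        u.ursellSum (Matrix.vecCons x₁ (Matrix.vecCons x₂ (y ∘ B.orderEmbOfFin rfl))) *
          u.weight (y ∘ Bᶜ.orderEmbOfFin rfl) := by
  rw [weight_eq_sum_mayerSum, sum_powerset_univ_succ]
  congr 1 <;> refine sum_congr rfl fun B _ => congrArg₂ _ ?_ ?_
  · exact u.mayerSum_eq_ursellSum (consEmb ((B.orderEmbOfFin rfl).trans (Fin.succOrderEmb n)))
      (by rw [univ_map_consEmb, univ_map_trans_succOrderEmb, map_orderEmbOfFin_univ])
      (by rw [vecCons_comp_consEmb, vecCons_comp_trans_succOrderEmb])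
  · exact u.boltzmannProd_eq_weight ((consEmb (Bᶜ.orderEmbOfFin rfl)).trans (Fin.succOrderEmb _))
      (by rw [univ_map_trans_succOrderEmb, univ_map_consEmb, map_orderEmbOfFin_univ,
        compl_map_succOrderEmb])
      (by rw [vecCons_comp_trans_succOrderEmb, vecCons_comp_consEmb])
  · exact u.mayerSum_eq_ursellSum (consEmb (consEmb (B.orderEmbOfFin rfl)))
      (by rw [univ_map_consEmb, univ_map_consEmb, map_orderEmbOfFin_univ])
      (by rw [vecCons_comp_consEmb, vecCons_comp_consEmb])
  · exact u.boltzmannProd_eq_weight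
      (((Bᶜ.orderEmbOfFin rfl).trans (Fin.succOrderEmb n)).trans (Fin.succOrderEmb _))
      (by rw [univ_map_trans_succOrderEmb, univ_map_trans_succOrderEmb, map_orderEmbOfFin_univ,
        compl_insert_zero_map_succOrderEmb])
      (by rw [vecCons_comp_trans_succOrderEmb, vecCons_comp_trans_succOrderEmb])

end PairInteraction

end Ursell

section AbsoluteConvergence

section Gronwall

variable {a c : ℕ → ℝ}

lemma sum_range_succ_mul_pow_le (ha : ∀ n, 0 ≤ a n) (hc : ∀ n, 0 ≤ c n) (hcs : Summable c)
    (hac : ∀ n, (n + 1) * a (n + 1) ≤ ∑ p ∈ antidiagonal n, c p.1 * a p.2) (N : ℕ) {t : ℝ}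
    (ht₀ : 0 ≤ t) (ht₁ : t ≤ 1) :
    ∑ n ∈ range N, (n + 1) * a (n + 1) * t ^ n ≤ (∑' n, c n) * ∑ n ∈ range N, a n * t ^ n := by
  have hcN : ∀ M, ∑ m ∈ range M, c m * t ^ m ≤ ∑' n, c n := fun M =>
    (sum_le_sum fun m _ => mul_le_of_le_one_right (hc m) (pow_le_one₀ ht₀ ht₁)).trans
      (hcs.sum_le_tsum _ fun m _ => hc m)
  calc ∑ n ∈ range N, (n + 1) * a (n + 1) * t ^ n
      ≤ ∑ n ∈ range N, ∑ k ∈ range (n + 1), a k * t ^ k * (c (n - k) * t ^ (n - k)) := by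
        refine sum_le_sum fun n _ => (mul_le_mul_of_nonneg_right (hac n) (pow_nonneg ht₀ n)).trans
          (le_of_eq ?_)
        rw [← Nat.sum_antidiagonal_eq_sum_range_succ fun k m => a k * t ^ k * (c m * t ^ m),
          ← Nat.sum_antidiagonal_swap, sum_mul]
        refine sum_congr rfl fun p hp => ?_
        rw [← mem_antidiagonal.1 hp, Prod.fst_swap, Prod.snd_swap, pow_add]
        ring
    _ = ∑ k ∈ range N, ∑ m ∈ range (N - k), a k * t ^ k * (c m * t ^ m) :=
        sum_range_diag_flip N fun k m => a k * t ^ k * (c m * t ^ m)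
    _ ≤ (∑' n, c n) * ∑ n ∈ range N, a n * t ^ n := by
        rw [mul_sum]
        refine sum_le_sum fun k _ => ?_
        rw [← mul_sum, mul_comm]
        exact mul_le_mul_of_nonneg_right (hcN _) (mul_nonneg (ha k) (pow_nonneg ht₀ k))

lemma summable_of_succ_mul_le_sum_antidiagonal (ha : ∀ n, 0 ≤ a n) (hc : ∀ n, 0 ≤ c n)
    (hcs : Summable c)
    (hac : ∀ n, (n + 1) * a (n + 1) ≤ ∑ p ∈ antidiagonal n, c p.1 * a p.2) : Summable a := by
  refine summable_of_sum_range_le ha (c := a 0 * Real.exp (∑' n, c n)) fun N => ?_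
  -- Grönwall's inequality for the truncated generating function of `a`.
  set f : ℝ → ℝ := fun t => ∑ n ∈ range (N + 1), a n * t ^ n
  have hf_nonneg : ∀ {t}, 0 ≤ t → 0 ≤ f t := fun ht =>
    sum_nonneg fun n _ => mul_nonneg (ha n) (pow_nonneg ht n)
  have hderiv : ∀ t, HasDerivAt f (∑ n ∈ range N, (n + 1) * a (n + 1) * t ^ n) t := fun t => by
    have h := HasDerivAt.fun_sum (u := range (N + 1)) fun n _ =>
      (hasDerivAt_pow n t).const_mul (a n)
    rw [sum_range_succ'] at h
    refine h.congr_deriv ?_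
    simp only [Nat.cast_zero, zero_mul, mul_zero, add_zero, Nat.cast_add, Nat.cast_one,
      Nat.add_sub_cancel]
    exact sum_congr rfl fun n _ => by ring
  have hbound : ∀ t ∈ Set.Ico (0 : ℝ) 1, ‖∑ n ∈ range N, (n + 1) * a (n + 1) * t ^ n‖ ≤
      (∑' n, c n) * ‖f t‖ + 0 := fun t ht => by
    rw [add_zero, Real.norm_of_nonneg (hf_nonneg ht.1), Real.norm_of_nonneg
      (sum_nonneg fun n _ => mul_nonneg (mul_nonneg n.cast_add_one_pos.le (ha _))
        (pow_nonneg ht.1 n))]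
    refine (sum_range_succ_mul_pow_le ha hc hcs hac N ht.1 ht.2.le).trans
      (mul_le_mul_of_nonneg_left ?_ (tsum_nonneg hc))
    exact sum_le_sum_of_subset_of_nonneg (range_mono N.le_succ)
      fun n _ _ => mul_nonneg (ha n) (pow_nonneg ht.1 n)
  have hgronwall := norm_le_gronwallBound_of_norm_deriv_right_le (δ := a 0)
    (fun t _ => (hderiv t).continuousAt.continuousWithinAt) (fun t _ => (hderiv t).hasDerivWithinAt)
    (by simp [f, sum_range_succ', abs_of_nonneg (ha 0)]) hbound 1 ⟨zero_le_one, le_rfl⟩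
  rw [gronwallBound_ε0, sub_zero, mul_one, Real.norm_of_nonneg (hf_nonneg zero_le_one)] at hgronwall
  refine le_trans ?_ hgronwall
  simp only [f, one_pow, mul_one]
  exact sum_le_sum_of_subset_of_nonneg (range_mono N.le_succ) fun n _ _ => ha n

end Gronwall

open PowerSeries

variable {𝕜 : Type*} [RCLike 𝕜] {φ ψ ε : PowerSeries 𝕜}

/-- The power series converges absolutely at `1`. -/
def SummableCoeffs (φ : PowerSeries 𝕜) : Prop := Summable fun n => ‖coeff n φ‖

/-- The value at `1` of a power series; meaningful when `SummableCoeffs` holds. -/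
def coeffSum (φ : PowerSeries 𝕜) : 𝕜 := ∑' n, coeff n φ

lemma coeffSum_one : coeffSum (1 : PowerSeries 𝕜) = 1 := by
  simp [coeffSum, coeff_one]

namespace SummableCoeffs

lemma summable (hφ : SummableCoeffs φ) : Summable fun n => coeff n φ :=
  Summable.of_norm hφ

lemma neg (hφ : SummableCoeffs φ) : SummableCoeffs (-φ) := by
  simpa [SummableCoeffs] using hφ

lemma sub (hφ : SummableCoeffs φ) (hψ : SummableCoeffs ψ) : SummableCoeffs (φ - ψ) :=
  (Summable.add hφ hψ).of_nonneg_of_le (fun _ => norm_nonneg _)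
    fun n => by rw [map_sub]; exact norm_sub_le _ _

lemma mul (hφ : SummableCoeffs φ) (hψ : SummableCoeffs ψ) : SummableCoeffs (φ * ψ) := by
  simpa only [SummableCoeffs, coeff_mul] using
    summable_norm_sum_mul_antidiagonal_of_summable_norm hφ hψ

lemma coeffSum_mul (hφ : SummableCoeffs φ) (hψ : SummableCoeffs ψ) :
    coeffSum (φ * ψ) = coeffSum φ * coeffSum ψ := by
  simp only [coeffSum, coeff_mul, tsum_mul_tsum_eq_tsum_sum_antidiagonal_of_summable_norm hφ hψ]

lemma coeffSum_add (hφ : SummableCoeffs φ) (hψ : SummableCoeffs ψ) :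
    coeffSum (φ + ψ) = coeffSum φ + coeffSum ψ := by
  simp only [coeffSum, map_add, hφ.summable.tsum_add hψ.summable]

lemma of_derivative_eq_mul (hε : SummableCoeffs ε) (h : d⁄dX 𝕜 φ = ε * φ) : SummableCoeffs φ := by
  refine summable_of_succ_mul_le_sum_antidiagonal (fun _ => norm_nonneg _) (fun _ => norm_nonneg _)
    hε fun n => ?_
  have hn := congrArg (fun ψ => ‖coeff n ψ‖) h
  simp only [coeff_derivative, coeff_mul, norm_mul] at hn
  rw [show ‖(n : 𝕜) + 1‖ = n + 1 by exact_mod_cast RCLike.norm_natCast (K := 𝕜) (n + 1),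
    mul_comm] at hn
  rw [hn]
  exact (norm_sum_le _ _).trans_eq (sum_congr rfl fun p _ => norm_mul _ _)

-- The inverse solves the linear equation with the opposite coefficient.
lemma inv_of_derivative_eq_mul (hε : SummableCoeffs ε) (h : d⁄dX 𝕜 φ = ε * φ)
    (hφ₀ : constantCoeff φ ≠ 0) : SummableCoeffs φ⁻¹ := by
  refine of_derivative_eq_mul hε.neg ?_
  rw [derivative_inv', h]
  linear_combination -ε * φ⁻¹ * PowerSeries.mul_inv_cancel φ hφ₀

end SummableCoeffs

lemma coeffSum_ne_zero (hφ : SummableCoeffs φ) (hφ' : SummableCoeffs φ⁻¹)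
    (hφ₀ : constantCoeff φ ≠ 0) : coeffSum φ ≠ 0 := by
  refine left_ne_zero_of_mul_eq_one (b := coeffSum φ⁻¹) ?_
  rw [← hφ.coeffSum_mul hφ', PowerSeries.mul_inv_cancel φ hφ₀, coeffSum_one]

end AbsoluteConvergence

section Slices

variable {X : Type*} [MeasurableSpace X]

lemma measurePreserving_vecCons_vecCons (ν : Measure X) [SigmaFinite ν] (n : ℕ) :
    MeasurePreserving (fun q : (X × X) × (Fin n → X) =>
        (Matrix.vecCons q.1.1 (Matrix.vecCons q.1.2 q.2) : Fin (n + 2) → X))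
      ((ν.prod ν).prod (Measure.pi fun _ => ν)) (Measure.pi fun _ => ν) :=
  ((measurePreserving_vecCons ν (n + 1)).comp
    ((MeasurePreserving.id ν).prod (measurePreserving_vecCons ν n))).comp
    (measurePreserving_prodAssoc ν ν (Measure.pi fun _ => ν))

variable {μ : ComplexMeasure X} [IsFiniteMeasure μ.variation] {n : ℕ}

lemma ae_vecCons {P : (Fin (n + 1) → X) → Prop} (h : ∀ᵐ x ∂absPi μ (n + 1), P x) :
    ∀ᵐ x₁ ∂μ.variation, ∀ᵐ y ∂absPi μ n, P (Matrix.vecCons x₁ y) :=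
  Measure.ae_ae_of_ae_prod
    ((measurePreserving_vecCons μ.variation n).quasiMeasurePreserving.ae h)

lemma ae_vecCons_vecCons {P : (Fin (n + 2) → X) → Prop} (h : ∀ᵐ x ∂absPi μ (n + 2), P x) :
    ∀ᵐ p ∂μ.variation.prod μ.variation, ∀ᵐ y ∂absPi μ n,
      P (Matrix.vecCons p.1 (Matrix.vecCons p.2 y)) :=
  Measure.ae_ae_of_ae_prod
    ((measurePreserving_vecCons_vecCons μ.variation n).quasiMeasurePreserving.ae h)

lemma ae_integrable_vecCons {F : (Fin (n + 1) → X) → ℂ} (hF : Integrable F (absPi μ (n + 1))) :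
    ∀ᵐ x₁ ∂μ.variation, Integrable (fun y => F (Matrix.vecCons x₁ y)) (absPi μ n) :=
  ((measurePreserving_vecCons μ.variation n).integrable_comp_of_integrable hF).prod_right_ae

lemma ae_integrable_vecCons_vecCons {F : (Fin (n + 2) → X) → ℂ}
    (hF : Integrable F (absPi μ (n + 2))) :
    ∀ᵐ p ∂μ.variation.prod μ.variation,
      Integrable (fun y => F (Matrix.vecCons p.1 (Matrix.vecCons p.2 y))) (absPi μ n) :=
  ((measurePreserving_vecCons_vecCons μ.variation n).integrable_comp_of_integrable hF).prod_right_ae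

lemma integrable_iterInt_vecCons {F : (Fin (n + 1) → X) → ℂ}
    (hF : Integrable F (absPi μ (n + 1))) :
    Integrable (fun x => iterInt μ n fun y => F (Matrix.vecCons x y)) μ.variation := by
  obtain ⟨h, hμ⟩ := exists_isPhase μ
  have hFcons := (measurePreserving_vecCons μ.variation n).integrable_comp_of_integrable hF
  refine (hμ.integrable_mul_prod measurable_snd hFcons).integral_prod_left.congr ?_
  filter_upwards [ae_integrable_vecCons hF] with x hx
  exact (hμ.iterInt_eq n hx).symm

lemma enorm_iterInt_le {F : (Fin n → X) → ℂ} (hF : Integrable F (absPi μ n)) :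
    ‖iterInt μ n F‖ₑ ≤ ∫⁻ y, ‖F y‖ₑ ∂absPi μ n := by
  obtain ⟨h, hμ⟩ := exists_isPhase μ
  rw [hμ.iterInt_eq n hF]
  refine (enorm_integral_le_lintegral_enorm _).trans_eq (lintegral_congr fun y => ?_)
  rw [← ofReal_norm, ← ofReal_norm, norm_mul, norm_prod]
  simp [hμ.norm_eq_one]

lemma norm_iterInt_le {F : (Fin n → X) → ℂ} (hF : Integrable F (absPi μ n)) :
    ‖iterInt μ n F‖ ≤ ∫ y, ‖F y‖ ∂absPi μ n := by
  rw [integral_norm_eq_lintegral_enorm hF.1, ← toReal_enorm]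
  exact ENNReal.toReal_mono hF.2.ne (enorm_iterInt_le hF)

lemma iterInt_const_mul (c : ℂ) {F : (Fin n → X) → ℂ} (hF : Integrable F (absPi μ n)) :
    iterInt μ n (fun y => c * F y) = c * iterInt μ n F := by
  obtain ⟨h, hμ⟩ := exists_isPhase μ
  rw [hμ.iterInt_eq n hF, hμ.iterInt_eq n (hF.const_mul c), ← integral_const_mul]
  simp_rw [mul_assoc]

lemma iterInt_add {F G : (Fin n → X) → ℂ} (hF : Integrable F (absPi μ n))
    (hG : Integrable G (absPi μ n)) :
    iterInt μ n (fun y => F y + G y) = iterInt μ n F + iterInt μ n G := by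
  obtain ⟨h, hμ⟩ := exists_isPhase μ
  rw [hμ.iterInt_eq n hF, hμ.iterInt_eq n hG, hμ.iterInt_eq n (hF.fun_add hG)]
  simp_rw [add_mul]
  exact integral_add (hμ.integrable_mul_prod measurable_id hF)
    (hμ.integrable_mul_prod measurable_id hG)

end Slices

section ActivitySeries

open PowerSeries

variable {X : Type*} [MeasurableSpace X]

/-- The power series `∑ₙ zⁿ/n! ∫ dμ(y₁) ⋯ ∫ dμ(yₙ) f(y₁, …, yₙ)` in the activity `z`; the series of
the theorem are its values at `z = 1`. -/
def activitySeries (μ : ComplexMeasure X) (f : ∀ n, (Fin n → X) → ℂ) : PowerSeries ℂ :=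
  mk fun n => (1 / (n.factorial : ℂ)) * iterInt μ n (f n)

/-- The power series `∑ₙ zⁿ/n! ∫ dμ(x) ∫ dμ(y₁) ⋯ ∫ dμ(yₙ) f(x, y₁, …, yₙ)`, that is, the integral
over `x` of activity series rooted at `x`. -/
def rootedSeries (μ : ComplexMeasure X) (f : ∀ n, (Fin (n + 1) → X) → ℂ) : PowerSeries ℂ :=
  mk fun n => (1 / (n.factorial : ℂ)) * iterInt μ (n + 1) (f n)

lemma derivative_activitySeries (μ : ComplexMeasure X) (f : ∀ n, (Fin n → X) → ℂ) :
    d⁄dX ℂ (activitySeries μ f) = rootedSeries μ fun n => f (n + 1) := by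
  ext n
  have hn : (n.factorial : ℂ) ≠ 0 := by exact_mod_cast n.factorial_ne_zero
  have hn1 : (n : ℂ) + 1 ≠ 0 := by exact_mod_cast n.succ_ne_zero
  rw [coeff_derivative, activitySeries, rootedSeries, coeff_mk, coeff_mk, Nat.factorial_succ]
  push_cast
  field_simp

variable {μ : ComplexMeasure X} [IsFiniteMeasure μ.variation]

lemma activitySeries_add {f g : ∀ n, (Fin n → X) → ℂ} (hf : ∀ n, Integrable (f n) (absPi μ n))
    (hg : ∀ n, Integrable (g n) (absPi μ n)) :
    activitySeries μ (fun n y => f n y + g n y) = activitySeries μ f + activitySeries μ g := by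
  ext n
  simp only [activitySeries, map_add, coeff_mk, iterInt_add (hf n) (hg n), mul_add]

lemma activitySeries_sum_restrict_mul_compl {f g : ∀ n, (Fin n → X) → ℂ}
    (hf : ∀ n, Integrable (f n) (absPi μ n)) (hg : ∀ n, Integrable (g n) (absPi μ n)) :
    activitySeries μ (fun n y => ∑ A ∈ univ.powerset,
        f #A (y ∘ A.orderEmbOfFin rfl) * g #Aᶜ (y ∘ Aᶜ.orderEmbOfFin rfl)) =
      activitySeries μ f * activitySeries μ g := by
  ext n
  simp only [activitySeries, coeff_mul, coeff_mk, iterInt_sum_restrict_mul_compl hf hg]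

section Rooted

variable {f g : ∀ n, (Fin (n + 1) → X) → ℂ}

lemma integrable_coeff_activitySeries_vecCons {n : ℕ} (hf : Integrable (f n) (absPi μ (n + 1))) :
    Integrable (fun x => coeff n (activitySeries μ fun n y => f n (Matrix.vecCons x y)))
      μ.variation := by
  simpa only [activitySeries, coeff_mk] using (integrable_iterInt_vecCons hf).const_mul _

lemma IsPhase.coeff_rootedSeries_eq {h : X → ℂ} (hμ : IsPhase μ h) {n : ℕ}
    (hf : Integrable (f n) (absPi μ (n + 1))) :
    coeff n (rootedSeries μ f) =
      ∫ x, coeff n (activitySeries μ fun n y => f n (Matrix.vecCons x y)) * h x ∂μ.variation := by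
  simp only [rootedSeries, activitySeries, coeff_mk, mul_assoc]
  rw [iterInt, hμ.vectorMeasure_integral_eq (integrable_iterInt_vecCons hf), integral_const_mul]

lemma rootedSeries_eq_mul_of_ae {ψ : PowerSeries ℂ} (hf : ∀ n, Integrable (f n) (absPi μ (n + 1)))
    (hg : ∀ n, Integrable (g n) (absPi μ (n + 1)))
    (hfg : ∀ᵐ x ∂μ.variation, activitySeries μ (fun n y => f n (Matrix.vecCons x y)) =
      activitySeries μ (fun n y => g n (Matrix.vecCons x y)) * ψ) :
    rootedSeries μ f = rootedSeries μ g * ψ := by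
  obtain ⟨h, hμ⟩ := exists_isPhase μ
  ext n
  rw [hμ.coeff_rootedSeries_eq (hf n), integral_congr_ae (hfg.mono fun x hx =>
    congrArg (fun φ => coeff n φ * h x) hx)]
  simp only [coeff_mul, sum_mul, hμ.coeff_rootedSeries_eq (hg _), mul_right_comm]
  rw [integral_finsetSum _ fun p _ =>
    (hμ.integrable_mul (integrable_coeff_activitySeries_vecCons (hg p.1))).mul_const _]
  exact sum_congr rfl fun p _ => integral_mul_const _ _

end Rooted

section DominatedByPower

variable {g : X → ℝ} {C : ℝ}

lemma integrable_of_ae_norm_le_prod (hg : Integrable g μ.variation) {n : ℕ} {F : (Fin n → X) → ℂ}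
    (hF : AEStronglyMeasurable F (absPi μ n))
    (hFg : ∀ᵐ y ∂absPi μ n, ‖F y‖ ≤ C * ∏ i, g (y i)) : Integrable F (absPi μ n) :=
  ((Integrable.fintype_prod fun _ => hg).const_mul C).mono' hF hFg

lemma summableCoeffs_activitySeries (hg : Integrable g μ.variation) {f : ∀ n, (Fin n → X) → ℂ}
    (hf : ∀ n, AEStronglyMeasurable (f n) (absPi μ n))
    (hfg : ∀ n, ∀ᵐ y ∂absPi μ n, ‖f n y‖ ≤ C * ∏ i, g (y i)) :
    SummableCoeffs (activitySeries μ f) := by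
  refine Summable.of_nonneg_of_le (fun _ => norm_nonneg _) (fun n => ?_)
    ((Real.summable_pow_div_factorial (∫ x, g x ∂μ.variation)).mul_left C)
  have hfn := integrable_of_ae_norm_le_prod hg (hf n) (hfg n)
  have hle : ‖iterInt μ n (f n)‖ ≤ C * (∫ x, g x ∂μ.variation) ^ n := by
    refine (norm_iterInt_le hfn).trans ((integral_mono_ae hfn.norm
      ((Integrable.fintype_prod fun _ => hg).const_mul C) (hfg n)).trans_eq ?_)
    rw [integral_const_mul, absPi, integral_fintype_prod_eq_pow g, Fintype.card_fin]
  rw [activitySeries, coeff_mk, norm_mul, norm_div, norm_one, Complex.norm_natCast, one_div,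
    inv_mul_eq_div, ← mul_div_assoc]
  gcongr

end DominatedByPower

end ActivitySeries

section CauchyProducts

open PowerSeries

variable {X : Type*} [MeasurableSpace X] {μ : ComplexMeasure X} [IsFiniteMeasure μ.variation]
  {u : PairInteraction X} {x₁ x₂ : X}

lemma mk_clusterTerm₁
    (h : ∀ n, Integrable (fun y : Fin n → X => u.ursellSum (Matrix.vecCons x₁ y)) (absPi μ n)) :
    mk (clusterTerm₁ μ u x₁) = activitySeries μ fun _ y => u.ursellSum (Matrix.vecCons x₁ y) := by
  ext n
  have hn : (n.factorial : ℂ) ≠ 0 := by exact_mod_cast n.factorial_ne_zero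
  have hn1 : (n : ℂ) + 1 ≠ 0 := by exact_mod_cast n.succ_ne_zero
  simp_rw [activitySeries, coeff_mk, clusterTerm₁, PairInteraction.phi_eq]
  rw [iterInt_const_mul _ (h n), Nat.factorial_succ]
  push_cast
  field_simp

lemma mk_clusterTerm₂
    (h : ∀ n, Integrable (fun y : Fin n → X =>
      u.ursellSum (Matrix.vecCons x₁ (Matrix.vecCons x₂ y))) (absPi μ n)) :
    mk (clusterTerm₂ μ u x₁ x₂) =
      activitySeries μ fun _ y => u.ursellSum (Matrix.vecCons x₁ (Matrix.vecCons x₂ y)) := by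
  ext n
  have hn : (n.factorial : ℂ) ≠ 0 := by exact_mod_cast n.factorial_ne_zero
  have hn1 : (n : ℂ) + 1 ≠ 0 := by exact_mod_cast n.succ_ne_zero
  have hn2 : (n : ℂ) + 2 ≠ 0 := by exact_mod_cast (n + 1).succ_ne_zero
  simp_rw [activitySeries, coeff_mk, clusterTerm₂, PairInteraction.phi_eq]
  rw [iterInt_const_mul _ (h n), Nat.factorial_succ, Nat.factorial_succ]
  push_cast
  rw [show (n : ℂ) + 1 + 1 = n + 2 by ring]
  field_simp

lemma mk_ZTerm₁_eq
    (hW : ∀ n, Integrable (fun y : Fin n → X => u.weight y) (absPi μ n))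
    (hU : ∀ n, Integrable (fun y : Fin n → X => u.ursellSum (Matrix.vecCons x₁ y)) (absPi μ n)) :
    mk (ZTerm₁ μ u x₁) = mk (clusterTerm₁ μ u x₁) * mk (ZTerm μ u) := by
  rw [mk_clusterTerm₁ hU]
  refine Eq.trans ?_ (activitySeries_sum_restrict_mul_compl hU hW)
  simp_rw [← PairInteraction.weight_vecCons]
  rfl

lemma mk_ZTerm₂_eq
    (hW : ∀ n, Integrable (fun y : Fin n → X => u.weight y) (absPi μ n))
    (hW₂ : ∀ n, Integrable (fun y : Fin n → X => u.weight (Matrix.vecCons x₂ y)) (absPi μ n))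
    (hU₁ : ∀ n, Integrable (fun y : Fin n → X => u.ursellSum (Matrix.vecCons x₁ y)) (absPi μ n))
    (hU₁₂ : ∀ n, Integrable (fun y : Fin n → X =>
      u.ursellSum (Matrix.vecCons x₁ (Matrix.vecCons x₂ y))) (absPi μ n)) :
    mk (ZTerm₂ μ u x₁ x₂) = mk (clusterTerm₁ μ u x₁) * mk (ZTerm₁ μ u x₂) +
      mk (clusterTerm₂ μ u x₁ x₂) * mk (ZTerm μ u) := by
  rw [mk_clusterTerm₁ hU₁, mk_clusterTerm₂ hU₁₂]
  refine Eq.trans ?_ (congrArg₂ _ (activitySeries_sum_restrict_mul_compl hU₁ hW₂)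
    (activitySeries_sum_restrict_mul_compl hU₁₂ hW))
  rw [← activitySeries_add
    (fun n => integrable_finsetSum _ fun A _ => integrable_restrict_mul_compl hU₁ hW₂ A)
    (fun n => integrable_finsetSum _ fun A _ => integrable_restrict_mul_compl hU₁₂ hW A)]
  simp_rw [← PairInteraction.weight_vecCons_vecCons]
  rfl

lemma derivative_mk_ZTerm
    (hW : ∀ n, Integrable (fun y : Fin n → X => u.weight y) (absPi μ n))
    (hU : ∀ n, Integrable (fun x : Fin (n + 1) → X => u.ursellSum x) (absPi μ (n + 1))) :
    d⁄dX ℂ (mk (ZTerm μ u)) = (rootedSeries μ fun _ => u.ursellSum) * mk (ZTerm μ u) := by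
  refine (derivative_activitySeries μ fun _ => u.weight).trans
    (rootedSeries_eq_mul_of_ae (fun n => hW (n + 1)) hU ?_)
  filter_upwards [ae_all_iff.2 fun n => ae_integrable_vecCons (hU n)] with x hx
  rw [← mk_clusterTerm₁ hx, ← mk_ZTerm₁_eq hW hx]
  rfl

end CauchyProducts

section Measurability

variable {X : Type*} [MeasurableSpace X]

namespace PairInteraction

lemma measurable_val (u : PairInteraction X) : Measurable fun p : X × X => u.val p.1 p.2 := by
  unfold val
  exact (Complex.measurable_ofReal.comp (measurable_ereal_toReal.comp u.measurable_re)).add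
    ((Complex.measurable_ofReal.comp u.measurable_im).mul_const _)

lemma measurableSet_re_eq_top (u : PairInteraction X) :
    MeasurableSet {p : X × X | u.re p.1 p.2 = ⊤} :=
  u.measurable_re (measurableSet_singleton ⊤)

lemma measurable_zeta (u : PairInteraction X) : Measurable fun p : X × X => u.zeta p.1 p.2 := by
  unfold zeta
  exact Measurable.ite u.measurableSet_re_eq_top measurable_const
    ((Complex.measurable_exp.comp u.measurable_val.neg).sub_const 1)

lemma measurable_ubar (u : PairInteraction X) : Measurable fun p : X × X => u.ubar p.1 p.2 := by
  unfold ubar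
  exact Measurable.ite u.measurableSet_re_eq_top measurable_const u.measurable_val

lemma measurable_weight (u : PairInteraction X) (n : ℕ) :
    Measurable fun x : Fin n → X => u.weight x := by
  unfold weight
  exact Finset.measurable_fun_prod _ fun p _ =>
    (measurable_pair u.measurable_zeta p.1 p.2).const_add 1

lemma measurable_ursellSum (u : PairInteraction X) (n : ℕ) :
    Measurable fun x : Fin n → X => u.ursellSum x := by
  unfold ursellSum mayerSum
  exact Finset.measurable_fun_sum _ fun E _ => Finset.measurable_fun_prod _ fun p _ =>
    measurable_pair u.measurable_zeta p.1 p.2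

end PairInteraction

end Measurability

section TreeBounds

variable {X : Type*} [MeasurableSpace X]

namespace PairInteraction

lemma norm_one_add_zeta (u : PairInteraction X) {x y : X} (h : u.re x y ≠ ⊤) :
    ‖1 + u.zeta x y‖ = Real.exp (-(u.val x y).re) := by
  rw [zeta, if_neg h, add_sub_cancel, Complex.norm_exp, Complex.neg_re]

lemma val_symm (u : PairInteraction X) (x y : X) : u.val x y = u.val y x := by
  rw [val, val, u.re_symm, u.im_symm]

open Classical in
lemma norm_ubar (u : PairInteraction X) (x y : X) :
    ‖u.ubar x y‖ = if u.re x y = ⊤ then 1 else ‖u.val x y‖ := by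
  rw [ubar]
  split_ifs <;> simp

variable (u : PairInteraction X) {n : ℕ} {x : Fin (n + 1) → X} {b : X → ℝ}

lemma norm_ursellSum_le_forestSum_zeta
    (hst : ∀ A : Finset (Fin (n + 1)), ∏ p ∈ pairs A, ‖1 + u.zeta (x p.1) (x p.2)‖ ≤
      ∏ i ∈ A, Real.exp (b (x i))) :
    ‖u.ursellSum x‖ ≤ (∏ i, Real.exp (b (x i)) ^ 2) *
      forestSum (fun i j => ‖u.zeta (x i) (x j)‖) {0} (univ.erase 0) :=
  norm_mayerSum_le_forestSum_norm (fun _ _ => u.zeta_symm _ _) hst (mem_univ 0)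

lemma norm_ursellSum_le_forestSum_ubar (hb : ∀ x, 0 ≤ b x)
    (hst : ∀ A : Finset (Fin (n + 1)), ∏ p ∈ pairs A, ‖1 + u.zeta (x p.1) (x p.2)‖ ≤
      ∏ i ∈ A, Real.exp (b (x i))) :
    ‖u.ursellSum x‖ ≤ (∏ i, Real.exp (b (x i))) *
      forestSum (fun i j => ‖u.ubar (x i) (x j)‖) {0} (univ.erase 0) := by
  classical
  have hsum : ∀ A ⊆ univ, (∀ p ∈ pairs A, u.re (x p.1) (x p.2) ≠ ⊤) →
      0 ≤ (∑ p ∈ pairs A, u.val (x p.1) (x p.2)).re + ∑ i ∈ A, b (x i) := fun A _ hA => by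
    have hstA := hst A
    rw [prod_congr rfl fun p hp => u.norm_one_add_zeta (hA p hp), ← Real.exp_sum,
      ← Real.exp_sum, Real.exp_le_exp, sum_neg_distrib] at hstA
    rw [Complex.re_sum]
    linarith
  have hle := norm_mayerSum_le_forestSum_hard (z := fun i j => u.val (x i) (x j))
    (hard := fun i j => u.re (x i) (x j) = ⊤) (fun i j => u.val_symm _ _)
    (fun i j => by rw [u.re_symm]) (fun i => hb (x i)) hsum (mem_univ (0 : Fin (n + 1)))
  simp only [norm_ubar, ursellSum, zeta]
  convert hle

end PairInteraction

lemma enorm_le_prod_mul_forestSum_enorm {E F V : Type*} [NormedAddCommGroup E]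
    [NormedAddCommGroup F] [LinearOrder V] {z : E} {g : V → ℝ} (hg : ∀ i, 0 ≤ g i)
    {κ : V → V → F} {s R Y : Finset V} (hRY : Disjoint R Y)
    (h : ‖z‖ ≤ (∏ i ∈ s, g i) * forestSum (fun i j => ‖κ i j‖) R Y) :
    ‖z‖ₑ ≤ (∏ i ∈ s, ENNReal.ofReal (g i)) * forestSum (fun i j => ‖κ i j‖ₑ) R Y := by
  have hreal : ((forestSum (fun i j => ‖κ i j‖₊) R Y : NNReal) : ℝ) =
      forestSum (fun i j => ‖κ i j‖) R Y := map_forestSum NNReal.toRealHom _ hRY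
  have hennreal : ((forestSum (fun i j => ‖κ i j‖₊) R Y : NNReal) : ℝ≥0∞) =
      forestSum (fun i j => ‖κ i j‖ₑ) R Y := map_forestSum ENNReal.ofNNRealHom _ hRY
  rw [← hreal] at h
  rw [← hennreal, ← ofReal_norm, ← ENNReal.ofReal_prod_of_nonneg fun i _ => hg i,
    ← ENNReal.ofReal_coe_nnreal, ← ENNReal.ofReal_mul (prod_nonneg fun i _ => hg i)]
  exact ENNReal.ofReal_le_ofReal h

/-- The Ursell functions of `u` are dominated by sums over trees with edge weights `w` and a factor
`r` at the root, and `w` satisfies the convergence criterion `∫ d|μ|(y) w(x,y) e^{a(y)} ≤ a(x)` at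
every point `x`. -/
structure IsTreeBound (μ : ComplexMeasure X) (u : PairInteraction X) (a : X → ℝ) (r : X → ℝ≥0∞)
    (w : X → X → ℝ≥0∞) : Prop where
  measurable : Measurable fun p : X × X => w p.1 p.2
  lintegral_le : ∀ x, ∫⁻ y, w x y * ENNReal.ofReal (Real.exp (a y)) ∂μ.variation ≤
    ENNReal.ofReal (a x)
  ae_enorm_ursellSum_le : ∀ n, ∀ᵐ x ∂absPi μ (n + 1),
    ‖u.ursellSum x‖ₑ ≤ r (x 0) * forestSum (fun i j => w (x i) (x j)) {0} (univ.erase 0)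

variable {μ : ComplexMeasure X} [IsFiniteMeasure μ.variation] {u : PairInteraction X} {a b : X → ℝ}

-- The weights are set to `0` on the null set of points where the criterion fails.
lemma exists_isTreeBound_of_ae {r g : X → ℝ≥0∞} {κ : X → X → ℝ≥0∞} (ha : Measurable a)
    (hg : Measurable g) (hgr : ∀ x, g x ≤ r x) (hκ : Measurable fun p : X × X => κ p.1 p.2)
    (hcrit : ∀ᵐ x ∂μ.variation, ∫⁻ y, κ x y * g y * ENNReal.ofReal (Real.exp (a y)) ∂μ.variation ≤
      ENNReal.ofReal (a x))
    (hle : ∀ n, ∀ᵐ x ∂absPi μ (n + 1), ‖u.ursellSum x‖ₑ ≤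
      (∏ i, g (x i)) * forestSum (fun i j => κ (x i) (x j)) {0} (univ.erase 0)) :
    ∃ w, IsTreeBound μ u a r w := by
  classical
  set S : Set X := {x | ∫⁻ y, κ x y * g y * ENNReal.ofReal (Real.exp (a y)) ∂μ.variation ≤
    ENNReal.ofReal (a x)}
  have hκg : Measurable fun p : X × X => κ p.1 p.2 * g p.2 := hκ.mul (hg.comp measurable_snd)
  have hS : MeasurableSet S := measurableSet_le (Measurable.lintegral_prod_right'
    (f := fun p : X × X => κ p.1 p.2 * g p.2 * ENNReal.ofReal (Real.exp (a p.2)))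
    (hκg.mul (by fun_prop))) (by fun_prop)
  refine ⟨fun x y => if x ∈ S then κ x y * g y else 0,
    Measurable.ite (measurable_fst hS) hκg measurable_const, fun x => ?_, fun n => ?_⟩
  · by_cases hx : x ∈ S
    · simp only [if_pos hx]
      exact hx
    · simp [hx]
  · have hall : ∀ᵐ x ∂absPi μ (n + 1), ∀ i, x i ∈ S := ae_all_iff.2 fun i =>
      (Measure.quasiMeasurePreserving_eval (fun _ => μ.variation) i).ae hcrit
    filter_upwards [hall, hle n] with x hx hxle
    simp only [hx, if_true]
    rw [forestSum_mul_right (fun i j => κ (x i) (x j)) (fun j => g (x j)) (by simp), ← mul_assoc]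
    refine hxle.trans ?_
    rw [← mul_prod_erase univ _ (mem_univ 0)]
    gcongr
    exact hgr _

lemma Stable.ae_forall_finset (h : Stable μ u b) (n : ℕ) :
    ∀ᵐ x ∂absPi μ n, ∀ A : Finset (Fin n),
      ∏ p ∈ pairs A, ‖1 + u.zeta (x p.1) (x p.2)‖ ≤ ∏ i ∈ A, Real.exp (b (x i)) := by
  refine ae_all_iff.2 fun A => ?_
  have hrestrict := Measure.quasiMeasurePreserving_fst.comp
    (measurePreserving_restrict_compl μ.variation (A := A) rfl rfl).quasiMeasurePreserving
  filter_upwards [hrestrict.ae (h #A)] with x hx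
  have hpairs := prod_pairs_map (A.orderEmbOfFin rfl) (fun i j => ‖1 + u.zeta (x i) (x j)‖) univ
  have hprod := prod_map univ (A.orderEmbOfFin rfl).toEmbedding fun i => Real.exp (b (x i))
  rw [map_orderEmbOfFin_univ A rfl] at hpairs hprod
  rw [hpairs, hprod]
  simp only [pairs, univ_product_univ]
  exact hx

lemma enorm_mul_ofReal_exp_mul_ofReal_exp {E : Type*} [NormedAddCommGroup E] (z : E) (s t : ℝ) :
    ‖z‖ₑ * ENNReal.ofReal (Real.exp s) * ENNReal.ofReal (Real.exp t) =
      ENNReal.ofReal (‖z‖ * Real.exp (t + s)) := by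
  rw [ENNReal.ofReal_mul (norm_nonneg z), add_comm, Real.exp_add,
    ENNReal.ofReal_mul (Real.exp_pos s).le, mul_assoc, ofReal_norm]

lemma Stable.exists_isTreeBound_of_zetaCriterion (hstable : Stable μ u b) (ha : Measurable a)
    (hb : Measurable b) (hcrit : ZetaCriterion μ u a b) :
    ∃ w, IsTreeBound μ u a (fun x => ENNReal.ofReal (Real.exp (2 * b x))) w := by
  refine exists_isTreeBound_of_ae (g := fun x => ENNReal.ofReal (Real.exp (2 * b x)))
    (κ := fun x y => ‖u.zeta x y‖ₑ) ha (by fun_prop) (fun x => le_rfl) u.measurable_zeta.enorm ?_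
    fun n => ?_
  · simp only [enorm_mul_ofReal_exp_mul_ofReal_exp]
    exact hcrit
  · filter_upwards [hstable.ae_forall_finset (n + 1)] with x hx
    refine enorm_le_prod_mul_forestSum_enorm (fun _ => (Real.exp_pos _).le)
      (disjoint_singleton_left.2 (notMem_erase _ _)) ?_
    simpa only [← Real.exp_nat_mul, Nat.cast_ofNat] using u.norm_ursellSum_le_forestSum_zeta hx

lemma Stable.exists_isTreeBound_of_ubarCriterion (hstable : Stable μ u b) (ha : Measurable a)
    (hb : Measurable b) (hb0 : ∀ x, 0 ≤ b x) (hcrit : UbarCriterion μ u a b) :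
    ∃ w, IsTreeBound μ u a (fun x => ENNReal.ofReal (Real.exp (2 * b x))) w := by
  refine exists_isTreeBound_of_ae (g := fun x => ENNReal.ofReal (Real.exp (b x)))
    (κ := fun x y => ‖u.ubar x y‖ₑ) ha (by fun_prop) (fun x => ?_) u.measurable_ubar.enorm ?_
    fun n => ?_
  · exact ENNReal.ofReal_le_ofReal (Real.exp_le_exp.2 (by linarith [hb0 x]))
  · simp only [enorm_mul_ofReal_exp_mul_ofReal_exp]
    exact hcrit
  · filter_upwards [hstable.ae_forall_finset (n + 1)] with x hx
    exact enorm_le_prod_mul_forestSum_enorm (fun _ => (Real.exp_pos _).le)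
      (disjoint_singleton_left.2 (notMem_erase _ _)) (u.norm_ursellSum_le_forestSum_ubar hb0 hx)

namespace IsTreeBound

variable {r : X → ℝ≥0∞} {w : X → X → ℝ≥0∞}

lemma lintegral_enorm_ursellSum_le (h : IsTreeBound μ u a r w) (hr : Measurable r) (n : ℕ) :
    ∫⁻ x : Fin (n + 1) → X, ‖u.ursellSum x‖ₑ ∂absPi μ (n + 1) ≤
      ∫⁻ x, r x * treeIntegral μ.variation w n x ∂μ.variation := by
  have hforest : Measurable fun x : Fin (n + 1) → X =>
      forestSum (fun i j => w (x i) (x j)) {0} (univ.erase 0) :=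
    measurable_forestSum h.measurable (by simp)
  have hm := (hr.comp (measurable_pi_apply (0 : Fin (n + 1)))).fun_mul hforest
  refine (lintegral_mono_ae (h.ae_enorm_ursellSum_le n)).trans_eq ?_
  rw [absPi]
  refine ((measurePreserving_vecCons μ.variation n).lintegral_comp hm).symm.trans
    ((lintegral_prod _ (hm.comp (measurable_vecCons n)).aemeasurable).trans ?_)
  refine lintegral_congr fun x => ?_
  simp only [Function.comp_apply, Matrix.cons_val_zero]
  exact lintegral_const_mul _ ((hforest.comp (measurable_vecCons n)).comp measurable_prodMk_left)

theorem tsum_lintegral_enorm_ursellSum_le (h : IsTreeBound μ u a r w) (hr : Measurable r)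
    (ha : Measurable a) (ha0 : ∀ x, 0 ≤ a x) :
    ∑' n : ℕ, ENNReal.ofReal (1 / (n.factorial : ℝ)) *
        ∫⁻ x : Fin (n + 1) → X, ‖u.ursellSum x‖ₑ ∂absPi μ (n + 1) ≤
      ∫⁻ x, r x * ENNReal.ofReal (Real.exp (a x)) ∂μ.variation := by
  have htree : ∀ n, Measurable (treeIntegral μ.variation w n) := fun n =>
    ((measurable_forestSum h.measurable (by simp)).comp
      (measurable_vecCons n)).lintegral_prod_right'
  calc _ ≤ ∑' n : ℕ, ENNReal.ofReal (1 / (n.factorial : ℝ)) *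
          ∫⁻ x, r x * treeIntegral μ.variation w n x ∂μ.variation :=
        ENNReal.tsum_le_tsum fun n => mul_le_mul_right (h.lintegral_enorm_ursellSum_le hr n) _
    _ = ∫⁻ x, ∑' n : ℕ, ENNReal.ofReal (1 / (n.factorial : ℝ)) *
          (r x * treeIntegral μ.variation w n x) ∂μ.variation := by
        rw [lintegral_tsum fun n => ((hr.fun_mul (htree n)).const_mul _).aemeasurable]
        exact tsum_congr fun n => (lintegral_const_mul _ (hr.fun_mul (htree n))).symm
    _ ≤ _ := lintegral_mono fun x => by
        simp_rw [mul_left_comm _ (r x)]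
        rw [ENNReal.tsum_mul_left]
        gcongr
        exact tsum_treeIntegral_le h.measurable ha ha0 h.lintegral_le x

end IsTreeBound

end TreeBounds

section RootedSeriesBound

variable {X : Type*} [MeasurableSpace X] {μ : ComplexMeasure X} {f : ∀ n, (Fin (n + 1) → X) → ℂ}

lemma integrable_of_tsum_lintegral_enorm_ne_top
    (hf : ∀ n, AEStronglyMeasurable (f n) (absPi μ (n + 1)))
    (h : ∑' n : ℕ, ENNReal.ofReal (1 / (n.factorial : ℝ)) * ∫⁻ x, ‖f n x‖ₑ ∂absPi μ (n + 1) ≠ ∞)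
    (n : ℕ) : Integrable (f n) (absPi μ (n + 1)) := by
  refine ⟨hf n, lt_top_iff_ne_top.2 fun htop => ENNReal.ne_top_of_tsum_ne_top h n ?_⟩
  rw [htop, ENNReal.mul_top]
  simpa using n.factorial_ne_zero

lemma summableCoeffs_rootedSeries [IsFiniteMeasure μ.variation]
    (hf : ∀ n, AEStronglyMeasurable (f n) (absPi μ (n + 1)))
    (h : ∑' n : ℕ, ENNReal.ofReal (1 / (n.factorial : ℝ)) * ∫⁻ x, ‖f n x‖ₑ ∂absPi μ (n + 1) ≠ ∞) :
    SummableCoeffs (rootedSeries μ f) := by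
  refine Summable.of_nonneg_of_le (fun _ => norm_nonneg _) (fun n => ?_)
    (ENNReal.summable_toReal h)
  rw [rootedSeries, PowerSeries.coeff_mk, ← toReal_enorm]
  refine ENNReal.toReal_mono (ENNReal.ne_top_of_tsum_ne_top h n) ?_
  rw [enorm_mul]
  gcongr
  · rw [← ofReal_norm, norm_div, norm_one, Complex.norm_natCast]
  · exact enorm_iterInt_le (integrable_of_tsum_lintegral_enorm_ne_top hf h n)

end RootedSeriesBound

section Correlations

open PowerSeries

variable {X : Type*} [MeasurableSpace X] {μ : ComplexMeasure X} {u : PairInteraction X}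
  {a b : X → ℝ}

lemma summableCoeffs_mk_iff {f : ℕ → ℂ} : SummableCoeffs (mk f) ↔ Summable f := by
  simp only [SummableCoeffs, coeff_mk, summable_norm_iff]

lemma coeffSum_mk (f : ℕ → ℂ) : coeffSum (mk f) = ∑' n, f n := by
  simp only [coeffSum, coeff_mk]

lemma integrable_phi_iff {n m : ℕ} {T : (Fin n → X) → Fin (m + 1) → X} :
    Integrable (fun y => u.phi (T y)) (absPi μ n) ↔
      Integrable (fun y => u.ursellSum (T y)) (absPi μ n) := by
  simp only [PairInteraction.phi_eq]
  exact integrable_const_mul_iff (by simp [Nat.factorial_ne_zero]) _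

lemma isFiniteMeasure_of_lintegral_exp_lt_top {ν : Measure X} {f : X → ℝ} (hf : ∀ x, 0 ≤ f x)
    (hint : ∫⁻ y, ENNReal.ofReal (Real.exp (f y)) ∂ν < ∞) : IsFiniteMeasure ν := by
  refine ⟨lt_of_le_of_lt ?_ hint⟩
  rw [← lintegral_one]
  exact lintegral_mono fun y => ENNReal.one_le_ofReal.2 (Real.one_le_exp (hf y))

lemma integrable_exp_of_le {ν : Measure X} {f g : X → ℝ} (hf : Measurable f)
    (hfg : ∀ x, f x ≤ g x) (hint : ∫⁻ y, ENNReal.ofReal (Real.exp (g y)) ∂ν < ∞) :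
    Integrable (fun x => Real.exp (f x)) ν := by
  refine ⟨by fun_prop, lt_of_le_of_lt (lintegral_mono fun y => ?_) hint⟩
  rw [Real.enorm_of_nonneg (Real.exp_pos _).le]
  exact ENNReal.ofReal_le_ofReal (Real.exp_le_exp.2 (hfg y))

lemma constantCoeff_mk_ZTerm_ne_zero (μ : ComplexMeasure X) (u : PairInteraction X) :
    constantCoeff (mk (ZTerm μ u)) ≠ 0 := by
  simp [← coeff_zero_eq_constantCoeff_apply, ZTerm, iterInt, PairInteraction.weight]

lemma Stable.ae_norm_weight_le (h : Stable μ u b) (n : ℕ) :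
    ∀ᵐ x ∂absPi μ n, ‖u.weight x‖ ≤ ∏ i, Real.exp (b (x i)) := by
  filter_upwards [h n] with x hx
  rwa [PairInteraction.weight, norm_prod]

variable [IsFiniteMeasure μ.variation]

lemma Stable.ae_norm_weight_vecCons_le (h : Stable μ u b) (n : ℕ) :
    ∀ᵐ x₁ ∂μ.variation, ∀ᵐ y ∂absPi μ n, ‖u.weight (Matrix.vecCons x₁ y)‖ ≤
      Real.exp (b x₁) * ∏ i, Real.exp (b (y i)) := by
  filter_upwards [ae_vecCons (h.ae_norm_weight_le (n + 1))] with x₁ hx₁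
  filter_upwards [hx₁] with y hy
  simpa only [Fin.prod_univ_succ, Matrix.cons_val_zero, Matrix.cons_val_succ] using hy

lemma Stable.ae_norm_weight_vecCons_vecCons_le (h : Stable μ u b) (n : ℕ) :
    ∀ᵐ p ∂μ.variation.prod μ.variation, ∀ᵐ y ∂absPi μ n,
      ‖u.weight (Matrix.vecCons p.1 (Matrix.vecCons p.2 y))‖ ≤
        Real.exp (b p.1) * Real.exp (b p.2) * ∏ i, Real.exp (b (y i)) := by
  filter_upwards [ae_vecCons_vecCons (h.ae_norm_weight_le (n + 2))] with p hp
  filter_upwards [hp] with y hy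
  simpa only [Fin.prod_univ_succ, Matrix.cons_val_zero, Matrix.cons_val_succ, mul_assoc] using hy

section Identities

variable {x₁ x₂ : X}

lemma Conv₁.Z₁_eq (h₁ : Conv₁ μ u x₁) (hZ : ConvZ μ u) : Z₁ μ u x₁ = Zhat₁ μ u x₁ * Z μ u := by
  have hmk := mk_ZTerm₁_eq hZ.1 fun n => integrable_phi_iff.1 (h₁.2.2.1 n)
  have hsum := congrArg coeffSum hmk
  rwa [(summableCoeffs_mk_iff.2 h₁.2.2.2).coeffSum_mul (summableCoeffs_mk_iff.2 hZ.2),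
    coeffSum_mk, coeffSum_mk, coeffSum_mk] at hsum

lemma Conv₂.Z₂_eq (h₁₂ : Conv₂ μ u x₁ x₂) (h₁ : Conv₁ μ u x₁) (h₂ : Conv₁ μ u x₂)
    (hZ : ConvZ μ u) :
    Z₂ μ u x₁ x₂ = Zhat₁ μ u x₁ * Z₁ μ u x₂ + Zhat₂ μ u x₁ x₂ * Z μ u := by
  have hmk := mk_ZTerm₂_eq hZ.1 h₂.1 (fun n => integrable_phi_iff.1 (h₁.2.2.1 n))
    fun n => integrable_phi_iff.1 (h₁₂.2.2.1 n)
  have hZ' := summableCoeffs_mk_iff.2 hZ.2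
  have hZ₂ := summableCoeffs_mk_iff.2 h₂.2.1
  have hcluster₁ := summableCoeffs_mk_iff.2 h₁.2.2.2
  have hcluster₂ := summableCoeffs_mk_iff.2 h₁₂.2.2.2
  have hsum := congrArg coeffSum hmk
  rwa [(hcluster₁.mul hZ₂).coeffSum_add (hcluster₂.mul hZ'), hcluster₁.coeffSum_mul hZ₂,
    hcluster₂.coeffSum_mul hZ', coeffSum_mk, coeffSum_mk, coeffSum_mk, coeffSum_mk,
    coeffSum_mk] at hsum

end Identities

/-- What the correlation functions need of the hypotheses of the theorem: the Boltzmann weights are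
dominated by a product of integrable functions, and the Ursell functions, integrated over all their
arguments, form an absolutely convergent series. -/
structure IsConvergent (μ : ComplexMeasure X) (u : PairInteraction X) (b : X → ℝ) : Prop where
  stable : Stable μ u b
  integrable_exp : Integrable (fun x => Real.exp (b x)) μ.variation
  integrable_ursellSum : ∀ n,
    Integrable (fun x : Fin (n + 1) → X => u.ursellSum x) (absPi μ (n + 1))
  summableCoeffs_ursellSum : SummableCoeffs (rootedSeries μ fun _ => u.ursellSum)

lemma Stable.isConvergent (hstable : Stable μ u b) (ha : Measurable a) (ha0 : ∀ x, 0 ≤ a x)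
    (hb : Measurable b) (hb0 : ∀ x, 0 ≤ b x)
    (hcrit : ZetaCriterion μ u a b ∨ UbarCriterion μ u a b)
    (hint : ∫⁻ y, ENNReal.ofReal (Real.exp (a y + 2 * b y)) ∂μ.variation < ∞) :
    IsConvergent μ u b := by
  obtain ⟨w, hw⟩ := hcrit.elim (hstable.exists_isTreeBound_of_zetaCriterion ha hb)
    (hstable.exists_isTreeBound_of_ubarCriterion ha hb hb0)
  have htsum := ((hw.tsum_lintegral_enorm_ursellSum_le (by fun_prop) ha ha0).trans_eq
    (lintegral_congr fun x => by
      rw [← ENNReal.ofReal_mul (Real.exp_pos _).le, ← Real.exp_add, add_comm])).trans_lt hint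
  have hmeas : ∀ n, AEStronglyMeasurable (fun x : Fin (n + 1) → X => u.ursellSum x)
    (absPi μ (n + 1)) := fun n => (u.measurable_ursellSum (n + 1)).aestronglyMeasurable
  exact ⟨hstable, integrable_exp_of_le hb (fun x => by linarith [ha0 x, hb0 x]) hint,
    integrable_of_tsum_lintegral_enorm_ne_top hmeas htsum.ne,
    summableCoeffs_rootedSeries hmeas htsum.ne⟩

namespace IsConvergent

lemma integrable_weight (h : IsConvergent μ u b) (n : ℕ) :
    Integrable (fun y : Fin n → X => u.weight y) (absPi μ n) :=
  integrable_of_ae_norm_le_prod (C := 1) h.integrable_exp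
    (u.measurable_weight n).aestronglyMeasurable
    (by simpa only [one_mul] using h.stable.ae_norm_weight_le n)

lemma derivative_mk_ZTerm (h : IsConvergent μ u b) :
    d⁄dX ℂ (PowerSeries.mk (ZTerm μ u)) =
      (rootedSeries μ fun _ => u.ursellSum) * PowerSeries.mk (ZTerm μ u) :=
  ClusterExpansion.derivative_mk_ZTerm h.integrable_weight h.integrable_ursellSum

lemma summableCoeffs_mk_ZTerm (h : IsConvergent μ u b) :
    SummableCoeffs (PowerSeries.mk (ZTerm μ u)) :=
  h.summableCoeffs_ursellSum.of_derivative_eq_mul h.derivative_mk_ZTerm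

lemma summableCoeffs_inv_mk_ZTerm (h : IsConvergent μ u b) :
    SummableCoeffs (PowerSeries.mk (ZTerm μ u))⁻¹ :=
  h.summableCoeffs_ursellSum.inv_of_derivative_eq_mul h.derivative_mk_ZTerm
    (constantCoeff_mk_ZTerm_ne_zero μ u)

theorem convZ (h : IsConvergent μ u b) : ConvZ μ u :=
  ⟨h.integrable_weight, summableCoeffs_mk_iff.1 h.summableCoeffs_mk_ZTerm⟩

theorem Z_ne_zero (h : IsConvergent μ u b) : Z μ u ≠ 0 := by
  rw [Z, ← coeffSum_mk]
  exact coeffSum_ne_zero h.summableCoeffs_mk_ZTerm h.summableCoeffs_inv_mk_ZTerm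
    (constantCoeff_mk_ZTerm_ne_zero μ u)

lemma summableCoeffs_of_mul_mk_ZTerm (h : IsConvergent μ u b) {φ ψ : PowerSeries ℂ}
    (hψ : SummableCoeffs ψ) (hφ : ψ = φ * PowerSeries.mk (ZTerm μ u)) : SummableCoeffs φ := by
  have hinv := hψ.mul h.summableCoeffs_inv_mk_ZTerm
  rwa [hφ, mul_assoc, PowerSeries.mul_inv_cancel _ (constantCoeff_mk_ZTerm_ne_zero μ u),
    mul_one] at hinv

theorem ae_conv₁ (h : IsConvergent μ u b) : ∀ᵐ x₁ ∂μ.variation, Conv₁ μ u x₁ := by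
  filter_upwards [ae_all_iff.2 h.stable.ae_norm_weight_vecCons_le,
    ae_all_iff.2 fun n => ae_integrable_vecCons (h.integrable_ursellSum n)] with x₁ hle hU
  have hmeas : ∀ n, AEStronglyMeasurable (fun y : Fin n → X => u.weight (Matrix.vecCons x₁ y))
      (absPi μ n) := fun n => (((u.measurable_weight (n + 1)).comp (measurable_vecCons n)).comp
    measurable_prodMk_left).aestronglyMeasurable
  have hZ₁ : SummableCoeffs (PowerSeries.mk (ZTerm₁ μ u x₁)) :=
    summableCoeffs_activitySeries h.integrable_exp hmeas hle
  have hcluster := h.summableCoeffs_of_mul_mk_ZTerm hZ₁ (mk_ZTerm₁_eq h.integrable_weight hU)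
  exact ⟨fun n => integrable_of_ae_norm_le_prod h.integrable_exp (hmeas n) (hle n),
    summableCoeffs_mk_iff.1 hZ₁, fun n => integrable_phi_iff.2 (hU n),
    summableCoeffs_mk_iff.1 hcluster⟩

theorem ae_conv₂ (h : IsConvergent μ u b) :
    ∀ᵐ p ∂μ.variation.prod μ.variation, Conv₂ μ u p.1 p.2 := by
  filter_upwards [Measure.quasiMeasurePreserving_fst.ae h.ae_conv₁,
    Measure.quasiMeasurePreserving_snd.ae h.ae_conv₁,
    ae_all_iff.2 h.stable.ae_norm_weight_vecCons_vecCons_le, ae_all_iff.2 fun n =>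
      ae_integrable_vecCons_vecCons (h.integrable_ursellSum (n + 1))] with p h₁ h₂ hle hU
  have hmeas : ∀ n, AEStronglyMeasurable
      (fun y : Fin n → X => u.weight (Matrix.vecCons p.1 (Matrix.vecCons p.2 y)))
      (absPi μ n) := fun n => (((u.measurable_weight (n + 2)).comp
    (measurePreserving_vecCons_vecCons μ.variation n).measurable).comp
      (measurable_prodMk_left (x := p))).aestronglyMeasurable
  have hZ₂ : SummableCoeffs (PowerSeries.mk (ZTerm₂ μ u p.1 p.2)) :=
    summableCoeffs_activitySeries h.integrable_exp hmeas hle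
  have hprod := (summableCoeffs_mk_iff.2 h₁.2.2.2).mul (summableCoeffs_mk_iff.2 h₂.2.1)
  have hcluster := h.summableCoeffs_of_mul_mk_ZTerm (hZ₂.sub hprod) (sub_eq_of_eq_add'
    (mk_ZTerm₂_eq h.integrable_weight h₂.1 (fun n => integrable_phi_iff.1 (h₁.2.2.1 n)) hU))
  exact ⟨fun n => integrable_of_ae_norm_le_prod h.integrable_exp (hmeas n) (hle n),
    summableCoeffs_mk_iff.1 hZ₂, fun n => integrable_phi_iff.2 (hU n),
    summableCoeffs_mk_iff.1 hcluster⟩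

end IsConvergent

end Correlations

end ClusterExpansion

end

open ClusterExpansion in
theorem theorem2 {X : Type*} [MeasurableSpace X] (μ : ComplexMeasure X)
    (u : ClusterExpansion.PairInteraction X) (a b : X → ℝ)
    (ha : Measurable a) (ha0 : ∀ x, 0 ≤ a x) (hb : Measurable b) (hb0 : ∀ x, 0 ≤ b x)
    (hstable : ClusterExpansion.Stable μ u b)
    (hcrit : ClusterExpansion.ZetaCriterion μ u a b ∨ ClusterExpansion.UbarCriterion μ u a b)
    (hint : ∫⁻ y, ENNReal.ofReal (Real.exp (a y + 2 * b y)) ∂μ.variation < ∞) :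
    ClusterExpansion.ConvZ μ u ∧ ClusterExpansion.Z μ u ≠ 0 ∧
    (∀ᵐ x₁ ∂μ.variation,
      ClusterExpansion.Conv₁ μ u x₁ ∧
      ClusterExpansion.Z₁ μ u x₁ / ClusterExpansion.Z μ u = ClusterExpansion.Zhat₁ μ u x₁) ∧
    (∀ᵐ p ∂(μ.variation.prod μ.variation),
      ClusterExpansion.Conv₂ μ u p.1 p.2 ∧
      ClusterExpansion.Z₂ μ u p.1 p.2 / ClusterExpansion.Z μ u =
        ClusterExpansion.Zhat₁ μ u p.1 * ClusterExpansion.Zhat₁ μ u p.2 +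
          ClusterExpansion.Zhat₂ μ u p.1 p.2 ∧
      ClusterExpansion.Z₂ μ u p.1 p.2 / ClusterExpansion.Z μ u -
          ClusterExpansion.Z₁ μ u p.1 * ClusterExpansion.Z₁ μ u p.2 /
            ClusterExpansion.Z μ u ^ 2 =
        ClusterExpansion.Zhat₂ μ u p.1 p.2) := by
  have : IsFiniteMeasure μ.variation :=
    isFiniteMeasure_of_lintegral_exp_lt_top (fun y => by linarith [ha0 y, hb0 y]) hint
  have hconv : IsConvergent μ u b := hstable.isConvergent ha ha0 hb hb0 hcrit hint
  have hZ : Z μ u ≠ 0 := hconv.Z_ne_zero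
  have hone : ∀ᵐ x₁ ∂μ.variation, Conv₁ μ u x₁ ∧ Z₁ μ u x₁ / Z μ u = Zhat₁ μ u x₁ := by
    filter_upwards [hconv.ae_conv₁] with x₁ h₁
    exact ⟨h₁, by rw [h₁.Z₁_eq hconv.convZ, mul_div_cancel_right₀ _ hZ]⟩
  refine ⟨hconv.convZ, hZ, hone, ?_⟩
  filter_upwards [Measure.quasiMeasurePreserving_fst.ae hone,
    Measure.quasiMeasurePreserving_snd.ae hone, hconv.ae_conv₂] with p ⟨h₁, hZ₁⟩ ⟨h₂, hZ₂⟩ h₁₂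
  have htwo : Z₂ μ u p.1 p.2 / Z μ u =
      Zhat₁ μ u p.1 * Zhat₁ μ u p.2 + Zhat₂ μ u p.1 p.2 := by
    rw [h₁₂.Z₂_eq h₁ h₂ hconv.convZ, add_div, mul_div_assoc, hZ₂, mul_div_cancel_right₀ _ hZ]
  refine ⟨h₁₂, htwo, ?_⟩
  rw [htwo, sq, ← div_mul_div_comm, hZ₁, hZ₂, add_sub_cancel_left]
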